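/- **Conventions.** Fix a computable bijection $n\mapsto q_n$ from $\mathbb N$ onto $\mathbb Q$ and the usual pairing $\langle k,n\rangle$ of natural numbers. $\Phi_e^X$ is the partial function computed by the $e$-th oracle program with oracle $X\subseteq\mathbb N$, and $A\oplus B=\{2n:n\in A\}\cup\{2n+1:n\in B\}$. For $x\in\mathbb R$ let $L_x=\{n:q_n<x\}$ and $R_x=\{n:q_n>x\}$ be its strict Dedekind cuts; $S\oplus L_x\oplus R_x$ means $S\oplus(L_x\oplus R_x)$. A *presentation* $\mathcal A=(D,\prec)$ of a countable ordinal $\alpha$ is a well-order of type $\alpha$ on a coinfinite set $D\subseteq\mathbb N$ whose least element, if $\alpha\ne0$, is the number $0$. For $k\in D$ let $\mathcal B_k$ be the restriction of $\mathcal A$ to $\{j\in D:j\prec k\}$. The *$\mathcal A$-jump* $C^{(\mathcal A)}$ of $C\subseteq\mathbb N$ is defined by recursion: it is $C$ if $D=\emptyset$; otherwise $\langle k,n\rangle\in C^{(\mathcal A)}$ if and only if either $k\in D$ and $n\in C^{(\mathcal B_k)}$, or $\mathcal A$ has a $\prec$-greatest element $j$, $k$ is the least number $>j$ not in $D$, and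 $\Phi_n^{C^{(\mathcal B_j)}}(n)$ halts. $\mathcal A$ is *$S$-decidable* if $S$ computes its complete (elementary) diagram, i.e. the set of Gödel numbers of the first-order sentences, with constants for the elements of $D$, that are true in $\mathcal A$. An *index* of $\mathcal A$ relative to $S$ is $d+1$ for any $d$ such that $\Phi_d^S$ is the characteristic function of that diagram, if $\alpha\neq0$; it is $0$ if $\alpha=0$. **Corollary 3.5.** There are two Turing functionals $\Psi$ and $\Theta$ such that for every rational $\epsilon>0$, every set $S\subseteq\mathbb N$, every $S$-decidable presentation $\mathcal A$ of any ordinal $\alpha<\omega_1^S$ (the least ordinal without an $S$-computable presentation) and every index $i$ of $\mathcal A$ relative to $S$, the following holds, where $\Psi_\epsilon=\Psi(\epsilon,i,\cdot)$ and $\Theta_\epsilon=\Theta(\epsilon,i,\cdot)$. The error set $$\mathcal U_{\epsilon,S,\mathcal A}=\bigl\{x\in\mathbb R:\ \Psi_\epsilon^{S^{(\mathcal A)}\oplus L_x\oplus R_x}\ \text{is not the characteristic function of}\ (S\oplus L_x\oplus R_x)^{(\mathcal A)}\bigr\}$$ has Lebesgue measure $<\epsilon$, and it is an $S^{(\mathcal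 A)}$-effective union of rational open intervals, uniformly in $\epsilon$, $S$, $\alpha$ and $\mathcal A$: $$\mathcal U_{\epsilon,S,\mathcal A}=\bigcup\bigl\{(q_a,q_b):\ \Theta_\epsilon^{S^{(\mathcal A)}}(\langle a,b\rangle)\ \text{halts}\bigr\}.$$ Moreover, $\Psi_\epsilon^{S^{(\mathcal A)}\oplus L_x\oplus R_x}$ is total for every $x\in\mathbb R$. -/

import Mathlib

open FirstOrder

/-! ### Turing functionals -/

/-- Programs with access to an oracle: `Nat.Partrec.Code` with one more instruction, `oracle`. -/
inductive OracleCode : Type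
  | zero : OracleCode
  | succ : OracleCode
  | left : OracleCode
  | right : OracleCode
  | oracle : OracleCode
  | pair : OracleCode → OracleCode → OracleCode
  | comp : OracleCode → OracleCode → OracleCode
  | prec : OracleCode → OracleCode → OracleCode
  | rfind : OracleCode → OracleCode

open Classical in
/-- The characteristic function of a set of natural numbers. -/
noncomputable def charFun (S : Set ℕ) (n : ℕ) : ℕ := if n ∈ S then 1 else 0

/-- The partial function computed by a program with oracle set `S`. The clauses are those
of `Nat.RecursiveIn {charFun S}`. -/
noncomputable def OracleCode.eval (S : Set ℕ) : OracleCode → ℕ →. ℕ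
  | .zero => fun _ => Part.some 0
  | .succ => fun n => Part.some (n + 1)
  | .left => fun n => Part.some n.unpair.1
  | .right => fun n => Part.some n.unpair.2
  | .oracle => fun n => Part.some (charFun S n)
  | .pair f g => fun n => Nat.pair <$> f.eval S n <*> g.eval S n
  | .comp f g => fun n => g.eval S n >>= f.eval S
  | .prec f g => fun p =>
      Nat.rec (f.eval S p.unpair.1)
        (fun y ih => ih >>= fun i => g.eval S (Nat.pair p.unpair.1 (Nat.pair y i))) p.unpair.2
  | .rfind f => fun a => Nat.rfind fun n => (fun m => decide (m = 0)) <$> f.eval S (Nat.pair a n)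

/-- The Gödel numbering of programs: the `n`-th program. It is a bijection, see
`OracleCode.ofNat_toNat` and `OracleCode.toNat_ofNat`. -/
def OracleCode.ofNat : ℕ → OracleCode
  | 0 => .zero
  | 1 => .succ
  | 2 => .left
  | 3 => .right
  | 4 => .oracle
  | n + 5 =>
    have h : n / 4 < n + 5 := by omega
    have h₁ : (n / 4).unpair.1 < n + 5 := (Nat.unpair_left_le _).trans_lt h
    have h₂ : (n / 4).unpair.2 < n + 5 := (Nat.unpair_right_le _).trans_lt h
    match n % 4 with
    | 0 => .pair (ofNat (n / 4).unpair.1) (ofNat (n / 4).unpair.2)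
    | 1 => .comp (ofNat (n / 4).unpair.1) (ofNat (n / 4).unpair.2)
    | 2 => .prec (ofNat (n / 4).unpair.1) (ofNat (n / 4).unpair.2)
    | _ => .rfind (ofNat (n / 4))

/-- The Gödel number of a program. -/
def OracleCode.toNat : OracleCode → ℕ
  | .zero => 0
  | .succ => 1
  | .left => 2
  | .right => 3
  | .oracle => 4
  | .pair f g => 4 * Nat.pair f.toNat g.toNat + 5
  | .comp f g => 4 * Nat.pair f.toNat g.toNat + 1 + 5
  | .prec f g => 4 * Nat.pair f.toNat g.toNat + 2 + 5
  | .rfind f => 4 * f.toNat + 3 + 5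

theorem OracleCode.ofNat_toNat (c : OracleCode) : OracleCode.ofNat c.toNat = c := by
  induction c with
  | zero | succ | left | right | oracle => simp [toNat, ofNat]
  | pair f g hf hg | comp f g hf hg | prec f g hf hg =>
    rw [toNat, ofNat]
    simp [Nat.mul_add_div, hf, hg]
  | rfind f hf =>
    rw [toNat, ofNat]
    simp [Nat.mul_add_div, hf]

theorem OracleCode.toNat_ofNat (n : ℕ) : (OracleCode.ofNat n).toNat = n := by
  induction n using Nat.strong_induction_on with
  | _ n ih =>
    match n with
    | 0 | 1 | 2 | 3 | 4 => simp [toNat, ofNat]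
    | n + 5 =>
      have h : n / 4 < n + 5 := by omega
      have h₁ := ih _ ((Nat.unpair_left_le (n / 4)).trans_lt h)
      have h₂ := ih _ ((Nat.unpair_right_le (n / 4)).trans_lt h)
      have h₃ := ih _ h
      rw [ofNat]
      rcases (by omega : n % 4 = 0 ∨ n % 4 = 1 ∨ n % 4 = 2 ∨ n % 4 = 3) with h' | h' | h' | h' <;>
        simp only [h', toNat, h₁, h₂, h₃, Nat.pair_unpair] <;> omega

/-- `Phi e S` is the partial function computed by the `e`-th oracle program with
oracle set `S`. -/
noncomputable def Phi (e : ℕ) (S : Set ℕ) : ℕ →. ℕ := (OracleCode.ofNat e).eval S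

/-- The program `e` with oracle `S` decides the set `B`. -/
def Decides (e : ℕ) (S B : Set ℕ) : Prop := ∀ n, Phi e S n = Part.some (charFun B n)

/-- The join `A ⊕ B` of two sets of natural numbers: evens code `A`, odds code `B`. -/
def setJoin (A B : Set ℕ) : Set ℕ := {m | (∃ n ∈ A, m = 2 * n) ∨ ∃ n ∈ B, m = 2 * n + 1}

/-! ### Presentations of countable ordinals -/

/-- A presentation of a countable ordinal: a well-ordering `lt` of a coinfinite set `dom` of
natural numbers, whose least element is the number `0` if `dom` is nonempty. The empty
presentation is the one of the ordinal `0`. -/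
structure Presentation where
  dom : Set ℕ
  lt : ℕ → ℕ → Prop
  lt_dom : ∀ a b, lt a b → a ∈ dom ∧ b ∈ dom
  wellOrder : IsWellOrder dom (fun a b => lt a b)
  coinfinite : domᶜ.Infinite
  zero_least : dom.Nonempty → 0 ∈ dom ∧ ∀ a ∈ dom, a ≠ 0 → lt 0 a

/-- The presentation of a proper initial segment, with domain `{j | j ≺ k}`. -/
def Presentation.below (A : Presentation) (k : ℕ) : Presentation where
  dom := {j | A.lt j k}
  lt a b := A.lt a b ∧ A.lt a k ∧ A.lt b k
  lt_dom _ _ h := h.2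
  wellOrder := by
    have := A.wellOrder
    let f : {j | A.lt j k} → A.dom := fun j => ⟨j, (A.lt_dom _ _ j.2).1⟩
    have hf : Function.Injective f := fun a b h => Subtype.ext (congrArg (fun x => x.1) h)
    have e : (fun a b : {j | A.lt j k} => A.lt a b ∧ A.lt a k ∧ A.lt b k) ↪r
        (fun a b : A.dom => A.lt a b) :=
      ⟨⟨f, hf⟩, fun {a b} => ⟨fun h => ⟨h, a.2, b.2⟩, fun h => h.1⟩⟩
    exact e.isWellOrder
  coinfinite := A.coinfinite.mono
    (Set.compl_subset_compl.2 fun j (hj : A.lt j k) => (A.lt_dom _ _ hj).1)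
  zero_least := by
    have := A.wellOrder
    rintro ⟨j, hj⟩
    have hj : A.lt j k := hj
    have hd := A.lt_dom _ _ hj
    have hz := A.zero_least ⟨j, hd.1⟩
    have h0 : A.lt 0 k := by
      by_cases h : j = 0
      · exact h ▸ hj
      · exact _root_.trans_of (fun a b : A.dom => A.lt a b)
          (a := ⟨0, hz.1⟩) (b := ⟨j, hd.1⟩) (c := ⟨k, hd.2⟩) (hz.2 j hd.1 h) hj
    exact ⟨h0, fun a ha h => ⟨hz.2 a (A.lt_dom _ _ ha).1 h, h0, ha⟩⟩

/-- The ordinal that is presented. -/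
noncomputable def Presentation.ordinal (A : Presentation) : Ordinal.{0} :=
  haveI := A.wellOrder
  Ordinal.type (fun a b : A.dom => A.lt a b)

theorem Presentation.ordinal_below_lt (A : Presentation) {k : ℕ} (hk : k ∈ A.dom) :
    (A.below k).ordinal < A.ordinal := by
  have := A.wellOrder
  have := (A.below k).wellOrder
  refine Ordinal.type_lt_iff.2 ⟨⟨⟨⟨fun j => ⟨j, (A.lt_dom _ _ j.2).1⟩, ?_⟩, ?_⟩, ⟨k, hk⟩, ?_⟩⟩
  · exact fun a b h => Subtype.ext (congrArg (fun x => x.1) h)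
  · intro a b
    exact ⟨fun h => ⟨h, a.2, b.2⟩, fun h => h.1⟩
  · intro b
    exact ⟨fun ⟨a, ha⟩ => ha ▸ a.2, fun h => ⟨⟨b, h⟩, rfl⟩⟩

/-- `j` is the greatest element of the presentation. -/
def Presentation.IsGreatest (A : Presentation) (j : ℕ) : Prop :=
  j ∈ A.dom ∧ ∀ i ∈ A.dom, i ≠ j → A.lt i j

/-- The iterated jump `C^(A)` along a presentation `A`. For the empty presentation it is `C`.
Otherwise it consists of the codes `⟨k, n⟩` such that `k ∈ dom A` and `n ∈ C^(A.below k)`, or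
`A` has a greatest element `j`, `k` is the least number above `j` outside `dom A`, and
the `n`-th program with oracle `C^(A.below j)` halts on input `n`. -/
noncomputable def Presentation.jump (C : Set ℕ) (A : Presentation) : Set ℕ :=
  {m | (A.dom = ∅ ∧ m ∈ C) ∨
    (∃ _ : m.unpair.1 ∈ A.dom, m.unpair.2 ∈ jump C (A.below m.unpair.1)) ∨
    (∃ j, ∃ _ : A.IsGreatest j, IsLeast {k | j < k ∧ k ∉ A.dom} m.unpair.1 ∧
      (Phi m.unpair.2 (jump C (A.below j)) m.unpair.2).Dom)}
termination_by A.ordinal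
decreasing_by
  · exact A.ordinal_below_lt (by assumption)
  · exact A.ordinal_below_lt (Presentation.IsGreatest.eq_1 A j ▸ ‹A.IsGreatest j›).1

theorem Presentation.mem_jump_iff (C : Set ℕ) (A : Presentation) (m : ℕ) :
    m ∈ A.jump C ↔ (A.dom = ∅ ∧ m ∈ C) ∨
      (m.unpair.1 ∈ A.dom ∧ m.unpair.2 ∈ (A.below m.unpair.1).jump C) ∨
      (∃ j, A.IsGreatest j ∧ IsLeast {k | j < k ∧ k ∉ A.dom} m.unpair.1 ∧
        (Phi m.unpair.2 ((A.below j).jump C) m.unpair.2).Dom) := by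
  rw [Presentation.jump]
  simp only [Set.mem_ofPred_eq, exists_prop]

/-! ### Complete diagrams -/

/-- The presentation as a first-order structure in the language of orders. -/
@[reducible] def Presentation.str (A : Presentation) : Language.order.Structure A.dom :=
  @Language.orderStructure A.dom ⟨fun a b => a = b ∨ A.lt a b⟩

/-- Gödel numbers of terms; the only terms are constants from `D` and bound variables. -/
def termCode {D : Set ℕ} {n : ℕ} : Language.order.Term (D ⊕ Fin n) → ℕ
  | .var (.inl d) => 2 * d
  | .var (.inr i) => 2 * i + 1
  | .func f _ => Empty.elim f

/-- Gödel numbers of formulas in the language of orders with constants from `D`. -/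
def formulaCode {D : Set ℕ} : {n : ℕ} → Language.order.BoundedFormula D n → ℕ
  | _, .falsum => 0
  | _, .equal s t => 4 * Nat.pair (termCode s) (termCode t) + 1
  | _, .rel (l := 2) _ ts => 4 * Nat.pair (termCode (ts 0)) (termCode (ts 1)) + 2
  | _, .rel (l := _) _ _ => 0
  | _, .imp φ ψ => 4 * Nat.pair (formulaCode φ) (formulaCode ψ) + 3
  | _, .all φ => 4 * formulaCode φ + 4

/-- The complete (elementary) diagram of a presentation: the Gödel numbers of all first-order
sentences with constants from the domain (formulas whose free variables are the elements
of the domain, standing for themselves) that are true in it. -/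
def Presentation.completeDiagram (A : Presentation) : Set ℕ :=
  {m | ∃ φ : Language.order.Formula A.dom,
    formulaCode φ = m ∧ @Language.Formula.Realize _ _ A.str _ φ id}

/-- `A` is an `S`-decidable presentation, and `i` is an index for it: a program deciding the
complete diagram of `A` from the oracle `S`, shifted by one; the index `0` is
reserved for the empty presentation, the only one of the ordinal `0`. -/
def Presentation.IsIndex (A : Presentation) (S : Set ℕ) (i : ℕ) : Prop :=
  (A.dom = ∅ ∧ i = 0) ∨ (A.dom.Nonempty ∧ ∃ d, i = d + 1 ∧ Decides d S A.completeDiagram)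

/-! ### Dedekind cuts and the error set -/

/-- The strict left Dedekind cut of `x`, through an enumeration `q` of the rationals. -/
def leftCut (q : ℕ ≃ ℚ) (x : ℝ) : Set ℕ := {n | (q n : ℝ) < x}

/-- The strict right Dedekind cut of `x`, through an enumeration `q` of the rationals. -/
def rightCut (q : ℕ ≃ ℚ) (x : ℝ) : Set ℕ := {n | x < (q n : ℝ)}

/-- `S ⊕ L_x ⊕ R_x`. -/
def withCuts (q : ℕ ≃ ℚ) (S : Set ℕ) (x : ℝ) : Set ℕ :=
  setJoin S (setJoin (leftCut q x) (rightCut q x))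

/-- The functional number `p`, with the rational `ε` and the index `i` of a presentation
as its parameters, run with oracle `X`. -/
noncomputable def functionalAt (q : ℕ ≃ ℚ) (p : ℕ) (ε : ℚ) (i : ℕ) (X : Set ℕ) : ℕ →. ℕ :=
  fun n => Phi p X (Nat.pair (Nat.pair (q.symm ε) i) n)

/-- The set of the real numbers `x` for which `Ψ_ε` with oracle `S^(A) ⊕ L_x ⊕ R_x` is not
the characteristic function of `(S ⊕ L_x ⊕ R_x)^(A)`. -/
def errorSet (q : ℕ ≃ ℚ) (p : ℕ) (ε : ℚ) (i : ℕ) (S : Set ℕ) (A : Presentation) : Set ℝ :=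
  {x | ¬ ∀ n, functionalAt q p ε i (withCuts q (A.jump S) x) n =
    Part.some (charFun (A.jump (withCuts q S x)) n)}

/-! The procedure works with the dyadic cells `[r / 2 ^ t - s, (r + 1) / 2 ^ t - s)` of `[-s, s)`.
From the iterated jump of `S` it enumerates which cells force, up to a controlled error, which bits
of the iterated jump of `S ⊕ L_x ⊕ R_x`. At the empty segment, a cell on one side of a rational
number settles the two cut bits; a column that belongs to the domain is handed to a smaller initial
segment; a column that belongs neither to the domain nor to the jump is empty.

The essential case is the jump column. A halting computation uses finitely many bits, so the points
at which it halts form an increasing union, over the levels `t`, of the cells in `Halts`. This union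
has finite measure in `[-s, s)`, hence from some level on at most `2 ^ (-w)` is missing
(`exists_not_large`). The halting set of the previous iterated jump of `S` decides which cells of a
level force halting and whether more than `2 ^ (-w)` is still to come. It therefore finds such a
level, and non-halting is declared on all the other cells. This is wrong only on cells that turn up
later; they are enumerable, and their measure is at most `2 ^ (-w)` whichever level is chosen
(`volume_le_of_not_large`).

The weights `w` are summable over all segments, programs and windows. Rational numbers, where the
two strict cuts are not complementary, are covered by small intervals. These intervals and cells
make up `unsafeSet`, of measure less than `ε` (`volume_unsafeSet_le`); off it, induction on ordinals
shows that all answers are right (`correct_seg`).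

To have the error set equal to `unsafeSet`, the final program also searches for a proof that `x` is
unsafe, which is a `Σ₁` event. If there is one, the search of `exists_select` outputs the impossible
value `2` for at least one input. The search ends in either case, which gives totality.

All notions are kept uniformly `Σ₁` in the oracle (`Sigma1`). The recursion is a fixed point in the
sense of Kleene (`Sigma1.fixed_point`): only its equation is needed, since well-foundedness enters
through the correctness proof. -/

section

open Encodable

/-! ### Oracle programs for ordinary computable functions. -/

namespace OracleCode

theorem exists_of_partrec {f : ℕ →. ℕ} (hf : Nat.Partrec f) :
    ∃ c : OracleCode, ∀ S, c.eval S = f := by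
  induction hf with
  | zero => exact ⟨.zero, fun S => by funext n; rfl⟩
  | succ => exact ⟨.succ, fun S => by funext n; rfl⟩
  | left => exact ⟨.left, fun S => by funext n; rfl⟩
  | right => exact ⟨.right, fun S => by funext n; rfl⟩
  | pair _ _ hf hg =>
    obtain ⟨cf, hf⟩ := hf
    obtain ⟨cg, hg⟩ := hg
    exact ⟨.pair cf cg, fun S => by funext n; simp only [eval, hf S, hg S]⟩
  | comp _ _ hf hg =>
    obtain ⟨cf, hf⟩ := hf
    obtain ⟨cg, hg⟩ := hg
    exact ⟨.comp cf cg, fun S => by funext n; simp only [eval, hf S, hg S]⟩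
  | prec _ _ hf hg =>
    obtain ⟨cf, hf⟩ := hf
    obtain ⟨cg, hg⟩ := hg
    exact ⟨.prec cf cg, fun S => by funext n; simp only [eval, hf S, hg S]⟩
  | rfind _ hf =>
    obtain ⟨cf, hf⟩ := hf
    exact ⟨.rfind cf, fun S => by funext n; simp only [eval, hf S]⟩

theorem exists_of_primrec {f : ℕ → ℕ} (hf : Primrec f) :
    ∃ c : OracleCode, ∀ S n, c.eval S n = Part.some (f n) := by
  obtain ⟨c, hc⟩ := exists_of_partrec (Nat.Partrec.of_primrec (Primrec.nat_iff.1 hf))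
  exact ⟨c, fun S n => by rw [hc S]; rfl⟩

theorem eval_comp_of_eq {S : Set ℕ} {f g : OracleCode} {n m : ℕ} (h : g.eval S n = Part.some m) :
    (comp f g).eval S n = f.eval S m := by
  simp only [eval, h]
  exact Part.bind_some _ _

theorem eval_pair_of_eq {S : Set ℕ} {f g : OracleCode} {n a b : ℕ} (hf : f.eval S n = Part.some a)
    (hg : g.eval S n = Part.some b) : (pair f g).eval S n = Part.some (Nat.pair a b) := by
  simp [eval, hf, hg, Seq.seq]

theorem eval_prec_of_eq {S : Set ℕ} {f g : OracleCode} {F : ℕ → ℕ} {G : ℕ → ℕ → ℕ → ℕ}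
    (hf : ∀ a, f.eval S a = Part.some (F a))
    (hg : ∀ a y i, g.eval S (Nat.pair a (Nat.pair y i)) = Part.some (G a y i)) (a n : ℕ) :
    (prec f g).eval S (Nat.pair a n) = Part.some (Nat.rec (F a) (fun y i => G a y i) n) := by
  simp only [eval, Nat.unpair_pair]
  induction n with
  | zero => exact hf a
  | succ n ih =>
    simp only [ih]
    simp [hg]

end OracleCode

/-! ### Finite lists of facts about the oracle, and search for a valid one. -/

/-- A finite list of facts about membership is true of `Y`. -/
def Holds (σ : List (ℕ × Bool)) (Y : Set ℕ) : Prop := ∀ p ∈ σ, p.1 ∈ Y ↔ p.2 = true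

@[simp] theorem holds_nil (Y : Set ℕ) : Holds [] Y := by simp [Holds]

@[simp] theorem holds_append (σ τ : List (ℕ × Bool)) (Y : Set ℕ) :
    Holds (σ ++ τ) Y ↔ Holds σ Y ∧ Holds τ Y := by
  simp only [Holds, List.mem_append, or_imp, forall_and]

@[simp] theorem holds_cons (p : ℕ × Bool) (τ : List (ℕ × Bool)) (Y : Set ℕ) :
    Holds (p :: τ) Y ↔ (p.1 ∈ Y ↔ p.2 = true) ∧ Holds τ Y := by
  simp [Holds]

theorem charFun_eq_bool (Y : Set ℕ) (n : ℕ) (b : Bool) :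
    charFun Y n = b.toNat ↔ (n ∈ Y ↔ b = true) := by
  unfold charFun
  split_ifs with h <;> cases b <;> simp [h]

open Classical in
-- The matrix of a `Σ₁` search: `T` needs no oracle, and the finitely many facts that it returns are
-- compared with the oracle one by one.
theorem exists_check {T : ℕ → ℕ → Option (List (ℕ × Bool))} (hT : Primrec₂ T) :
    ∃ c : OracleCode, ∀ Y x w, c.eval Y (Nat.pair x w) =
      Part.some (if ∃ σ, T x w = some σ ∧ Holds σ Y then 0 else 1) := by
  have hN : Primrec fun N : ℕ => T N.unpair.1 N.unpair.2 :=
    hT.comp (Primrec.fst.comp .unpair) (Primrec.snd.comp .unpair)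
  obtain ⟨ci, hci⟩ := OracleCode.exists_of_primrec
    (f := fun N => if (T N.unpair.1 N.unpair.2).isSome = true then 0 else 1)
    (Primrec.ite (Primrec.eq.comp (Primrec.option_isSome.comp hN) (.const true))
      (.const 0) (.const 1))
  let fact : ℕ → ℕ → ℕ × Bool :=
    fun N y => (((T N.unpair.1 N.unpair.2).getD [])[y]?).getD (0, false)
  have hfact : Primrec₂ fact := Primrec.option_getD.comp
    (Primrec.list_getElem?.comp
      (Primrec.option_getD.comp (hN.comp Primrec.fst) (.const [])) Primrec.snd) (.const (0, false))
  obtain ⟨cq, hcq⟩ := OracleCode.exists_of_primrec (f := fun M => (fact M.unpair.1 M.unpair.2.unpair.1).1)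
    (Primrec.fst.comp (hfact.comp (Primrec.fst.comp .unpair)
      (Primrec.fst.comp (Primrec.unpair.comp (Primrec.snd.comp .unpair)))))
  obtain ⟨cl, hcl⟩ := OracleCode.exists_of_primrec
    (f := fun N => ((T N.unpair.1 N.unpair.2).getD []).length)
    (Primrec.list_length.comp (Primrec.option_getD.comp hN (.const [])))
  obtain ⟨cid, hcid⟩ := OracleCode.exists_of_primrec (f := fun N => N) Primrec.id
  have hb : Primrec Bool.toNat := (Primrec.dom_finite _)
  obtain ⟨ch, hch⟩ := OracleCode.exists_of_primrec
    (f := fun M => if M.unpair.2.unpair.2.unpair.2 = 0 ∧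
      M.unpair.1 = (fact M.unpair.2.unpair.1 M.unpair.2.unpair.2.unpair.1).2.toNat then 0 else 1) (by
    have h1 : Primrec fun M : ℕ => M.unpair.1 := Primrec.fst.comp .unpair
    have h2 : Primrec fun M : ℕ => M.unpair.2 := Primrec.snd.comp .unpair
    exact Primrec.ite ((Primrec.eq.comp (h2.comp (h2.comp h2)) (.const 0)).and
      (Primrec.eq.comp h1 (hb.comp (Primrec.snd.comp
        (hfact.comp (h1.comp h2) (h1.comp (h2.comp h2))))))) (.const 0) (.const 1))
  -- The primitive recursion over the list carries `0` as long as every fact tested is true, and `1`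
  -- after a failure; `ci` starts it at `1` if `T` returns `none`.
  let cg : OracleCode := .comp ch (.pair (.comp .oracle cq) cid)
  refine ⟨.comp (.prec ci cg) (.pair cid cl), fun Y x w => ?_⟩
  have hg : ∀ a y i, cg.eval Y (Nat.pair a (Nat.pair y i)) =
      Part.some (if i = 0 ∧ charFun Y (fact a y).1 = (fact a y).2.toNat then 0 else 1) := by
    intro a y i
    rw [OracleCode.eval_comp_of_eq (OracleCode.eval_pair_of_eq
      (OracleCode.eval_comp_of_eq (hcq Y _)) (hcid Y _)), hch]
    simp
  rw [OracleCode.eval_comp_of_eq (OracleCode.eval_pair_of_eq (hcid Y _) (hcl Y _)),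
    OracleCode.eval_prec_of_eq (hci Y) hg]
  congr 1
  simp only [Nat.unpair_pair]
  have key : ∀ n, (Nat.rec (if (T x w).isSome = true then 0 else 1)
      (fun y i => if i = 0 ∧ charFun Y (fact (Nat.pair x w) y).1 =
        (fact (Nat.pair x w) y).2.toNat then 0 else 1) n : ℕ) =
      if (T x w).isSome = true ∧ ∀ y < n, charFun Y (fact (Nat.pair x w) y).1 =
        (fact (Nat.pair x w) y).2.toNat then 0 else 1 := by
    intro n
    induction n with
    | zero => simp
    | succ n ih =>
      simp only [ih, Nat.lt_succ_iff_lt_or_eq, or_imp, forall_and, forall_eq]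
      split_ifs <;> simp_all
  refine (key _).trans ?_
  congr 1
  cases h : T x w with
  | none => simp
  | some σ =>
    simp only [Option.isSome_some, true_and, Option.getD_some, Option.some.injEq, exists_eq_left',
      fact, Nat.unpair_pair, h, Holds, eq_iff_iff]
    constructor
    · intro H p hp
      obtain ⟨y, hy, rfl⟩ := List.getElem_of_mem hp
      have := H y hy
      rw [charFun_eq_bool] at this
      simpa [hy] using this
    · intro H y hy
      rw [charFun_eq_bool]
      simpa [hy] using H _ (List.getElem_mem hy)

/-- The program that returns the value attached to the least valid witness. -/
theorem exists_search {α : Type*} [Primcodable α] {T : α → ℕ → Option (ℕ × List (ℕ × Bool))}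
    (hT : Primrec₂ T) :
    ∃ c : OracleCode, ∀ Y a v, v ∈ c.eval Y (encode a) ↔
      ∃ w σ, T a w = some (v, σ) ∧ Holds σ Y ∧
        ∀ w' < w, ∀ v' σ', T a w' = some (v', σ') → ¬ Holds σ' Y := by
  classical
  let T' : ℕ → ℕ → Option (ℕ × List (ℕ × Bool)) :=
    fun x w => (decode (α := α) x).bind fun a => T a w
  have hT' : Primrec₂ T' := Primrec.option_bind (Primrec.decode.comp Primrec.fst)
    (hT.comp Primrec.snd (Primrec.snd.comp Primrec.fst))
  obtain ⟨ck, hck⟩ := exists_check (T := fun x w => (T' x w).map Prod.snd)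
    (Primrec.option_map hT' (Primrec.snd.comp Primrec.snd))
  obtain ⟨cv, hcv⟩ := OracleCode.exists_of_primrec
    (f := fun M => ((T' M.unpair.1 M.unpair.2).map Prod.fst).getD 0)
    (Primrec.option_getD.comp (Primrec.option_map (hT'.comp (Primrec.fst.comp .unpair)
      (Primrec.snd.comp .unpair)) (Primrec.fst.comp Primrec.snd)) (.const 0))
  obtain ⟨cid, hcid⟩ := OracleCode.exists_of_primrec (f := fun N => N) Primrec.id
  refine ⟨.comp cv (.pair cid (.rfind ck)), fun Y a v => ?_⟩
  have hr : ∀ w, w ∈ (OracleCode.rfind ck).eval Y (encode a) ↔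
      (∃ v σ, T a w = some (v, σ) ∧ Holds σ Y) ∧
        ∀ w' < w, ∀ v' σ', T a w' = some (v', σ') → ¬ Holds σ' Y := by
    intro w
    have key : ∀ w, (∃ σ, (T' (encode a) w).map Prod.snd = some σ ∧ Holds σ Y) ↔
        ∃ v σ, T a w = some (v, σ) ∧ Holds σ Y := by
      intro w
      simp only [T', encodek, Option.bind_some, Option.map_eq_some_iff]
      constructor
      · rintro ⟨σ, ⟨⟨v, σ'⟩, h, rfl⟩, h'⟩
        exact ⟨v, σ', h, h'⟩
      · rintro ⟨v, σ, h, h'⟩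
        exact ⟨σ, ⟨_, h, rfl⟩, h'⟩
    simp only [OracleCode.eval, hck, key]
    refine Nat.mem_rfind.trans ?_
    simp only [Part.map_eq_map, Part.map_some, Part.mem_some_iff]
    refine and_congr (by by_cases h : ∃ v σ, T a w = some (v, σ) ∧ Holds σ Y <;> simp [h]) ?_
    refine forall_congr' fun w' => forall_congr' fun _ => ?_
    by_cases h : ∃ v σ, T a w' = some (v, σ) ∧ Holds σ Y
    · simp only [h, if_true]
      simp only [decide_true, Bool.false_eq_true, false_iff]
      push Not
      obtain ⟨v, σ, h, h'⟩ := h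
      exact ⟨v, σ, h, h'⟩
    · simp only [h, if_false]
      push Not at h
      simpa using h
  have : v ∈ (OracleCode.comp cv (.pair cid (.rfind ck))).eval Y (encode a) ↔
      ∃ w ∈ (OracleCode.rfind ck).eval Y (encode a), v = ((T' (encode a) w).map Prod.fst).getD 0 := by
    have h : (OracleCode.comp cv (.pair cid (.rfind ck))).eval Y (encode a) =
        ((OracleCode.rfind ck).eval Y (encode a)).bind fun w =>
          cv.eval Y (Nat.pair (encode a) w) := by
      simp only [OracleCode.eval.eq_7, OracleCode.eval.eq_6, hcid]
      simp only [Seq.seq, Part.map_eq_map, Part.map_some, Part.bind_some]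
      exact Part.bind_map _ _ _
    rw [h, Part.mem_bind_iff]
    simp only [hcv, Part.mem_some_iff, Nat.unpair_pair]
  rw [this]
  simp only [hr, T', encodek, Option.bind_some]
  constructor
  · rintro ⟨w, ⟨⟨v', σ, h, h'⟩, hl⟩, rfl⟩
    exact ⟨w, σ, by simp [h], h', hl⟩
  · rintro ⟨w, σ, h, h', hl⟩
    exact ⟨w, ⟨⟨v, σ, h, h'⟩, hl⟩, by simp [h]⟩

end

/-! ### Computable functions and predicates that are uniformly `Σ₁` in an oracle. -/

section

open Encodable

namespace Computable

variable {α β γ : Type*} [Primcodable α] [Primcodable β] [Primcodable γ]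

attribute [fun_prop] Computable Computable.id Computable.const Computable.comp

@[fun_prop]
theorem fst_comp {f : α → β × γ} (hf : Computable f) : Computable fun a => (f a).1 := fst.comp hf

@[fun_prop]
theorem snd_comp {f : α → β × γ} (hf : Computable f) : Computable fun a => (f a).2 := snd.comp hf

@[fun_prop]
theorem prodMk {f : α → β} {g : α → γ} (hf : Computable f) (hg : Computable g) :
    Computable fun a => (f a, g a) := pair hf hg

@[fun_prop]
theorem nat_add {f g : α → ℕ} (hf : Computable f) (hg : Computable g) :
    Computable fun a => f a + g a := Primrec.nat_add.to_comp.comp hf hg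

@[fun_prop]
theorem nat_sub {f g : α → ℕ} (hf : Computable f) (hg : Computable g) :
    Computable fun a => f a - g a := Primrec.nat_sub.to_comp.comp hf hg

@[fun_prop]
theorem nat_mul {f g : α → ℕ} (hf : Computable f) (hg : Computable g) :
    Computable fun a => f a * g a := Primrec.nat_mul.to_comp.comp hf hg

@[fun_prop]
theorem nat_div {f g : α → ℕ} (hf : Computable f) (hg : Computable g) :
    Computable fun a => f a / g a := Primrec.nat_div.to_comp.comp hf hg

@[fun_prop]
theorem nat_pow {f g : α → ℕ} (hf : Computable f) (hg : Computable g) :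
    Computable fun a => f a ^ g a :=
  (Primrec₂.unpaired'.1 Nat.Primrec.pow).to_comp.comp hf hg

@[fun_prop]
theorem natPair {f g : α → ℕ} (hf : Computable f) (hg : Computable g) :
    Computable fun a => Nat.pair (f a) (g a) := Primrec₂.natPair.to_comp.comp hf hg

@[fun_prop]
theorem natUnpair {f : α → ℕ} (hf : Computable f) : Computable fun a => Nat.unpair (f a) :=
  unpair.comp hf

@[fun_prop]
theorem listRange {f : α → ℕ} (hf : Computable f) : Computable fun a => List.range (f a) :=
  Primrec.list_range.to_comp.comp hf

end Computable

section

variable {α β γ : Type*} [Primcodable α] [Primcodable β] [Primcodable γ]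

/-- `P Y a` is `Σ₁` in `Y`, uniformly: it holds if and only if some witness `w` computes
from `a` a finite list of facts about membership that are true of `Y`. -/
def Sigma1 (P : Set ℕ → α → Prop) : Prop :=
  ∃ T : α → ℕ → Option (List (ℕ × Bool)), Primrec₂ T ∧
    ∀ Y a, P Y a ↔ ∃ w σ, T a w = some σ ∧ Holds σ Y

namespace Sigma1

theorem of_iff {P Q : Set ℕ → α → Prop} (hP : Sigma1 P) (h : ∀ Y a, Q Y a ↔ P Y a) : Sigma1 Q := by
  obtain ⟨T, hT, H⟩ := hP
  exact ⟨T, hT, fun Y a => (h Y a).trans (H Y a)⟩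

theorem and {P Q : Set ℕ → α → Prop} (hP : Sigma1 P) (hQ : Sigma1 Q) :
    Sigma1 fun Y a => P Y a ∧ Q Y a := by
  obtain ⟨T, hT, H⟩ := hP
  obtain ⟨U, hU, K⟩ := hQ
  refine ⟨fun a w => (T a w.unpair.1).bind fun σ => (U a w.unpair.2).map fun τ => σ ++ τ, ?_, ?_⟩
  · refine Primrec.option_bind
      (hT.comp Primrec.fst (Primrec.fst.comp (Primrec.unpair.comp Primrec.snd))) ?_
    refine Primrec.option_map (hU.comp (Primrec.fst.comp Primrec.fst)
      (Primrec.snd.comp (Primrec.unpair.comp (Primrec.snd.comp Primrec.fst)))) ?_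
    exact Primrec.list_append.comp (Primrec.snd.comp Primrec.fst) Primrec.snd
  · intro Y a
    beta_reduce
    rw [H, K]
    constructor
    · rintro ⟨⟨w, σ, h, hσ⟩, w', τ, h', hτ⟩
      exact ⟨Nat.pair w w', σ ++ τ, by simp [h, h'], by simp [hσ, hτ]⟩
    · rintro ⟨w, ρ, h, hρ⟩
      simp only [Option.bind_eq_some_iff, Option.map_eq_some_iff] at h
      obtain ⟨σ, h, τ, h', rfl⟩ := h
      rw [holds_append] at hρ
      exact ⟨⟨_, σ, h, hρ.1⟩, _, τ, h', hρ.2⟩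

theorem or {P Q : Set ℕ → α → Prop} (hP : Sigma1 P) (hQ : Sigma1 Q) :
    Sigma1 fun Y a => P Y a ∨ Q Y a := by
  obtain ⟨T, hT, H⟩ := hP
  obtain ⟨U, hU, K⟩ := hQ
  refine ⟨fun a w => if w.unpair.1 = 0 then T a w.unpair.2 else U a w.unpair.2, ?_, ?_⟩
  · have h1 : Primrec fun p : α × ℕ => p.2.unpair.1 :=
      Primrec.fst.comp (Primrec.unpair.comp Primrec.snd)
    have h2 : Primrec fun p : α × ℕ => p.2.unpair.2 :=
      Primrec.snd.comp (Primrec.unpair.comp Primrec.snd)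
    exact Primrec.ite (Primrec.eq.comp h1 (.const 0)) (hT.comp .fst h2) (hU.comp .fst h2)
  · intro Y a
    beta_reduce
    rw [H, K]
    constructor
    · rintro (⟨w, σ, h, hσ⟩ | ⟨w, σ, h, hσ⟩)
      · exact ⟨Nat.pair 0 w, σ, by simp [h], hσ⟩
      · exact ⟨Nat.pair 1 w, σ, by simp [h], hσ⟩
    · rintro ⟨w, ρ, h, hρ⟩
      split_ifs at h
      · exact .inl ⟨_, _, h, hρ⟩
      · exact .inr ⟨_, _, h, hρ⟩

theorem ex {P : Set ℕ → α → β → Prop} (hP : Sigma1 fun Y (p : α × β) => P Y p.1 p.2) :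
    Sigma1 fun Y a => ∃ b, P Y a b := by
  obtain ⟨T, hT, H⟩ := hP
  refine ⟨fun a w => (decode (α := β) w.unpair.1).bind fun b => T (a, b) w.unpair.2, ?_, ?_⟩
  · refine Primrec.option_bind
      (Primrec.decode.comp (Primrec.fst.comp (Primrec.unpair.comp Primrec.snd))) ?_
    exact hT.comp ((Primrec.fst.comp Primrec.fst).pair Primrec.snd)
      (Primrec.snd.comp (Primrec.unpair.comp (Primrec.snd.comp Primrec.fst)))
  · intro Y a
    constructor
    · rintro ⟨b, hb⟩
      obtain ⟨w, σ, h, hσ⟩ := (H Y (a, b)).1 hb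
      exact ⟨Nat.pair (encode b) w, σ, by simp [h], hσ⟩
    · rintro ⟨w, σ, h, hσ⟩
      obtain ⟨b, -, h⟩ := Option.bind_eq_some_iff.1 h
      exact ⟨b, (H Y (a, b)).2 ⟨_, _, h, hσ⟩⟩

theorem comp_primrec {P : Set ℕ → β → Prop} (hP : Sigma1 P) {f : α → β} (hf : Primrec f) :
    Sigma1 fun Y a => P Y (f a) := by
  obtain ⟨T, hT, H⟩ := hP
  exact ⟨fun a w => T (f a) w, hT.comp (hf.comp .fst) .snd, fun Y a => H Y (f a)⟩

/-- The time bound of `evaln` is the witness, and no fact about the oracle is needed. -/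
theorem dom {f : α →. β} (hf : Partrec f) : Sigma1 fun _ a => (f a).Dom := by
  obtain ⟨c, hc⟩ := Nat.Partrec.Code.exists_code.1 hf
  refine ⟨fun a w => (Nat.Partrec.Code.evaln w c (encode a)).map fun _ => [], ?_, ?_⟩
  · exact Primrec.option_map (Nat.Partrec.Code.primrec_evaln.comp
      ((Primrec.snd.pair (.const c)).pair (Primrec.encode.comp .fst))) (.const [])
  · intro Y a
    have h1 : (f a).Dom ↔ (c.eval (encode a)).Dom := by
      rw [hc]
      simp
    beta_reduce
    rw [h1, Part.dom_iff_mem]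
    simp only [Nat.Partrec.Code.evaln_complete, Option.map_eq_some_iff, Option.mem_def]
    constructor
    · rintro ⟨y, k, h⟩
      exact ⟨k, [], ⟨y, h, rfl⟩, holds_nil Y⟩
    · rintro ⟨k, _, ⟨y, h, -⟩, -⟩
      exact ⟨y, k, h⟩

theorem re {p : α → Prop} (hp : REPred p) : Sigma1 fun _ a => p a := by
  refine (dom hp).of_iff fun Y a => ?_
  rw [Part.dom_iff_mem]
  simp

theorem graph [DecidableEq β] {f : α → β} (hf : Computable f) :
    Sigma1 fun _ (p : α × β) => f p.1 = p.2 :=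
  re (ComputablePred.to_re
    (Primrec.eq.decide.to_comp.comp (hf.comp Computable.fst) Computable.snd).computablePred)

/-- Witnesses have to be checked primitive recursively, so a merely computable `f` is brought in
through its `Σ₁` graph, the value `f a` being guessed. -/
theorem comp {P : Set ℕ → β → Prop} (hP : Sigma1 P) {f : α → β} (hf : Computable f) :
    Sigma1 fun Y a => P Y (f a) := by
  classical
  refine (ex (P := fun Y a b => f a = b ∧ P Y b)
    ((graph hf).and (hP.comp_primrec Primrec.snd))).of_iff fun Y a => ?_
  simp

theorem ofBool {p : α → Bool} (hp : Computable p) : Sigma1 fun _ a => p a = true :=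
  re (ComputablePred.to_re (Computable.computablePred (by simpa using hp)))

theorem eq [DecidableEq β] {f g : α → β} (hf : Computable f) (hg : Computable g) :
    Sigma1 fun _ a => f a = g a :=
  (graph hf).comp (Computable.id.pair hg)

theorem ne [DecidableEq β] {f g : α → β} (hf : Computable f) (hg : Computable g) :
    Sigma1 fun _ a => f a ≠ g a :=
  re (ComputablePred.to_re (ComputablePred.not
    (Primrec.eq.decide.to_comp.comp hf hg).computablePred))

theorem lt {f g : α → ℕ} (hf : Computable f) (hg : Computable g) :
    Sigma1 fun _ a => f a < g a :=
  re (ComputablePred.to_re (Primrec.nat_lt.decide.to_comp.comp hf hg).computablePred)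

theorem le {f g : α → ℕ} (hf : Computable f) (hg : Computable g) :
    Sigma1 fun _ a => f a ≤ g a :=
  re (ComputablePred.to_re (Primrec.nat_le.decide.to_comp.comp hf hg).computablePred)

theorem fact {f : α → ℕ} {b : α → Bool} (hf : Computable f) (hb : Computable b) :
    Sigma1 fun Y a => f a ∈ Y ↔ b a = true := by
  have : Sigma1 fun Y (p : ℕ × Bool) => p.1 ∈ Y ↔ p.2 = true := by
    refine ⟨fun p _ => some [p], ?_, fun Y p => by simp⟩
    exact Primrec.option_some.comp (Primrec.list_cons.comp .fst (.const []))
  exact this.comp (hf.pair hb)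

theorem mem {f : α → ℕ} (hf : Computable f) : Sigma1 fun Y a => f a ∈ Y :=
  (fact hf (.const true)).of_iff fun Y a => by simp

theorem notMem {f : α → ℕ} (hf : Computable f) : Sigma1 fun Y a => f a ∉ Y :=
  (fact hf (.const false)).of_iff fun Y a => by simp

/-- One number `w` codes a witness for every element of the list: each step consumes `w.unpair.1`,
passes `w.unpair.2` on and adds its facts to those collected. -/
theorem foldl_bind_eq_some {β : Type*} {T : β → ℕ → Option (List (ℕ × Bool))} (l : List β)
    (ρ : List (ℕ × Bool)) (Y : Set ℕ) (hρ : Holds ρ Y) :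
    (∃ w, ∃ q : ℕ × List (ℕ × Bool), l.foldl (fun (s : Option (ℕ × List (ℕ × Bool))) b => s.bind fun q =>
      (T b q.1.unpair.1).map fun σ => (q.1.unpair.2, q.2 ++ σ)) (some (w, ρ)) = some q ∧
        Holds q.2 Y) ↔ ∀ b ∈ l, ∃ w σ, T b w = some σ ∧ Holds σ Y := by
  induction l generalizing ρ with
  | nil => simpa using hρ
  | cons b l ih =>
    simp only [List.foldl_cons, List.forall_mem_cons, Option.bind_some]
    have none_fold : ∀ l : List β, l.foldl (fun (s : Option (ℕ × List (ℕ × Bool))) b => s.bind fun q =>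
        (T b q.1.unpair.1).map fun σ => (q.1.unpair.2, q.2 ++ σ)) none = none := by
      intro l
      induction l with
      | nil => rfl
      | cons b l ih => simpa using ih
    have sub : ∀ (l : List β) (p q : ℕ × List (ℕ × Bool)), l.foldl (fun (s : Option (ℕ × List (ℕ × Bool))) b => s.bind fun q =>
        (T b q.1.unpair.1).map fun σ => (q.1.unpair.2, q.2 ++ σ)) (some p) = some q →
        ∀ f ∈ p.2, f ∈ q.2 := by
      intro l
      induction l with
      | nil =>
        rintro p q h
        simp only [List.foldl_nil, Option.some.injEq] at h
        simp [h]
      | cons b l ih =>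
        rintro p q h f hf
        simp only [List.foldl_cons, Option.bind_some] at h
        cases hT : T b p.1.unpair.1 with
        | none => simp [hT, none_fold] at h
        | some σ =>
          rw [hT] at h
          exact ih _ _ h f (List.mem_append_left _ hf)
    constructor
    · rintro ⟨w, q, h, hq⟩
      cases hT : T b w.unpair.1 with
      | none => simp [hT, none_fold] at h
      | some σ =>
        rw [hT] at h
        have hρσ : Holds (ρ ++ σ) Y := fun f hf => hq f (sub _ _ _ h f hf)
        exact ⟨⟨_, σ, hT, ((holds_append _ _ _).1 hρσ).2⟩, (ih (ρ ++ σ) hρσ).1 ⟨_, q, h, hq⟩⟩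
    · rintro ⟨⟨w, σ, hT, hσ⟩, h⟩
      have hρσ : Holds (ρ ++ σ) Y := (holds_append _ _ _).2 ⟨hρ, hσ⟩
      obtain ⟨w', q, h, hq⟩ := (ih _ hρσ).2 h
      exact ⟨Nat.pair w w', q, by simpa [hT] using h, hq⟩

theorem ball {P : Set ℕ → α → β → Prop} (hP : Sigma1 fun Y (p : α × β) => P Y p.1 p.2)
    {l : α → List β} (hl : Computable l) : Sigma1 fun Y a => ∀ b ∈ l a, P Y a b := by
  obtain ⟨T, hT, H⟩ := hP
  have : Sigma1 fun Y (p : α × List β) => ∀ b ∈ p.2, P Y p.1 b := by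
    refine ⟨fun p w => (p.2.foldl (fun (s : Option (ℕ × List (ℕ × Bool))) b => s.bind fun q =>
      (T (p.1, b) q.1.unpair.1).map fun σ => (q.1.unpair.2, q.2 ++ σ)) (some (w, []))).map
        Prod.snd, ?_, ?_⟩
    · refine Primrec.option_map (Primrec.list_foldl
        (h := fun p (x : Option (ℕ × List (ℕ × Bool)) × β) => x.1.bind fun q =>
          (T (p.1.1, x.2) q.1.unpair.1).map fun σ => (q.1.unpair.2, q.2 ++ σ))
        (Primrec.snd.comp .fst)
        (Primrec.option_some.comp (Primrec.snd.pair (.const []))) ?_) (Primrec.snd.comp .snd)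
      refine Primrec.option_bind (Primrec.fst.comp .snd) ?_
      refine Primrec.option_map (hT.comp
        ((Primrec.fst.comp (.comp .fst (.comp .fst .fst))).pair
          (Primrec.snd.comp (.comp .snd .fst)))
        (Primrec.fst.comp (Primrec.unpair.comp (Primrec.fst.comp .snd)))) ?_
      exact (Primrec.snd.comp (Primrec.unpair.comp (Primrec.fst.comp (.comp .snd .fst)))).pair
        (Primrec.list_append.comp (Primrec.snd.comp (.comp .snd .fst)) .snd)
    · rintro Y ⟨a, l⟩
      have := foldl_bind_eq_some (T := fun b => T (a, b)) l [] Y (holds_nil Y)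
      simp only [← H] at this
      refine this.symm.trans ?_
      constructor
      · rintro ⟨w, q, h, hq⟩
        exact ⟨w, q.2, by simp [h], hq⟩
      · rintro ⟨w, σ, h, hσ⟩
        obtain ⟨q, h', rfl⟩ := Option.map_eq_some_iff.1 h
        exact ⟨w, q, h', hσ⟩
  exact this.comp (Computable.id.pair hl)

theorem ball_lt {P : Set ℕ → α → ℕ → Prop} (hP : Sigma1 fun Y (p : α × ℕ) => P Y p.1 p.2)
    {N : α → ℕ} (hN : Computable N) : Sigma1 fun Y a => ∀ n < N a, P Y a n :=
  (hP.ball (Primrec.list_range.to_comp.comp hN)).of_iff fun Y a => by simp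

/-- A fact about `{n | f a n ∈ Y}` is a fact about `Y` at a renamed number. With `column`, this lets
a recursive call consult a part of the oracle as if it were the whole. -/
theorem preimage {P : Set ℕ → α → Prop} (hP : Sigma1 P) {f : α → ℕ → ℕ} (hf : Primrec₂ f) :
    Sigma1 fun Y a => P {n | f a n ∈ Y} a := by
  obtain ⟨T, hT, H⟩ := hP
  refine ⟨fun a w => (T a w).map fun σ => σ.map fun p => (f a p.1, p.2), ?_, ?_⟩
  · refine Primrec.option_map hT (Primrec.list_map .snd ?_)
    exact (hf.comp (Primrec.fst.comp (.comp .fst .fst)) (Primrec.fst.comp .snd)).pair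
      (Primrec.snd.comp .snd)
  · intro Y a
    beta_reduce
    rw [H]
    have key : ∀ σ, Holds (σ.map fun p => (f a p.1, p.2)) Y ↔ Holds σ {n | f a n ∈ Y} := by
      intro σ
      simp only [Holds, List.forall_mem_map]
      rfl
    constructor
    · rintro ⟨w, σ, h, hσ⟩
      exact ⟨w, _, by simp [h], (key σ).2 hσ⟩
    · rintro ⟨w, _, h, hσ⟩
      obtain ⟨σ, h', rfl⟩ := Option.map_eq_some_iff.1 h
      exact ⟨w, σ, h', (key σ).1 hσ⟩

end Sigma1

end

/-- The `k`-th column of a set of natural numbers. -/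
def column (k : ℕ) (Y : Set ℕ) : Set ℕ := {n | Nat.pair k n ∈ Y}

theorem Sigma1.column {α : Type*} [Primcodable α] {P : Set ℕ → α → Prop} (hP : Sigma1 P)
    {k : α → ℕ} (hk : Computable k) : Sigma1 fun Y a => P (column (k a) Y) a := by
  have : Sigma1 fun Y (p : α × ℕ) => P (_root_.column p.2 Y) p.1 :=
    (hP.comp_primrec (Primrec.fst (β := ℕ))).preimage
      (Primrec₂.natPair.comp (Primrec.snd.comp .fst) .snd)
  exact this.comp (Computable.id.pair hk)

end

/-! ### The use principle: computations from finitely many facts. -/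

section

open Encodable
open Nat.Partrec (Code)

namespace OracleCode

/-- Replace the oracle instruction by an ordinary program. -/
def substOracle (o : Code) : OracleCode → Code
  | .zero => .zero
  | .succ => .succ
  | .left => .left
  | .right => .right
  | .oracle => o
  | .pair f g => .pair (f.substOracle o) (g.substOracle o)
  | .comp f g => .comp (f.substOracle o) (g.substOracle o)
  | .prec f g => .prec (f.substOracle o) (g.substOracle o)
  | .rfind f => .comp (.rfind' (f.substOracle o)) (.pair .id .zero)

theorem mem_eval_pair {S : Set ℕ} {f g : OracleCode} {n v : ℕ} :
    v ∈ (pair f g).eval S n ↔ ∃ a ∈ f.eval S n, ∃ b ∈ g.eval S n, v = Nat.pair a b := by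
  simp [eval, Seq.seq, eq_comm]

theorem mem_eval_comp {S : Set ℕ} {f g : OracleCode} {n v : ℕ} :
    v ∈ (comp f g).eval S n ↔ ∃ a ∈ g.eval S n, v ∈ f.eval S a := by
  simp only [eval]
  exact Part.mem_bind_iff

theorem mem_eval_prec_zero {S : Set ℕ} {f g : OracleCode} {a v : ℕ} :
    v ∈ (prec f g).eval S (Nat.pair a 0) ↔ v ∈ f.eval S a := by
  simp [eval]

theorem mem_eval_prec_succ {S : Set ℕ} {f g : OracleCode} {a k v : ℕ} :
    v ∈ (prec f g).eval S (Nat.pair a (k + 1)) ↔ ∃ i ∈ (prec f g).eval S (Nat.pair a k),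
      v ∈ g.eval S (Nat.pair a (Nat.pair k i)) := by
  simp only [eval, Nat.unpair_pair]
  exact Part.mem_bind_iff

theorem mem_eval_rfind {S : Set ℕ} {f : OracleCode} {a v : ℕ} :
    v ∈ (rfind f).eval S a ↔ 0 ∈ f.eval S (Nat.pair a v) ∧
      ∀ m < v, ∃ y ∈ f.eval S (Nat.pair a m), y ≠ 0 := by
  simp only [eval]
  refine Nat.mem_rfind.trans ?_
  simp

end OracleCode

namespace Nat.Partrec.Code

theorem mem_eval_pair {f g : Code} {n v : ℕ} :
    v ∈ (pair f g).eval n ↔ ∃ a ∈ f.eval n, ∃ b ∈ g.eval n, v = Nat.pair a b := by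
  simp [eval, Seq.seq, eq_comm]

theorem mem_eval_comp {f g : Code} {n v : ℕ} :
    v ∈ (comp f g).eval n ↔ ∃ a ∈ g.eval n, v ∈ f.eval a := by
  simp only [eval]
  exact Part.mem_bind_iff

theorem mem_eval_prec_succ {f g : Code} {a k v : ℕ} :
    v ∈ (prec f g).eval (Nat.pair a (k + 1)) ↔ ∃ i ∈ (prec f g).eval (Nat.pair a k),
      v ∈ g.eval (Nat.pair a (Nat.pair k i)) := by
  rw [eval_prec_succ]
  exact Part.mem_bind_iff

/-- `rfind'` starts its search at the second component of its input; pairing with zero turns it into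
the ordinary search. -/
theorem mem_eval_rfind {f : Code} {a v : ℕ} :
    v ∈ (comp (rfind' f) (pair .id .zero)).eval a ↔ 0 ∈ f.eval (Nat.pair a v) ∧
      ∀ m < v, ∃ y ∈ f.eval (Nat.pair a m), y ≠ 0 := by
  have h0 : (0 : ℕ) ∈ (Code.zero).eval a := by simp [eval, pure, PFun.pure]
  rw [mem_eval_comp]
  simp only [mem_eval_pair, eval_id, Part.mem_some_iff]
  have : ∀ b, b ∈ (Code.zero).eval a ↔ b = 0 := fun b => ⟨fun h => Part.mem_unique h h0, fun h => h ▸ h0⟩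
  simp only [this]
  simp only [exists_eq_left, eval, Nat.unpaired, Nat.unpair_pair, Nat.add_zero]
  refine Nat.mem_rfind.trans ?_
  simp

end Nat.Partrec.Code

namespace OracleCode

/-- Soundness: a computation that converges with a partial oracle has only received true answers. -/
theorem mem_eval_of_mem_substOracle {Y : Set ℕ} {o : Code}
    (ho : ∀ n, ∀ v ∈ o.eval n, v = charFun Y n) (c : OracleCode) :
    ∀ n, ∀ v ∈ (c.substOracle o).eval n, v ∈ c.eval Y n := by
  induction c with
  | zero | succ | left | right => exact fun n v h => h
  | oracle => exact fun n v h => by simpa [eval] using ho n v h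
  | pair f g hf hg =>
    intro n v h
    obtain ⟨a, ha, b, hb, rfl⟩ := Code.mem_eval_pair.1 h
    exact mem_eval_pair.2 ⟨a, hf _ _ ha, b, hg _ _ hb, rfl⟩
  | comp f g hf hg =>
    intro n v h
    obtain ⟨a, ha, hb⟩ := Code.mem_eval_comp.1 h
    exact mem_eval_comp.2 ⟨a, hg _ _ ha, hf _ _ hb⟩
  | prec f g hf hg =>
    intro n
    rw [← Nat.pair_unpair n]
    generalize n.unpair.1 = a
    induction n.unpair.2 with
    | zero =>
      intro v h
      rw [mem_eval_prec_zero]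
      exact hf _ _ (by rwa [substOracle, Code.eval_prec_zero] at h)
    | succ k ih =>
      intro v h
      obtain ⟨i, hi, h⟩ := Code.mem_eval_prec_succ.1 h
      exact mem_eval_prec_succ.2 ⟨i, ih _ hi, hg _ _ h⟩
  | rfind f hf =>
    intro n v h
    obtain ⟨h, h'⟩ := Code.mem_eval_rfind.1 h
    refine mem_eval_rfind.2 ⟨hf _ _ h, fun m hm => ?_⟩
    obtain ⟨y, hy, h0⟩ := h' m hm
    exact ⟨y, hf _ _ hy, h0⟩

open Filter in
-- Completeness: a convergent computation asks finitely many questions, so it converges with every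
-- sufficiently long initial segment of the oracle.
theorem eventually_mem_substOracle {Y : Set ℕ} {o : ℕ → Code}
    (ho : ∀ N, ∀ n < N, charFun Y n ∈ (o N).eval n) (c : OracleCode) :
    ∀ n, ∀ v ∈ c.eval Y n, ∀ᶠ N in atTop, v ∈ (c.substOracle (o N)).eval n := by
  induction c with
  | zero | succ | left | right => exact fun n v h => .of_forall fun _ => h
  | oracle =>
    intro n v h
    filter_upwards [eventually_gt_atTop n] with N hN
    rw [Part.mem_some_iff.1 h]
    exact ho N n hN
  | pair f g hf hg =>
    intro n v h
    obtain ⟨a, ha, b, hb, rfl⟩ := mem_eval_pair.1 h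
    filter_upwards [hf _ _ ha, hg _ _ hb] with N h1 h2
    exact Code.mem_eval_pair.2 ⟨a, h1, b, h2, rfl⟩
  | comp f g hf hg =>
    intro n v h
    obtain ⟨a, ha, hb⟩ := mem_eval_comp.1 h
    filter_upwards [hg _ _ ha, hf _ _ hb] with N h1 h2
    exact Code.mem_eval_comp.2 ⟨a, h1, h2⟩
  | prec f g hf hg =>
    intro n
    rw [← Nat.pair_unpair n]
    generalize n.unpair.1 = a
    induction n.unpair.2 with
    | zero =>
      intro v h
      filter_upwards [hf _ _ (mem_eval_prec_zero.1 h)] with N h1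
      rwa [substOracle, Code.eval_prec_zero]
    | succ k ih =>
      intro v h
      obtain ⟨i, hi, h⟩ := mem_eval_prec_succ.1 h
      filter_upwards [ih _ hi, hg _ _ h] with N h1 h2
      exact Code.mem_eval_prec_succ.2 ⟨i, h1, h2⟩
  | rfind f hf =>
    intro n v h
    obtain ⟨h, h'⟩ := mem_eval_rfind.1 h
    choose! y hy h0 using h'
    have : ∀ᶠ N in atTop, ∀ m ∈ Finset.range v, y m ∈ (f.substOracle (o N)).eval (Nat.pair n m) := by
      rw [eventually_all_finset]
      exact fun m hm => hf _ _ (hy m (Finset.mem_range.1 hm))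
    filter_upwards [hf _ _ h, this] with N h1 h2
    exact Code.mem_eval_rfind.2 ⟨h1, fun m hm => ⟨y m, h2 m (Finset.mem_range.2 hm), h0 m hm⟩⟩

/-- Course-of-values recursion on Gödel numbers: `l` lists the translations of all smaller programs,
and its length is the number of the current one. -/
theorem primrec_substOracle :
    Primrec₂ fun (o : Code) (e : ℕ) => (ofNat e).substOracle o := by
  let bin (F : Code → Code → Code) (l : List Code) : Option Code :=
    (l[((l.length - 5) / 4).unpair.1]?).bind fun a =>
      (l[((l.length - 5) / 4).unpair.2]?).map fun b => F a b
  have hn : Primrec fun l : List Code => (l.length - 5) / 4 :=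
    Primrec.nat_div.comp (Primrec.nat_sub.comp Primrec.list_length (.const 5)) (.const 4)
  have hbin : ∀ F, Primrec₂ F → Primrec (bin F) := by
    intro F hF
    refine Primrec.option_bind (Primrec.list_getElem?.comp .id
      (Primrec.fst.comp (Primrec.unpair.comp hn))) ?_
    refine Primrec.option_map (Primrec.list_getElem?.comp .fst
      (Primrec.snd.comp (Primrec.unpair.comp (hn.comp .fst)))) ?_
    exact hF.comp (Primrec.snd.comp .fst) .snd
  let una (l : List Code) : Option Code := (l[(l.length - 5) / 4]?).map fun a =>
    .comp (.rfind' a) (.pair .id .zero)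
  have huna : Primrec una := by
    refine Primrec.option_map (Primrec.list_getElem?.comp .id hn) ?_
    exact Code.primrec₂_comp.comp (Code.primrec_rfind'.comp .snd) (.const _)
  let g (o : Code) (l : List Code) : Option Code :=
    if l.length = 0 then some .zero else if l.length = 1 then some .succ
    else if l.length = 2 then some .left else if l.length = 3 then some .right
    else if l.length = 4 then some o
    else if (l.length - 5) % 4 = 0 then bin .pair l else if (l.length - 5) % 4 = 1 then bin .comp l
    else if (l.length - 5) % 4 = 2 then bin .prec l else una l
  have hl : Primrec fun p : Code × List Code => p.2.length := Primrec.list_length.comp .snd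
  have hl4 : Primrec fun p : Code × List Code => (p.2.length - 5) % 4 :=
    Primrec.nat_mod.comp (Primrec.nat_sub.comp hl (.const 5)) (.const 4)
  refine Primrec.nat_strong_rec _ (g := g) ?_ ?_
  · refine .ite (Primrec.eq.comp hl (.const 0)) (.const _) ?_
    refine .ite (Primrec.eq.comp hl (.const 1)) (.const _) ?_
    refine .ite (Primrec.eq.comp hl (.const 2)) (.const _) ?_
    refine .ite (Primrec.eq.comp hl (.const 3)) (.const _) ?_
    refine .ite (Primrec.eq.comp hl (.const 4)) (Primrec.option_some.comp .fst) ?_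
    refine .ite (Primrec.eq.comp hl4 (.const 0)) ((hbin _ Code.primrec₂_pair).comp .snd) ?_
    refine .ite (Primrec.eq.comp hl4 (.const 1)) ((hbin _ Code.primrec₂_comp).comp .snd) ?_
    exact .ite (Primrec.eq.comp hl4 (.const 2)) ((hbin _ Code.primrec₂_prec).comp .snd)
      (huna.comp .snd)
  · intro o n
    match n with
    | 0 | 1 | 2 | 3 | 4 => simp [g, ofNat, substOracle]
    | n + 5 =>
      have h : n / 4 < n + 5 := by omega
      have h₁ : (n / 4).unpair.1 < n + 5 := (Nat.unpair_left_le _).trans_lt h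
      have h₂ : (n / 4).unpair.2 < n + 5 := (Nat.unpair_right_le _).trans_lt h
      rw [ofNat]
      rcases (by omega : n % 4 = 0 ∨ n % 4 = 1 ∨ n % 4 = 2 ∨ n % 4 = 3) with h' | h' | h' | h' <;>
        simp [g, h', bin, una, h₁, h₂, h, substOracle]

end OracleCode

/-- The facts `σ` as a partial oracle. -/
theorem exists_lookupCode : ∃ o : List (ℕ × Bool) → Code, Primrec o ∧
    ∀ σ n v, v ∈ (o σ).eval n ↔ (σ.lookup n).map Bool.toNat = some v := by
  let f : ℕ →. ℕ := fun p => (((decode (α := List (ℕ × Bool)) p.unpair.1).bind fun σ =>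
    (σ.lookup p.unpair.2).map Bool.toNat : Option ℕ) : Part ℕ)
  have hf : Partrec f := by
    refine Computable.ofOption (Primrec.to_comp ?_)
    refine Primrec.option_bind (Primrec.decode.comp (Primrec.fst.comp .unpair)) ?_
    refine Primrec.option_map (Primrec.listLookup.comp
      (Primrec.snd.comp (Primrec.unpair.comp .fst)) .snd) ?_
    exact (Primrec.dom_bool _).comp .snd
  obtain ⟨c, hc⟩ := Code.exists_code.1 (Partrec.nat_iff.1 hf)
  refine ⟨fun σ => c.curry (encode σ), Code.primrec₂_curry.comp (.const c) .encode, ?_⟩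
  intro σ n v
  rw [Code.eval_curry, hc]
  simp only [f, Nat.unpair_pair, encodek, Option.bind_some]
  exact Part.mem_ofOption

/-- A witness is a finite list of facts together with a time bound for the program in which that
list replaces the oracle. -/
theorem Sigma1.phi : Sigma1 fun Y (p : ℕ × ℕ × ℕ) => p.2.2 ∈ Phi p.1 Y p.2.1 := by
  obtain ⟨o, ho, H⟩ := exists_lookupCode
  refine ⟨fun p w => (decode (α := List (ℕ × Bool)) w.unpair.1).bind fun σ =>
    if Code.evaln w.unpair.2 ((OracleCode.ofNat p.1).substOracle (o σ)) p.2.1 = some p.2.2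
    then some σ else none, ?_, ?_⟩
  · refine Primrec.option_bind
      (Primrec.decode.comp (Primrec.fst.comp (Primrec.unpair.comp .snd))) ?_
    have h1 : Primrec fun q : ((ℕ × ℕ × ℕ) × ℕ) × List (ℕ × Bool) => q.1.1 :=
      Primrec.fst.comp .fst
    refine Primrec.ite (Primrec.eq.comp (Code.primrec_evaln.comp
      ((Primrec.pair (Primrec.snd.comp (Primrec.unpair.comp (Primrec.snd.comp .fst)))
        (OracleCode.primrec_substOracle.comp (ho.comp .snd) (Primrec.fst.comp h1))).pair
      (Primrec.fst.comp (Primrec.snd.comp h1)))) (Primrec.option_some.comp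
        (Primrec.snd.comp (Primrec.snd.comp h1)))) (Primrec.option_some.comp .snd) (.const none)
  · rintro Y ⟨e, n, v⟩
    have hT : (∃ (w : ℕ) (σ : List (ℕ × Bool)), ((decode (α := List (ℕ × Bool)) w.unpair.1).bind fun σ =>
        if Code.evaln w.unpair.2 ((OracleCode.ofNat e).substOracle (o σ)) n = some v
        then some σ else none) = some σ ∧ Holds σ Y) ↔
        ∃ σ, v ∈ ((OracleCode.ofNat e).substOracle (o σ)).eval n ∧ Holds σ Y := by
      simp only [Code.evaln_complete]
      constructor
      · rintro ⟨w, σ, h, hσ⟩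
        obtain ⟨τ, -, h⟩ := Option.bind_eq_some_iff.1 h
        split_ifs at h with h'
        cases h
        exact ⟨σ, ⟨_, h'⟩, hσ⟩
      · rintro ⟨σ, ⟨k, h⟩, hσ⟩
        exact ⟨Nat.pair (encode σ) k, σ, by simpa using h, hσ⟩
    refine Iff.trans ?_ hT.symm
    constructor
    · intro h
      classical
      -- The truncations of the characteristic function of `Y` serve as partial oracles.
      let τ : ℕ → List (ℕ × Bool) := fun N => (List.range N).map fun n => (n, decide (n ∈ Y))
      have hτ : ∀ N, ∀ n < N, (τ N).lookup n = some (decide (n ∈ Y)) := by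
        intro N n hn
        induction N with
        | zero => omega
        | succ N ih =>
          simp only [τ, List.range_succ, List.map_append, List.map_cons, List.map_nil,
            List.lookup_append]
          rcases Nat.lt_succ_iff_lt_or_eq.1 hn with h | rfl
          · have := ih h
            simp only [τ] at this
            simp [this]
          · have : ((List.range n).map fun n => (n, decide (n ∈ Y))).lookup n = none := by
              rw [List.lookup_eq_none_iff]
              simp +contextual [Nat.ne_of_gt]
            simp [this]
      obtain ⟨N, hN⟩ := (OracleCode.eventually_mem_substOracle (Y := Y) (o := fun N => o (τ N)) (by
        intro N n hn
        rw [H, hτ N n hn]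
        unfold charFun
        split_ifs with h <;> simp [h]) _ n v h).exists
      exact ⟨τ N, hN, by simp [Holds, τ]⟩
    · rintro ⟨σ, h, hσ⟩
      refine OracleCode.mem_eval_of_mem_substOracle ?_ _ n v h
      intro n v hv
      rw [H] at hv
      obtain ⟨b, hb, rfl⟩ := Option.map_eq_some_iff.1 hv
      exact ((charFun_eq_bool _ _ _).2 (hσ (n, b) (by obtain ⟨l₁, l₂, rfl, -⟩ := List.lookup_eq_some_iff.1 hb; simp))).symm

end

/-! ### Indices, the recursion theorem, and selection between two searches. -/

section

open Encodable
open Nat.Partrec (Code)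

/-- A program for a constant function. -/
def OracleCode.const : ℕ → OracleCode
  | 0 => .zero
  | n + 1 => .comp .succ (const n)

theorem OracleCode.eval_const (S : Set ℕ) (n m : ℕ) :
    (OracleCode.const n).eval S m = Part.some n := by
  induction n with
  | zero => rfl
  | succ n ih => rw [const, eval_comp_of_eq ih]; rfl

theorem OracleCode.primrec_const : Primrec fun n => (OracleCode.const n).toNat := by
  refine (Primrec.nat_rec₁ (f := fun _ i => 4 * Nat.pair 1 i + 1 + 5) 0 ?_).of_eq fun n => ?_
  · exact Primrec.nat_add.comp (Primrec.nat_add.comp (Primrec.nat_mul.comp (.const 4)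
      (Primrec₂.natPair.comp (.const 1) .snd)) (.const 1)) (.const 5)
  · induction n with
    | zero => rfl
    | succ n ih => simp only [const, toNat, ← ih]

theorem exists_search_dom {α : Type*} [Primcodable α] {T : α → ℕ → Option (ℕ × List (ℕ × Bool))}
    {c : OracleCode} {Y : Set ℕ} {a : α} (hc : ∀ v, v ∈ c.eval Y (encode a) ↔
      ∃ w σ, T a w = some (v, σ) ∧ Holds σ Y ∧
        ∀ w' < w, ∀ v' σ', T a w' = some (v', σ') → ¬ Holds σ' Y) :
    (c.eval Y (encode a)).Dom ↔ ∃ w v σ, T a w = some (v, σ) ∧ Holds σ Y := by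
  classical
  rw [Part.dom_iff_mem]
  simp only [hc]
  constructor
  · rintro ⟨v, w, σ, h, hσ, -⟩
    exact ⟨w, v, σ, h, hσ⟩
  · intro h
    obtain ⟨v, σ, hT, hσ⟩ := Nat.find_spec h
    exact ⟨v, _, σ, hT, hσ, fun w' hw v' σ' h1 h2 => Nat.find_min h hw ⟨v', σ', h1, h2⟩⟩

namespace Sigma1

variable {α β : Type*} [Primcodable α] [Primcodable β]

theorem exists_domain {P : Set ℕ → α → Prop} (hP : Sigma1 P) :
    ∃ p, ∀ Y a, (Phi p Y (encode a)).Dom ↔ P Y a := by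
  obtain ⟨T, hT, H⟩ := hP
  obtain ⟨c, hc⟩ := exists_search (T := fun a w => (T a w).map fun σ => (0, σ))
    (Primrec.option_map hT ((Primrec.const 0).pair .snd))
  refine ⟨c.toNat, fun Y a => ?_⟩
  rw [Phi, OracleCode.ofNat_toNat, exists_search_dom (T := fun a w => (T a w).map fun σ => (0, σ)) (hc Y a), H]
  constructor
  · rintro ⟨w, v, σ, h, hσ⟩
    obtain ⟨σ', h', h⟩ := Option.map_eq_some_iff.1 h
    cases h
    exact ⟨w, σ, h', hσ⟩
  · rintro ⟨w, σ, h, hσ⟩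
    exact ⟨w, 0, σ, by simp [h], hσ⟩

/-- The program `e a` ignores its input and works on the constant `a`. In particular `e a` lies in
the halting set relative to `Y` exactly when `P Y a`, which turns `Σ₁` questions into questions to
the jump. -/
theorem exists_index {P : Set ℕ → α → Prop} (hP : Sigma1 P) :
    ∃ e : α → ℕ, Computable e ∧ ∀ Y a m, (Phi (e a) Y m).Dom ↔ P Y a := by
  obtain ⟨p, hp⟩ := hP.exists_domain
  refine ⟨fun a => 4 * Nat.pair p (OracleCode.const (encode a)).toNat + 1 + 5, ?_, ?_⟩
  · have := OracleCode.primrec_const.to_comp.comp (Computable.encode (α := α))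
    fun_prop
  · intro Y a m
    have : OracleCode.ofNat (4 * Nat.pair p (OracleCode.const (encode a)).toNat + 1 + 5) =
        .comp (OracleCode.ofNat p) (OracleCode.const (encode a)) := by
      rw [← OracleCode.ofNat_toNat (.comp (OracleCode.ofNat p) (OracleCode.const (encode a)))]
      simp only [OracleCode.toNat, OracleCode.toNat_ofNat]
    rw [Phi, this, OracleCode.eval_comp_of_eq (OracleCode.eval_const _ _ _)]
    exact hp Y a

/-- The predicate enumerated by an ordinary program `c`. -/
def _root_.EnumeratedBy (c : Code) (Y : Set ℕ) (a : α) : Prop :=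
  ∃ σ, (c.eval (encode (a, σ))).Dom ∧ Holds σ Y

theorem enum : Sigma1 fun Y (p : Code × α) => EnumeratedBy p.1 Y p.2 := by
  refine ex (and ?_ ?_)
  · exact dom (f := fun p : (Code × α) × List (ℕ × Bool) => p.1.1.eval (encode (p.1.2, p.2)))
      (Code.eval_part.comp (by fun_prop) (Computable.encode.comp (by fun_prop)))
  · exact ball (fact (by fun_prop) (by fun_prop)) Computable.snd

/-- The recursion theorem for ordinary programs, applied to a program that semi-decides whether the
facts `σ` suffice for `P` at `(c, a)`. The solution need not be the least one. -/
theorem fixed_point {P : Set ℕ → Code × α → Prop} (hP : Sigma1 P) :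
    ∃ c : Code, ∀ Y a, P Y (c, a) ↔ EnumeratedBy c Y a := by
  obtain ⟨T, hT, H⟩ := hP
  let b (q : Code × ℕ) (w : ℕ) : Bool := ((decode (α := α × List (ℕ × Bool)) q.2).bind fun p =>
    if T (q.1, p.1) w = some p.2 then some () else none).isSome
  have hb : Primrec₂ b := by
    refine Primrec.option_isSome.comp (Primrec.option_bind
      (Primrec.decode.comp (Primrec.snd.comp .fst)) ?_)
    refine Primrec.ite (Primrec.eq.comp (hT.comp ?_ ?_) ?_) (.const _) (.const _)
    · exact (Primrec.fst.comp (Primrec.fst.comp .fst)).pair (Primrec.fst.comp .snd)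
    · exact Primrec.snd.comp .fst
    · exact Primrec.option_some.comp (Primrec.snd.comp .snd)
  have hf : Partrec₂ fun (c : Code) (n : ℕ) => Nat.rfind fun w => Part.some (b (c, n) w) :=
    Partrec.rfind (p := fun q w => Part.some (b q w)) hb.to_comp.partrec
  obtain ⟨c, hc⟩ := Code.fixed_point₂ hf
  refine ⟨c, fun Y a => ?_⟩
  have key : ∀ σ, (c.eval (encode (a, σ))).Dom ↔ ∃ w, T (c, a) w = some σ := by
    intro σ
    rw [hc]
    refine Nat.rfind_dom.trans ?_
    simp [b]
  simp only [EnumeratedBy, key, H]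
  exact ⟨fun ⟨w, σ, h, hσ⟩ => ⟨σ, ⟨w, h⟩, hσ⟩, fun ⟨σ, ⟨w, h⟩, hσ⟩ => ⟨w, σ, h, hσ⟩⟩

/-- A program that, given `a` and `n`, either finds a value `v` with `Q`, or finds that `P` is
true of `a` and answers `2`; and that does the latter for some `n` if `P` is true of `a`. -/
theorem exists_select {P : Set ℕ → α → Prop} {Q : Set ℕ → α × ℕ × ℕ → Prop} (hP : Sigma1 P)
    (hQ : Sigma1 Q) : ∃ p, ∀ Y a,
      (∀ n : ℕ, (Phi p Y (encode (a, n))).Dom ↔ P Y a ∨ ∃ v, Q Y (a, n, v)) ∧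
      (∀ n : ℕ, ∀ v ∈ Phi p Y (encode (a, n)), v = 2 ∧ P Y a ∨ Q Y (a, n, v)) ∧
      (P Y a → ∃ n : ℕ, 2 ∈ Phi p Y (encode (a, n))) := by
  obtain ⟨T, hT, H⟩ := hP
  obtain ⟨U, hU, K⟩ := hQ
  -- A witness for `Q` at `n` is admitted only if its first component is at least `n`, so its code
  -- is at least `n` too. Once `n` exceeds the code of a witness for `P`, the least valid witness
  -- must be one for `P`, and the output is `2`.
  let V (q : α × ℕ) (w : ℕ) : Option (ℕ × List (ℕ × Bool)) :=
    if w.unpair.1 = 0 then (T q.1 w.unpair.2).map fun σ => (2, σ)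
    else if q.2 ≤ w.unpair.1 then
      (U (q.1, q.2, w.unpair.2.unpair.1) w.unpair.2.unpair.2).map fun σ => (w.unpair.2.unpair.1, σ)
    else none
  have hV : Primrec₂ V := by
    have h1 : Primrec fun p : (α × ℕ) × ℕ => p.2.unpair.1 :=
      Primrec.fst.comp (Primrec.unpair.comp .snd)
    have h2 : Primrec fun p : (α × ℕ) × ℕ => p.2.unpair.2 :=
      Primrec.snd.comp (Primrec.unpair.comp .snd)
    have h21 := Primrec.fst.comp (Primrec.unpair.comp h2)
    have h22 := Primrec.snd.comp (Primrec.unpair.comp h2)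
    refine Primrec.ite (Primrec.eq.comp h1 (.const 0)) ?_
      (Primrec.ite (Primrec.nat_le.comp (Primrec.snd.comp .fst) h1) ?_ (.const none))
    · exact Primrec.option_map (hT.comp (Primrec.fst.comp .fst) h2) ((Primrec.const 2).pair .snd)
    · exact Primrec.option_map (hU.comp ((Primrec.fst.comp .fst).pair
        ((Primrec.snd.comp .fst).pair h21)) h22) ((h21.comp .fst).pair .snd)
  obtain ⟨c, hc⟩ := exists_search hV
  have hVs : ∀ a n w v σ, V (a, n) w = some (v, σ) ↔
      (w.unpair.1 = 0 ∧ v = 2 ∧ T a w.unpair.2 = some σ) ∨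
      (w.unpair.1 ≠ 0 ∧ n ≤ w.unpair.1 ∧ w.unpair.2.unpair.1 = v ∧
        U (a, n, v) w.unpair.2.unpair.2 = some σ) := by
    intro a n w v σ
    simp only [V]
    split_ifs with h h'
    · simp [h, eq_comm, and_comm]
    · simp only [h, h', Option.map_eq_some_iff, Prod.mk.injEq]
      aesop
    · simp [h, h']
  refine ⟨c.toNat, fun Y a => ?_⟩
  simp only [Phi, OracleCode.ofNat_toNat, hc, H, K]
  refine ⟨fun n => ?_, fun n v => ?_, ?_⟩
  · rw [exists_search_dom (hc Y (a, n))]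
    simp only [hVs]
    constructor
    · rintro ⟨w, v, σ, ⟨-, -, h⟩ | ⟨-, -, -, h⟩, hσ⟩
      · exact .inl ⟨_, σ, h, hσ⟩
      · exact .inr ⟨v, _, σ, h, hσ⟩
    · rintro (⟨w, σ, h, hσ⟩ | ⟨v, w, σ, h, hσ⟩)
      · exact ⟨Nat.pair 0 w, 2, σ, .inl (by simp [h]), hσ⟩
      · exact ⟨Nat.pair (n + 1) (Nat.pair v w), v, σ, .inr (by simp [h]), hσ⟩
  · rintro ⟨w, σ, h, hσ, -⟩
    rcases (hVs _ _ _ _ _).1 h with ⟨-, h, h'⟩ | ⟨-, -, -, h⟩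
    · exact .inl ⟨h, _, σ, h', hσ⟩
    · exact .inr ⟨_, σ, h, hσ⟩
  · intro h
    obtain ⟨w, σ, hw, hσ⟩ := h
    have hd := (exists_search_dom (hc Y (a, Nat.pair 0 w + 1))).2
      ⟨Nat.pair 0 w, 2, σ, (hVs _ _ _ _ _).2 (.inl (by simp [hw])), hσ⟩
    obtain ⟨v, hv⟩ := Part.dom_iff_mem.1 hd
    refine ⟨Nat.pair 0 w + 1, ?_⟩
    obtain ⟨w', σ', h, hσ', hmin⟩ := (hc _ _ _).1 hv
    have hle : w' ≤ Nat.pair 0 w := by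
      by_contra hlt
      exact hmin _ (not_le.1 hlt) 2 σ ((hVs _ _ _ _ _).2 (.inl (by simp [hw]))) hσ
    rcases (hVs _ _ _ _ _).1 h with ⟨-, rfl, -⟩ | ⟨-, hn, -, -⟩
    · exact ⟨w', σ', h, hσ', hmin⟩
    · have := Nat.unpair_left_le w'
      omega

end Sigma1

end

/-! ### Gödel numbers of the sentences used, and their meaning. -/

section

section Codes

variable {D : Set ℕ}

theorem termCode_injective {n : ℕ} :
    Function.Injective (termCode : Language.order.Term (D ⊕ Fin n) → ℕ) := by
  intro s t h
  match s, t with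
  | .var (.inl a), .var (.inl b) =>
    simp only [termCode] at h
    rw [Subtype.ext (by omega : (a : ℕ) = b)]
  | .var (.inl a), .var (.inr i) => simp only [termCode] at h; omega
  | .var (.inr i), .var (.inl a) => simp only [termCode] at h; omega
  | .var (.inr i), .var (.inr j) =>
    simp only [termCode] at h
    rw [Fin.ext (by omega : (i : ℕ) = j)]
  | .func f _, _ => exact Empty.elim f
  | _, .func f _ => exact Empty.elim f

theorem arity_eq_two {l : ℕ} (R : Language.order.Relations l) : l = 2 := by
  cases R
  rfl

theorem relations_two_eq (R R' : Language.order.Relations 2) : R = R' := by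
  cases R
  cases R'
  rfl

theorem formulaCode_rel {n : ℕ} (R : Language.order.Relations 2)
    (ts : Fin 2 → Language.order.Term (D ⊕ Fin n)) : formulaCode (.rel R ts) =
      4 * Nat.pair (termCode (ts 0)) (termCode (ts 1)) + 2 := rfl

/-- Hence the presence of a code in the diagram means the truth of the one formula that has this
code. -/
theorem formulaCode_injective {n : ℕ} (φ : Language.order.BoundedFormula D n) :
    ∀ ψ, formulaCode φ = formulaCode ψ → φ = ψ := by
  induction φ with
  | falsum =>
    intro ψ h
    cases ψ with
    | falsum => rfl
    | rel R _ => obtain rfl := arity_eq_two R; simp [formulaCode, formulaCode_rel] at h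
    | _ => simp [formulaCode] at h
  | equal s t =>
    intro ψ h
    cases ψ with
    | equal s' t' =>
      simp only [formulaCode] at h
      have := Nat.pair_eq_pair.1 (by omega : Nat.pair (termCode s) (termCode t) =
        Nat.pair (termCode s') (termCode t'))
      rw [termCode_injective this.1, termCode_injective this.2]
    | rel R _ =>
      obtain rfl := arity_eq_two R
      simp only [formulaCode, formulaCode_rel] at h
      omega
    | _ => simp only [formulaCode] at h; omega
  | rel R ts =>
    obtain rfl := arity_eq_two R
    intro ψ h
    cases ψ with
    | rel R' us =>
      obtain rfl := arity_eq_two R'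
      simp only [formulaCode_rel] at h
      obtain rfl := relations_two_eq R R'
      have := Nat.pair_eq_pair.1 (by omega : Nat.pair (termCode (ts 0)) (termCode (ts 1)) =
        Nat.pair (termCode (us 0)) (termCode (us 1)))
      congr 1
      funext i
      fin_cases i
      · exact termCode_injective this.1
      · exact termCode_injective this.2
    | _ => simp only [formulaCode, formulaCode_rel] at h; omega
  | imp φ φ' ih ih' =>
    intro ψ h
    cases ψ with
    | imp ψ ψ' =>
      simp only [formulaCode] at h
      have := Nat.pair_eq_pair.1 (by omega : Nat.pair (formulaCode φ) (formulaCode φ') =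
        Nat.pair (formulaCode ψ) (formulaCode ψ'))
      rw [ih _ this.1, ih' _ this.2]
    | rel R _ =>
      obtain rfl := arity_eq_two R
      simp only [formulaCode, formulaCode_rel] at h
      omega
    | _ => simp only [formulaCode] at h; omega
  | all φ ih =>
    intro ψ h
    cases ψ with
    | all ψ =>
      simp only [formulaCode] at h
      rw [ih ψ (by omega)]
    | rel R _ =>
      obtain rfl := arity_eq_two R
      simp only [formulaCode, formulaCode_rel] at h
      omega
    | _ => simp only [formulaCode] at h; omega

/-- The atomic formula `s ≤ t`. -/
def leFormula {n : ℕ} (s t : Language.order.Term (D ⊕ Fin n)) :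
    Language.order.BoundedFormula D n :=
  .rel Language.leSymb ![s, t]

end Codes

namespace Presentation

variable (A : Presentation)

theorem lt_irrefl (a : ℕ) : ¬ A.lt a a := by
  intro h
  have := A.wellOrder
  exact irrefl_of (fun a b : A.dom => A.lt a b) ⟨a, (A.lt_dom _ _ h).1⟩ h

theorem lt_trans {a b c : ℕ} (h : A.lt a b) (h' : A.lt b c) : A.lt a c := by
  have := A.wellOrder
  exact _root_.trans_of (fun a b : A.dom => A.lt a b) (a := ⟨a, (A.lt_dom _ _ h).1⟩)
    (b := ⟨b, (A.lt_dom _ _ h).2⟩) (c := ⟨c, (A.lt_dom _ _ h').2⟩) h h'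

theorem lt_trichotomy {a b : ℕ} (ha : a ∈ A.dom) (hb : b ∈ A.dom) :
    A.lt a b ∨ a = b ∨ A.lt b a := by
  have := A.wellOrder
  rcases trichotomous_of (fun a b : A.dom => A.lt a b) ⟨a, ha⟩ ⟨b, hb⟩ with h | h | h
  · exact .inl h
  · exact .inr (.inl (congrArg Subtype.val h))
  · exact .inr (.inr h)

theorem formulaCode_mem_completeDiagram (φ : Language.order.Formula A.dom) :
    formulaCode φ ∈ A.completeDiagram ↔ @Language.Formula.Realize _ _ A.str _ φ id :=
  ⟨fun ⟨_, h, h'⟩ => formulaCode_injective _ _ h ▸ h', fun h => ⟨φ, rfl, h⟩⟩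

/-- Truth of a formula in the presentation. -/
def Sat {n : ℕ} (φ : Language.order.BoundedFormula A.dom n) (v : Fin n → A.dom) : Prop :=
  @Language.BoundedFormula.Realize _ _ A.str _ _ φ id v

/-- The value of a term in the presentation. -/
def termValue {n : ℕ} (t : Language.order.Term (A.dom ⊕ Fin n)) (v : Fin n → A.dom) : A.dom :=
  @Language.Term.realize _ _ A.str _ (Sum.elim id v) t

variable {A}

@[simp] theorem sat_le {n : ℕ} (s t : Language.order.Term (A.dom ⊕ Fin n)) (v : Fin n → A.dom) :
    A.Sat (leFormula s t) v ↔ A.termValue s v = A.termValue t v ∨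
      A.lt (A.termValue s v) (A.termValue t v) := Iff.rfl

@[simp] theorem sat_equal {n : ℕ} (s t : Language.order.Term (A.dom ⊕ Fin n)) (v : Fin n → A.dom) :
    A.Sat (.equal s t) v ↔ A.termValue s v = A.termValue t v := Iff.rfl

@[simp] theorem sat_falsum {n : ℕ} (v : Fin n → A.dom) : A.Sat .falsum v ↔ False := Iff.rfl

@[simp] theorem sat_imp {n : ℕ} (φ ψ : Language.order.BoundedFormula A.dom n) (v : Fin n → A.dom) :
    A.Sat (.imp φ ψ) v ↔ (A.Sat φ v → A.Sat ψ v) := Iff.rfl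

@[simp] theorem sat_all {n : ℕ} (φ : Language.order.BoundedFormula A.dom (n + 1))
    (v : Fin n → A.dom) : A.Sat (.all φ) v ↔ ∀ a, A.Sat φ (Fin.snoc v a) := Iff.rfl

@[simp] theorem termValue_const {n : ℕ} (a : A.dom) (v : Fin n → A.dom) :
    A.termValue (.var (.inl a)) v = a := rfl

@[simp] theorem termValue_var {n : ℕ} (i : Fin n) (v : Fin n → A.dom) :
    A.termValue (.var (.inr i)) v = v i := rfl

variable (A) in
theorem mem_diagram (φ : Language.order.BoundedFormula A.dom 0) :
    formulaCode φ ∈ A.completeDiagram ↔ A.Sat φ default :=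
  A.formulaCode_mem_completeDiagram φ

/-- The Gödel number of `a = a`. -/
def domCode (a : ℕ) : ℕ := 4 * Nat.pair (2 * a) (2 * a) + 1

/-- The Gödel number of `a ≤ b`. -/
def leCode (a b : ℕ) : ℕ := 4 * Nat.pair (2 * a) (2 * b) + 2

/-- The Gödel number of `∀ z, z ≤ j`. -/
def maxCode (j : ℕ) : ℕ := 4 * (4 * Nat.pair 1 (2 * j) + 2) + 4

/-- The Gödel number of `∀ y, ¬ ∀ z, z ≤ y`. -/
def noMaxCode : ℕ := 4 * (4 * Nat.pair (4 * (4 * Nat.pair 3 1 + 2) + 4) 0 + 3) + 4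

/-- The Gödel number of `∀ z, ¬ z ≤ j → k ≤ z`. -/
def maxBelowCode (k j : ℕ) : ℕ :=
  4 * (4 * Nat.pair (4 * Nat.pair (4 * Nat.pair 1 (2 * j) + 2) 0 + 3)
    (4 * Nat.pair (2 * k) 1 + 2) + 3) + 4

/-- The Gödel number of `∀ y, y ≤ k → ¬ y = k → ¬ ∀ z, ¬ z ≤ y → k ≤ z`. -/
def noMaxBelowCode (k : ℕ) : ℕ :=
  4 * (4 * Nat.pair (4 * Nat.pair 1 (2 * k) + 2)
    (4 * Nat.pair (4 * Nat.pair (4 * Nat.pair 1 (2 * k) + 1) 0 + 3)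
      (4 * Nat.pair (4 * (4 * Nat.pair (4 * Nat.pair (4 * Nat.pair 3 1 + 2) 0 + 3)
        (4 * Nat.pair (2 * k) 3 + 2) + 3) + 4) 0 + 3) + 3) + 3) + 4

/-- A number outside the domain has no constant, so the code of `a = a` is then not the code of any
sentence: the diagram decides the domain. -/
theorem domCode_mem {a : ℕ} : domCode a ∈ A.completeDiagram ↔ a ∈ A.dom := by
  constructor
  · rintro ⟨φ, h, -⟩
    cases φ with
    | equal s t =>
      simp only [formulaCode, domCode] at h
      have := (Nat.pair_eq_pair.1 (by omega : Nat.pair (termCode s) (termCode t) =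
        Nat.pair (2 * a) (2 * a))).1
      match s with
      | .var (.inl d) =>
        simp only [termCode] at this
        have hd : a = d := by omega
        exact hd ▸ d.2
      | .var (.inr i) => exact i.elim0
      | .func f _ => exact Empty.elim f
    | rel R _ =>
      obtain rfl := arity_eq_two R
      simp only [formulaCode_rel, domCode] at h
      omega
    | _ => simp only [formulaCode, domCode] at h; omega
  · intro h
    exact (A.mem_diagram (.equal (.var (.inl ⟨a, h⟩)) (.var (.inl ⟨a, h⟩)))).2 (by simp)

theorem leCode_mem {a b : ℕ} (ha : a ∈ A.dom) (hb : b ∈ A.dom) :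
    leCode a b ∈ A.completeDiagram ↔ a = b ∨ A.lt a b := by
  refine (A.mem_diagram (leFormula (.var (.inl ⟨a, ha⟩)) (.var (.inl ⟨b, hb⟩)))).trans ?_
  simp

theorem maxCode_mem {j : ℕ} (hj : j ∈ A.dom) :
    maxCode j ∈ A.completeDiagram ↔ ∀ z ∈ A.dom, z = j ∨ A.lt z j := by
  refine (A.mem_diagram (.all (leFormula (.var (.inr 0)) (.var (.inl ⟨j, hj⟩))))).trans ?_
  simp [Fin.snoc]

theorem noMaxCode_mem :
    noMaxCode ∈ A.completeDiagram ↔ ∀ y ∈ A.dom, ¬ ∀ z ∈ A.dom, z = y ∨ A.lt z y := by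
  refine (A.mem_diagram (.all (.imp (.all (leFormula (.var (.inr 1)) (.var (.inr 0))))
    .falsum))).trans ?_
  simp [Fin.snoc, and_assoc]

/-- Only the diagram of the whole presentation is at hand, so statements about an initial segment
are relativised: for `j ≺ k`, this one says that `j` is the greatest element below `k`. -/
theorem maxBelowCode_mem {j k : ℕ} (hj : j ∈ A.dom) (hk : k ∈ A.dom) :
    maxBelowCode k j ∈ A.completeDiagram ↔
      ∀ z ∈ A.dom, ¬ (z = j ∨ A.lt z j) → (k = z ∨ A.lt k z) := by
  refine (A.mem_diagram (.all (.imp (.imp (leFormula (.var (.inr 0)) (.var (.inl ⟨j, hj⟩)))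
    .falsum) (leFormula (.var (.inl ⟨k, hk⟩)) (.var (.inr 0)))))).trans ?_
  simp [Fin.snoc]

theorem noMaxBelowCode_mem {k : ℕ} (hk : k ∈ A.dom) :
    noMaxBelowCode k ∈ A.completeDiagram ↔ ∀ y ∈ A.dom, A.lt y k → y ≠ k →
      ¬ ∀ z ∈ A.dom, ¬ (z = y ∨ A.lt z y) → (k = z ∨ A.lt k z) := by
  refine (A.mem_diagram (.all (.imp (leFormula (.var (.inr 0)) (.var (.inl ⟨k, hk⟩)))
    (.imp (.imp (.equal (.var (.inr 0)) (.var (.inl ⟨k, hk⟩))) .falsum)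
      (.imp (.all (.imp (.imp (leFormula (.var (.inr 1)) (.var (.inr 0))) .falsum)
        (leFormula (.var (.inl ⟨k, hk⟩)) (.var (.inr 1))))) .falsum))))).trans ?_
  simp [Fin.snoc, and_assoc]

end Presentation

end

section

/-! ### Initial segments and the columns of an iterated jump. -/

namespace Presentation

theorem below_below (A : Presentation) {k j : ℕ} (h : A.lt j k) :
    (A.below k).below j = A.below j := by
  have h1 : ∀ a b, (A.below k).lt a b ↔ A.lt a b ∧ A.lt a k ∧ A.lt b k := fun _ _ => Iff.rfl
  have hd : ((A.below k).below j).dom = (A.below j).dom := by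
    ext i
    exact ⟨fun h' => h'.1, fun h' => ⟨h', A.lt_trans h' h, h⟩⟩
  have hl : ((A.below k).below j).lt = (A.below j).lt := by
    funext a b
    apply propext
    constructor
    · rintro ⟨⟨h1, -⟩, ⟨h2, -⟩, h3, -⟩
      exact ⟨h1, h2, h3⟩
    · rintro ⟨h1, h2, h3⟩
      have ha := A.lt_trans h2 h
      have hb := A.lt_trans h3 h
      exact ⟨⟨h1, ha, hb⟩, ⟨h2, ha, h⟩, h3, hb, h⟩
  generalize (A.below k).below j = B at hd hl
  generalize A.below j = B' at hd hl
  cases B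
  cases B'
  simp only at hd hl
  subst hd hl
  rfl

theorem jump_of_dom_eq_empty {A : Presentation} (h : A.dom = ∅) (C : Set ℕ) : A.jump C = C := by
  ext m
  rw [mem_jump_iff]
  constructor
  · rintro (⟨-, h'⟩ | ⟨h', -⟩ | ⟨j, ⟨h', -⟩, -⟩)
    · exact h'
    · simp [h] at h'
    · simp [h] at h'
  · exact fun h' => .inl ⟨h, h'⟩

theorem IsGreatest.unique {A : Presentation} {i j : ℕ} (hi : A.IsGreatest i)
    (hj : A.IsGreatest j) : i = j := by
  by_contra h
  exact A.lt_irrefl _ (A.lt_trans (hj.2 i hi.1 h) (hi.2 j hj.1 (Ne.symm h)))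

theorem column_jump_of_mem {A : Presentation} {k : ℕ} (hk : k ∈ A.dom) (C : Set ℕ) :
    column k (A.jump C) = (A.below k).jump C := by
  ext n
  simp only [column, Set.mem_ofPred_eq]
  rw [mem_jump_iff, Nat.unpair_pair]
  constructor
  · rintro (⟨h, -⟩ | ⟨-, h⟩ | ⟨j, -, h, -⟩)
    · simp [h] at hk
    · exact h
    · exact absurd hk h.1.2
  · exact fun h => .inr (.inl ⟨hk, h⟩)

theorem column_jump_of_isLeast {A : Presentation} {j k : ℕ} (hj : A.IsGreatest j)
    (hk : IsLeast {k | j < k ∧ k ∉ A.dom} k) (C : Set ℕ) :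
    column k (A.jump C) = {n | (Phi n ((A.below j).jump C) n).Dom} := by
  ext n
  simp only [column, Set.mem_ofPred_eq]
  rw [mem_jump_iff, Nat.unpair_pair]
  constructor
  · rintro (⟨h, -⟩ | ⟨h, -⟩ | ⟨j', hj', -, h⟩)
    · simp [h, IsGreatest] at hj
    · exact absurd h hk.1.2
    · rwa [hj.unique hj']
  · exact fun h => .inr (.inr ⟨j, hj, hk, h⟩)

theorem notMem_jump {A : Presentation} {k : ℕ} (hk : k ∉ A.dom)
    (h : ¬ ∃ j, A.IsGreatest j ∧ IsLeast {k | j < k ∧ k ∉ A.dom} k) (hA : A.dom.Nonempty)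
    (C : Set ℕ) (n : ℕ) : Nat.pair k n ∉ A.jump C := by
  rw [mem_jump_iff, Nat.unpair_pair]
  rintro (⟨h', -⟩ | ⟨h', -⟩ | ⟨j, hj, hk, -⟩)
  · simp [h'] at hA
  · exact hk h'
  · exact h ⟨j, hj, hk⟩

/-- The initial segments of a presentation: number `0` is the whole presentation, and
number `k + 1` is the restriction to `{j | j ≺ k}`. -/
def seg (A : Presentation) : ℕ → Presentation
  | 0 => A
  | k + 1 => A.below k

/-- `K` is the number of an initial segment. -/
def ValidSeg (A : Presentation) (K : ℕ) : Prop := K = 0 ∨ ∃ k ∈ A.dom, K = k + 1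

/-- The recursion never leaves the family `A.seg`, so a number `K` is enough to describe where it
stands. -/
theorem seg_below {A : Presentation} {K j : ℕ} (hj : j ∈ (A.seg K).dom) :
    (A.seg K).below j = A.seg (j + 1) := by
  match K with
  | 0 => rfl
  | k + 1 => exact A.below_below hj

theorem mem_dom_of_mem_seg {A : Presentation} {K j : ℕ} (hj : j ∈ (A.seg K).dom) : j ∈ A.dom := by
  match K with
  | 0 => exact hj
  | k + 1 => exact (A.lt_dom _ _ hj).1

theorem validSeg_succ {A : Presentation} {j : ℕ} (hj : j ∈ A.dom) : A.ValidSeg (j + 1) :=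
  .inr ⟨j, hj, rfl⟩

theorem seg_one_dom (A : Presentation) : (A.seg 1).dom = ∅ := by
  ext j
  simp only [Set.mem_empty_iff_false, iff_false]
  intro (h : A.lt j 0)
  by_cases hj : j = 0
  · exact A.lt_irrefl 0 (hj ▸ h)
  · exact A.lt_irrefl 0 (A.lt_trans ((A.zero_least ⟨0, (A.lt_dom _ _ h).2⟩).2 j
      (A.lt_dom _ _ h).1 hj) h)

theorem zero_mem_seg {A : Presentation} (hA : A.dom.Nonempty) {K : ℕ} (hK : A.ValidSeg K)
    (h1 : K ≠ 1) : 0 ∈ (A.seg K).dom := by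
  have h0 := A.zero_least hA
  rcases hK with rfl | ⟨k, hk, rfl⟩
  · exact h0.1
  · exact h0.2 k hk (by omega)

/-- Since `0` is the least element, column `0` is the jump along the empty segment. Every call of
the recursion recovers `S` in this way, and with it the diagram. -/
theorem column_zero_jump_seg {A : Presentation} (hA : A.dom.Nonempty) {K : ℕ}
    (hK : A.ValidSeg K) (h1 : K ≠ 1) (C : Set ℕ) : column 0 ((A.seg K).jump C) = C := by
  have h := zero_mem_seg hA hK h1
  rw [column_jump_of_mem h, seg_below h]
  exact jump_of_dom_eq_empty A.seg_one_dom C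

end Presentation

/-! ### Deciding the structure of initial segments -/

/-- The program `d` accepts `m` with oracle `S`. -/
def Accepts (S : Set ℕ) (d m : ℕ) : Prop := 1 ∈ Phi d S m

/-- The program `d` rejects `m` with oracle `S`. -/
def Rejects (S : Set ℕ) (d m : ℕ) : Prop := 0 ∈ Phi d S m

theorem Decides.accepts {d : ℕ} {S B : Set ℕ} (h : Decides d S B) (m : ℕ) :
    Accepts S d m ↔ m ∈ B := by
  rw [Accepts, h m, Part.mem_some_iff, charFun]
  split_ifs with h <;> simp [h]

theorem Decides.rejects {d : ℕ} {S B : Set ℕ} (h : Decides d S B) (m : ℕ) :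
    Rejects S d m ↔ m ∉ B := by
  rw [Rejects, h m, Part.mem_some_iff, charFun]
  split_ifs with h <;> simp [h]

open Presentation

/-- `k` belongs to the initial segment number `K`. -/
def InSeg (S : Set ℕ) (d K k : ℕ) : Prop :=
  Accepts S d (domCode k) ∧ (K = 0 ∨ ∃ l, K = l + 1 ∧ Accepts S d (leCode k l) ∧ k ≠ l)

/-- `k` does not belong to the initial segment number `K`. -/
def NotInSeg (S : Set ℕ) (d K k : ℕ) : Prop :=
  Rejects S d (domCode k) ∨ ∃ l, K = l + 1 ∧ (k = l ∨ Rejects S d (leCode k l))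

/-- `j` is the greatest element of the initial segment number `K`. -/
def MaxSeg (S : Set ℕ) (d K j : ℕ) : Prop :=
  InSeg S d K j ∧ (K = 0 ∧ Accepts S d (maxCode j) ∨
    ∃ l, K = l + 1 ∧ Accepts S d (maxBelowCode l j))

/-- The initial segment number `K` has no greatest element. -/
def NoMaxSeg (S : Set ℕ) (d K : ℕ) : Prop :=
  K = 0 ∧ Accepts S d noMaxCode ∨ ∃ l, K = l + 1 ∧ Accepts S d (noMaxBelowCode l)

/-- `k` is the least number above `j` outside the initial segment number `K`. -/
def JumpColumn (S : Set ℕ) (d K j k : ℕ) : Prop :=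
  j < k ∧ NotInSeg S d K k ∧ ∀ i < k, i ≤ j ∨ InSeg S d K i

/-- The column `k` of a jump along the initial segment number `K` is empty. -/
def EmptyColumn (S : Set ℕ) (d K k : ℕ) : Prop :=
  NotInSeg S d K k ∧ (NoMaxSeg S d K ∨
    ∃ j, MaxSeg S d K j ∧ (k ≤ j ∨ ∃ i, j < i ∧ i < k ∧ NotInSeg S d K i))

section Sigma1

variable {α : Type*} [Primcodable α] {d m K k j : α → ℕ}

theorem Sigma1.accepts (hd : Computable d) (hm : Computable m) :
    Sigma1 fun Y a => Accepts Y (d a) (m a) :=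
  phi.comp (f := fun a => (d a, m a, 1)) (by fun_prop)

theorem Sigma1.rejects (hd : Computable d) (hm : Computable m) :
    Sigma1 fun Y a => Rejects Y (d a) (m a) :=
  phi.comp (f := fun a => (d a, m a, 0)) (by fun_prop)

@[fun_prop]
theorem Computable.domCode (hk : Computable k) : Computable fun a => domCode (k a) := by
  unfold Presentation.domCode
  fun_prop

@[fun_prop]
theorem Computable.leCode (hk : Computable k) (hj : Computable j) :
    Computable fun a => leCode (k a) (j a) := by
  unfold Presentation.leCode
  fun_prop

@[fun_prop]
theorem Computable.maxCode (hj : Computable j) : Computable fun a => maxCode (j a) := by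
  unfold Presentation.maxCode
  fun_prop

@[fun_prop]
theorem Computable.maxBelowCode (hk : Computable k) (hj : Computable j) :
    Computable fun a => maxBelowCode (k a) (j a) := by
  unfold Presentation.maxBelowCode
  fun_prop

@[fun_prop]
theorem Computable.noMaxBelowCode (hk : Computable k) :
    Computable fun a => noMaxBelowCode (k a) := by
  unfold Presentation.noMaxBelowCode
  fun_prop

theorem Sigma1.inSeg (hd : Computable d) (hK : Computable K) (hk : Computable k) :
    Sigma1 fun Y a => InSeg Y (d a) (K a) (k a) := by
  refine (accepts hd (by fun_prop)).and (or (eq hK (by fun_prop)) (ex (and (eq ?_ ?_)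
    (and (accepts ?_ ?_) (ne ?_ ?_))))) <;> fun_prop

theorem Sigma1.notInSeg (hd : Computable d) (hK : Computable K) (hk : Computable k) :
    Sigma1 fun Y a => NotInSeg Y (d a) (K a) (k a) := by
  refine (rejects hd (by fun_prop)).or (ex (and (eq ?_ ?_)
    (or (eq ?_ ?_) (rejects ?_ ?_)))) <;> fun_prop

theorem Sigma1.maxSeg (hd : Computable d) (hK : Computable K) (hj : Computable j) :
    Sigma1 fun Y a => MaxSeg Y (d a) (K a) (j a) := by
  refine (inSeg hd hK hj).and (or (and (eq ?_ ?_) (accepts ?_ ?_)) (ex (and (eq ?_ ?_)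
    (accepts ?_ ?_)))) <;> fun_prop

theorem Sigma1.noMaxSeg (hd : Computable d) (hK : Computable K) :
    Sigma1 fun Y a => NoMaxSeg Y (d a) (K a) := by
  refine or (and (eq ?_ ?_) (accepts ?_ ?_)) (ex (and (eq ?_ ?_) (accepts ?_ ?_))) <;> fun_prop

theorem Sigma1.jumpColumn (hd : Computable d) (hK : Computable K) (hj : Computable j)
    (hk : Computable k) : Sigma1 fun Y a => JumpColumn Y (d a) (K a) (j a) (k a) := by
  refine (lt hj hk).and ((notInSeg hd hK hk).and (ball_lt (or (le ?_ ?_)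
    (inSeg ?_ ?_ ?_)) ?_)) <;> fun_prop

theorem Sigma1.emptyColumn (hd : Computable d) (hK : Computable K) (hk : Computable k) :
    Sigma1 fun Y a => EmptyColumn Y (d a) (K a) (k a) := by
  refine (notInSeg hd hK hk).and (or (noMaxSeg hd hK) (ex (and (maxSeg ?_ ?_ ?_) (or (le ?_ ?_)
    (ex (and (lt ?_ ?_) (and (lt ?_ ?_) (notInSeg ?_ ?_ ?_)))))))) <;> fun_prop

end Sigma1

section Semantics

variable {A : Presentation} {S : Set ℕ} {d K : ℕ}

theorem inSeg_iff (hd : Decides d S A.completeDiagram) (hK : A.ValidSeg K)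
    {k : ℕ} :
    InSeg S d K k ↔ k ∈ (A.seg K).dom := by
  rw [InSeg, hd.accepts, domCode_mem]
  rcases hK with rfl | ⟨l, hl, rfl⟩
  · simp [seg]
  · simp only [Nat.add_eq_zero_iff, one_ne_zero, and_false, Nat.add_right_cancel_iff, false_or,
      exists_eq_left']
    rw [hd.accepts]
    constructor
    · rintro ⟨hk, h, hne⟩
      exact ((leCode_mem hk hl).1 h).resolve_left hne
    · intro h
      have hk := (A.lt_dom _ _ h).1
      exact ⟨hk, (leCode_mem hk hl).2 (.inr h), fun e => A.lt_irrefl l (e ▸ h)⟩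

theorem notInSeg_iff (hd : Decides d S A.completeDiagram) (hK : A.ValidSeg K)
    {k : ℕ} :
    NotInSeg S d K k ↔ k ∉ (A.seg K).dom := by
  rw [NotInSeg, hd.rejects, domCode_mem]
  rcases hK with rfl | ⟨l, hl, rfl⟩
  · simp [seg]
  · simp only [Nat.add_right_cancel_iff, exists_eq_left']
    rw [hd.rejects]
    by_cases hk : k ∈ A.dom
    · rw [leCode_mem hk hl]
      simp only [hk, not_true, false_or, not_or]
      constructor
      · rintro (rfl | ⟨-, h⟩)
        · exact A.lt_irrefl k
        · exact h
      · intro h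
        by_cases e : k = l
        · exact .inl e
        · exact .inr ⟨e, h⟩
    · simp only [hk, not_false_iff, true_or, true_iff]
      exact fun h => hk (A.lt_dom _ _ h).1

theorem maxSeg_iff (hd : Decides d S A.completeDiagram) (hK : A.ValidSeg K)
    {j : ℕ} :
    MaxSeg S d K j ↔ (A.seg K).IsGreatest j := by
  rw [MaxSeg, inSeg_iff hd hK, Presentation.IsGreatest]
  refine and_congr_right fun hj => ?_
  have hjA := mem_dom_of_mem_seg hj
  rcases hK with rfl | ⟨l, hl, rfl⟩
  · simp only [true_and, Nat.right_eq_add, Nat.add_eq_zero_iff, one_ne_zero, and_false, false_and,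
      exists_false, or_false]
    rw [hd.accepts, maxCode_mem hjA]
    exact forall₂_congr fun i _ => by rw [or_iff_not_imp_left]; rfl
  · simp only [Nat.add_eq_zero_iff, one_ne_zero, and_false, false_and, Nat.add_right_cancel_iff,
      exists_eq_left', false_or]
    rw [hd.accepts, maxBelowCode_mem hjA hl]
    constructor
    · intro h i (hi : A.lt i l) hij
      refine ⟨?_, hi, hj⟩
      by_contra hlt
      rcases h i (A.lt_dom _ _ hi).1 (by simp [hij, hlt]) with rfl | h'
      · exact A.lt_irrefl _ hi
      · exact A.lt_irrefl _ (A.lt_trans hi h')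
    · intro h i hi hij
      rw [not_or] at hij
      rcases A.lt_trichotomy hl hi with h' | h' | h'
      · exact .inr h'
      · exact .inl h'
      · exact absurd (h i h' hij.1).1 hij.2

theorem noMaxSeg_iff (hd : Decides d S A.completeDiagram) (hK : A.ValidSeg K) :
    NoMaxSeg S d K ↔ ¬ ∃ j, (A.seg K).IsGreatest j := by
  have key := fun j => maxSeg_iff (j := j) hd hK
  simp only [← key, NoMaxSeg, MaxSeg, inSeg_iff hd hK]
  rcases hK with rfl | ⟨l, hl, rfl⟩
  · simp only [true_and, Nat.right_eq_add, Nat.add_eq_zero_iff, one_ne_zero, and_false, false_and,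
      exists_false, or_false]
    rw [hd.accepts, noMaxCode_mem, not_exists]
    refine forall_congr' fun j => ?_
    rw [not_and]
    refine forall_congr' fun hj => ?_
    rw [hd.accepts, maxCode_mem hj]
  · simp only [Nat.add_eq_zero_iff, one_ne_zero, and_false, false_and, Nat.add_right_cancel_iff,
      exists_eq_left', false_or]
    rw [hd.accepts, noMaxBelowCode_mem hl, not_exists]
    refine forall_congr' fun j => ?_
    rw [not_and]
    constructor
    · intro h hj
      have hjA := (A.lt_dom _ _ hj).1
      rw [hd.accepts, maxBelowCode_mem hjA hl]
      exact h hjA hj fun e => A.lt_irrefl l (e ▸ hj)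
    · intro h hjA hj _
      have := h hj
      rwa [hd.accepts, maxBelowCode_mem hjA hl] at this

theorem jumpColumn_iff (hd : Decides d S A.completeDiagram) (hK : A.ValidSeg K)
    {j k : ℕ} :
   
    JumpColumn S d K j k ↔ IsLeast {k | j < k ∧ k ∉ (A.seg K).dom} k := by
  simp only [JumpColumn, notInSeg_iff hd hK, inSeg_iff hd hK]
  constructor
  · rintro ⟨h1, h2, h3⟩
    refine ⟨⟨h1, h2⟩, fun i ⟨hi, hi'⟩ => ?_⟩
    by_contra hlt
    rcases h3 i (not_le.1 hlt) with h | h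
    · omega
    · exact hi' h
  · rintro ⟨⟨h1, h2⟩, h3⟩
    refine ⟨h1, h2, fun i hi => ?_⟩
    by_contra h
    rw [not_or] at h
    have := h3 ⟨not_le.1 h.1, h.2⟩
    omega

theorem emptyColumn_iff (hd : Decides d S A.completeDiagram) (hK : A.ValidSeg K)
    {k : ℕ} :
    EmptyColumn S d K k ↔ k ∉ (A.seg K).dom ∧
    ¬ ∃ j, (A.seg K).IsGreatest j ∧ IsLeast {k | j < k ∧ k ∉ (A.seg K).dom} k := by
  simp only [EmptyColumn, notInSeg_iff hd hK, noMaxSeg_iff hd hK, maxSeg_iff hd hK]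
  refine and_congr_right fun hk => ?_
  constructor
  · rintro (h | ⟨j, hj, h⟩) ⟨j', hj', h'⟩
    · exact h ⟨j', hj'⟩
    · obtain rfl := hj.unique hj'
      rcases h with h | ⟨i, h1, h2, h3⟩
      · have := h'.1.1
        omega
      · have := h'.2 ⟨h1, h3⟩
        omega
  · intro h
    by_contra hn
    rw [not_or, not_not] at hn
    obtain ⟨⟨j, hj⟩, hn⟩ := hn
    refine h ⟨j, hj, (jumpColumn_iff hd hK).1 ?_⟩
    rw [JumpColumn, notInSeg_iff hd hK]
    simp only [inSeg_iff hd hK]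
    refine ⟨?_, hk, fun i hi => ?_⟩
    · by_contra hle
      exact hn ⟨j, hj, .inl (not_lt.1 hle)⟩
    · by_contra hi'
      rw [not_or] at hi'
      exact hn ⟨j, hj, .inr ⟨i, not_le.1 hi'.1, hi, hi'.2⟩⟩

end Semantics

end

section

open Encodable
open Nat.Partrec (Code)
open Presentation

/-! ### The procedure -/

/-- The rational number `q n` as a triple: it is the difference of the first two entries divided
by the third one. -/
def ratData (q : ℕ ≃ ℚ) (n : ℕ) : ℕ × ℕ × ℕ :=
  ((q n).num.toNat, (-(q n).num).toNat, (q n).den)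

/-- `q a < r / 2 ^ t - s`. -/
def LtPoint (D : ℕ → ℕ × ℕ × ℕ) (a s t r : ℕ) : Prop :=
  ((D a).1 + s * (D a).2.2) * 2 ^ t <
    r * (D a).2.2 + (D a).2.1 * 2 ^ t

/-- `r / 2 ^ t - s ≤ q a`. -/
def PointLe (D : ℕ → ℕ × ℕ × ℕ) (a s t r : ℕ) : Prop :=
  r * (D a).2.2 + (D a).2.1 * 2 ^ t ≤
    ((D a).1 + s * (D a).2.2) * 2 ^ t

/-- `r / 2 ^ t - s = q a`. -/
def PointEq (D : ℕ → ℕ × ℕ × ℕ) (a s t r : ℕ) : Prop :=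
  r * (D a).2.2 + (D a).2.1 * 2 ^ t =
    ((D a).1 + s * (D a).2.2) * 2 ^ t

/-- The cell `[r / 2 ^ t - s, (r + 1) / 2 ^ t - s)` forces that the truth value of `m ∈ X` is `b`,
for `X` the join of `Y` and the two cuts of a real number. -/
def BaseAns (D : ℕ → ℕ × ℕ × ℕ) (Y : Set ℕ) (m : ℕ) (b : Bool) (s t r : ℕ) : Prop :=
  (∃ n, m = 2 * n ∧ (n ∈ Y ↔ b = true)) ∨
  (∃ a, m = 2 * (2 * a) + 1 ∧ (b = true ∧ LtPoint D a s t r ∨ b = false ∧ PointLe D a s t (r + 1))) ∨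
  ∃ a, m = 2 * (2 * a + 1) + 1 ∧
    (b = true ∧ PointLe D a s t (r + 1) ∨ b = false ∧ LtPoint D a s t r)

/-- The cell `(s, t, r)` forces that the truth value of `m ∈ X^(B)` is `b`, where `B` is the
initial segment number `K`. -/
def Ans (c : Code) (Y : Set ℕ) (P d K m : ℕ) (b : Bool) (s t r : ℕ) : Prop :=
  EnumeratedBy c Y (P, d, K, m, b, s, t, r)

/-- The cell `(s, t, r)` forces that the program `n` halts on input `n` with oracle `X^(B)`,
where `B` is the initial segment number `j + 1`. Such computations are enumerated by `T`. -/
def Halts (T : ℕ → ℕ → Option (List (ℕ × Bool))) (c : Code) (Y : Set ℕ)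
    (P d j n s t r : ℕ) : Prop :=
  ∃ w σ, T n w = some σ ∧
    ∀ p ∈ σ, ∃ t', t' ≤ t ∧ Ans c Y P d (j + 1) p.1 p.2 s t' (r / 2 ^ (t - t'))

/-- The cells that force halting and do not lie below the list `F` of cells of level `t` have total
measure larger than `2 ^ (-w)`. -/
def Exceeds (T : ℕ → ℕ → Option (List (ℕ × Bool))) (c : Code) (Y : Set ℕ)
    (P d w j n s t : ℕ) (F : List ℕ) : Prop :=
  ∃ u, ∃ G : List ℕ, t ≤ u ∧ (∀ r ∈ G, Halts T c Y P d j n s u r ∧ r / 2 ^ (u - t) ∉ F) ∧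
    2 ^ u < ((List.range (2 * s * 2 ^ u)).filter fun r => r ∈ G).length * 2 ^ w

/-- The error bounds are `2 ^ (- weight P K n s)`. -/
def weight (P K n s : ℕ) : ℕ := P + 2 + Nat.pair K (Nat.pair n s)

/-- `F` is the list of cells of level `t` that force halting, and the measure not accounted for is
small. This is decided by the jump `J`, in which `e` and `g` are indices for the questions. -/
def Good (e : ℕ × ℕ × ℕ × ℕ × ℕ × ℕ × ℕ → ℕ) (g : ℕ × ℕ × ℕ × ℕ × ℕ × ℕ × ℕ × List ℕ → ℕ)
    (J : Set ℕ) (P d K j n s t : ℕ) (F : List ℕ) : Prop :=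
  (∀ r < 2 * s * 2 ^ t, (e (P, d, j, n, s, t, r) ∈ J ↔ decide (r ∈ F) = true)) ∧
    g (P, d, weight P K n s, j, n, s, t, F) ∉ J

/-- The cell `(s, t, r)` forces that the truth value of the halting of the program `n` is `b`, up
to an error. -/
def JumpAns (e : ℕ × ℕ × ℕ × ℕ × ℕ × ℕ × ℕ → ℕ) (g : ℕ × ℕ × ℕ × ℕ × ℕ × ℕ × ℕ × List ℕ → ℕ)
    (J : Set ℕ) (P d K j n : ℕ) (b : Bool) (s t r : ℕ) : Prop :=
  ∃ F, Good e g J P d K j n s t F ∧ r < 2 * s * 2 ^ t ∧ decide (r ∈ F) = b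

/-- The cell `(s, u, r)` is part of the error. -/
def Bad (e : ℕ × ℕ × ℕ × ℕ × ℕ × ℕ × ℕ → ℕ) (g : ℕ × ℕ × ℕ × ℕ × ℕ × ℕ × ℕ × List ℕ → ℕ)
    (J : Set ℕ) (P d K j n s u r : ℕ) : Prop :=
  r < 2 * s * 2 ^ u ∧ e (P, d, j, n, s, u, r) ∈ J ∧
    ∃ t F, t ≤ u ∧ Good e g J P d K j n s t F ∧ decide (r / 2 ^ (u - t) ∈ F) = false

/-- The recursive definition of `Ans`. -/
def Step (D : ℕ → ℕ × ℕ × ℕ) (c : Code) (e : ℕ × ℕ × ℕ × ℕ × ℕ × ℕ × ℕ → ℕ)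
    (g : ℕ × ℕ × ℕ × ℕ × ℕ × ℕ × ℕ × List ℕ → ℕ) (Y : Set ℕ) (P d K m : ℕ) (b : Bool)
    (s t r : ℕ) : Prop :=
  (K = 1 ∧ BaseAns D Y m b s t r) ∨ (K ≠ 1 ∧
    ((InSeg (column 0 Y) d K m.unpair.1 ∧
        Ans c (column m.unpair.1 Y) P d (m.unpair.1 + 1) m.unpair.2 b s t r) ∨
      (b = false ∧ EmptyColumn (column 0 Y) d K m.unpair.1) ∨
      ∃ j, MaxSeg (column 0 Y) d K j ∧ JumpColumn (column 0 Y) d K j m.unpair.1 ∧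
        JumpAns e g (column m.unpair.1 Y) P d K j m.unpair.2 b s t r))

theorem Computable.ratData {q : ℕ ≃ ℚ} (hq : Computable fun n => ((q n).num, (q n).den)) :
    Computable (ratData q) := by
  have key : ∀ n : ℕ, Denumerable.ofNat ℤ n = Equiv.intEquivNat.symm n := fun n => rfl
  -- In the coding of the integers, even numbers code the nonnegative ones and odd numbers the
  -- negative ones.
  have hz : ∀ n : ℕ, Equiv.intEquivNat.symm n =
      if n % 2 = 0 then ((n / 2 : ℕ) : ℤ) else Int.negSucc (n / 2) := by
    intro n
    rw [Equiv.symm_apply_eq]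
    split_ifs with h
    · exact (by omega : n = 2 * (n / 2))
    · exact (by omega : n = 2 * (n / 2) + 1)
  have h1 : Primrec Int.toNat := by
    refine Primrec.ofNat_iff.2 ?_
    refine (Primrec.ite (Primrec.eq.comp (Primrec.nat_mod.comp .id (.const 2)) (.const 0))
      (Primrec.nat_div.comp .id (.const 2)) (.const 0)).of_eq fun n => ?_
    rw [key, hz]
    simp only [id_eq]
    split_ifs <;> simp
    omega
  have h2 : Primrec fun z : ℤ => (-z).toNat := by
    refine Primrec.ofNat_iff.2 ?_
    refine (Primrec.ite (Primrec.eq.comp (Primrec.nat_mod.comp .id (.const 2)) (.const 0))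
      (.const 0) (Primrec.succ.comp (Primrec.nat_div.comp .id (.const 2)))).of_eq fun n => ?_
    rw [key, hz]
    simp only [id_eq]
    split_ifs <;> simp <;> omega
  have h3 : Computable fun n => (q n).num := fst.comp hq
  exact (h1.to_comp.comp h3).pair ((h2.to_comp.comp h3).pair (snd.comp hq))

section Sigma1

variable {α : Type*} [Primcodable α] {P d K j n m s t r u w : α → ℕ} {b : α → Bool}
  {F : α → List ℕ} {c : α → Code} {D : ℕ → ℕ × ℕ × ℕ}

namespace Sigma1

theorem ltPoint (hD : Computable D) (hm : Computable m) (hs : Computable s)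
    (ht : Computable t) (hr : Computable r) :
    Sigma1 fun _ a => LtPoint D (m a) (s a) (t a) (r a) := by
  apply lt <;> fun_prop

theorem pointLe (hD : Computable D) (hm : Computable m) (hs : Computable s)
    (ht : Computable t) (hr : Computable r) :
    Sigma1 fun _ a => PointLe D (m a) (s a) (t a) (r a) := by
  apply le <;> fun_prop

theorem pointEq (hD : Computable D) (hm : Computable m) (hs : Computable s)
    (ht : Computable t) (hr : Computable r) :
    Sigma1 fun _ a => PointEq D (m a) (s a) (t a) (r a) := by
  apply eq <;> fun_prop

theorem baseAns (hD : Computable D) (hm : Computable m) (hb : Computable b)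
    (hs : Computable s) (ht : Computable t) (hr : Computable r) :
    Sigma1 fun Y a => BaseAns D Y (m a) (b a) (s a) (t a) (r a) := by
  have hlt : Sigma1 fun _ (p : α × ℕ) => LtPoint D p.2 (s p.1) (t p.1) (r p.1) := by
    apply ltPoint <;> fun_prop
  have hle : Sigma1 fun _ (p : α × ℕ) => PointLe D p.2 (s p.1) (t p.1) (r p.1 + 1) := by
    apply pointLe <;> fun_prop
  refine or (ex (and (eq ?_ ?_) (fact ?_ ?_))) (or (ex (and (eq ?_ ?_)
    (or (and (eq ?_ ?_) hlt) (and (eq ?_ ?_) hle)))) (ex (and (eq ?_ ?_)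
    (or (and (eq ?_ ?_) hle) (and (eq ?_ ?_) hlt))))) <;> fun_prop

theorem ans (hc : Computable c) (hP : Computable P) (hd : Computable d) (hK : Computable K)
    (hm : Computable m) (hb : Computable b) (hs : Computable s) (ht : Computable t)
    (hr : Computable r) :
    Sigma1 fun Y a => Ans (c a) Y (P a) (d a) (K a) (m a) (b a) (s a) (t a) (r a) :=
  enum.comp (f := fun a => (c a, P a, d a, K a, m a, b a, s a, t a, r a)) (by fun_prop)

theorem halts {T : ℕ → ℕ → Option (List (ℕ × Bool))} (hT : Primrec₂ T) (hc : Computable c)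
    (hP : Computable P) (hd : Computable d) (hj : Computable j)
    (hn : Computable n) (hs : Computable s) (ht : Computable t) (hr : Computable r) :
    Sigma1 fun Y a => Halts T (c a) Y (P a) (d a) (j a) (n a) (s a) (t a) (r a) := by
  refine ex (ex (and (eq (f := fun p : (α × ℕ) × List (ℕ × Bool) => T (n p.1.1) p.1.2)
    (g := fun p => some p.2) (hT.to_comp.comp ?_ ?_) (Computable.option_some.comp ?_)) ?_))
  any_goals fun_prop
  refine ball ?_ Computable.snd
  refine ex (and (le ?_ ?_) (ans ?_ ?_ ?_ ?_ ?_ ?_ ?_ ?_ ?_)) <;> fun_prop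

theorem _root_.Computable.decide_mem {x : α → ℕ} (hx : Computable x) (hF : Computable F) :
    Computable fun a => decide (x a ∈ F a) := by
  have h : PrimrecRel fun (L : List ℕ) x => x ∈ L :=
    (Primrec.eq (α := ℕ)).exists_mem_list.of_eq fun L x => by simp
  exact h.decide.to_comp.comp hF hx

theorem exceeds {T : ℕ → ℕ → Option (List (ℕ × Bool))} (hT : Primrec₂ T) (hc : Computable c)
    (hP : Computable P) (hd : Computable d) (hw : Computable w) (hj : Computable j)
    (hn : Computable n) (hs : Computable s) (ht : Computable t) (hF : Computable F) :
    Sigma1 fun Y a => Exceeds T (c a) Y (P a) (d a) (w a) (j a) (n a) (s a) (t a) (F a) := by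
  have hfil : Primrec₂ fun (L G : List ℕ) => L.filter fun r => r ∈ G := by
    have h : PrimrecRel fun (x : ℕ) (L : List ℕ) => x ∈ L :=
      ((Primrec.eq (α := ℕ)).exists_mem_list.of_eq fun L x => by simp).swap
    exact h.listFilter
  have hlen : Computable fun p : (α × ℕ) × List ℕ =>
      ((List.range (2 * s p.1.1 * 2 ^ p.1.2)).filter fun r => r ∈ p.2).length :=
    Computable.list_length.comp (hfil.to_comp.comp (by fun_prop) (by fun_prop))
  have hnot : Sigma1 fun _ (p : ((α × ℕ) × List ℕ) × ℕ) =>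
      p.2 / 2 ^ (p.1.1.2 - t p.1.1.1) ∉ F p.1.1.1 :=
    (ofBool (p := fun p : ((α × ℕ) × List ℕ) × ℕ =>
        !decide (p.2 / 2 ^ (p.1.1.2 - t p.1.1.1) ∈ F p.1.1.1))
      (Primrec.not.to_comp.comp (Computable.decide_mem (by fun_prop) (by fun_prop)))).of_iff
        fun Y a => by simp
  refine ex (ex (and (le ?_ ?_) (and ?_ (lt ?_ ?_))))
  any_goals fun_prop
  refine ball ?_ Computable.snd
  refine and (halts hT ?_ ?_ ?_ ?_ ?_ ?_ ?_ ?_) hnot <;> fun_prop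

variable {E : α × ℕ × ℕ × ℕ × ℕ × ℕ × ℕ × ℕ → ℕ} {G : α × ℕ × ℕ × ℕ × ℕ × ℕ × ℕ × ℕ × List ℕ → ℕ}

@[fun_prop]
theorem _root_.Computable.weight (hP : Computable P) (hK : Computable K) (hn : Computable n)
    (hs : Computable s) : Computable fun a => weight (P a) (K a) (n a) (s a) := by
  unfold _root_.weight
  fun_prop

theorem good (hE : Computable E) (hG : Computable G)
    (hP : Computable P) (hd : Computable d) (hK : Computable K) (hj : Computable j)
    (hn : Computable n) (hs : Computable s) (ht : Computable t) (hF : Computable F) :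
    Sigma1 fun Y a => Good (fun z => E (a, z)) (fun z => G (a, z)) Y (P a) (d a) (K a) (j a) (n a)
      (s a) (t a) (F a) := by
  refine and (ball_lt (fact ?_ (Computable.decide_mem ?_ ?_)) ?_) (notMem ?_) <;> fun_prop

theorem jumpAns (hE : Computable E) (hG : Computable G)
    (hP : Computable P) (hd : Computable d) (hK : Computable K) (hj : Computable j)
    (hn : Computable n) (hb : Computable b) (hs : Computable s) (ht : Computable t)
    (hr : Computable r) :
    Sigma1 fun Y a => JumpAns (fun z => E (a, z)) (fun z => G (a, z)) Y (P a) (d a) (K a) (j a)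
      (n a) (b a) (s a) (t a) (r a) := by
  refine ex (and (good (E := fun p : (α × List ℕ) × _ => E (p.1.1, p.2))
    (G := fun p : (α × List ℕ) × _ => G (p.1.1, p.2))
    ?_ ?_ ?_ ?_ ?_ ?_ ?_ ?_ ?_ ?_) (and (lt ?_ ?_) (eq (Computable.decide_mem ?_ ?_) ?_))) <;>
    fun_prop

theorem bad (hE : Computable E) (hG : Computable G)
    (hP : Computable P) (hd : Computable d) (hK : Computable K) (hj : Computable j)
    (hn : Computable n) (hs : Computable s) (hu : Computable u) (hr : Computable r) :
    Sigma1 fun Y a => Bad (fun z => E (a, z)) (fun z => G (a, z)) Y (P a) (d a) (K a) (j a)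
      (n a) (s a) (u a) (r a) := by
  refine and (lt ?_ ?_) (and (mem ?_) (ex (ex (and (le ?_ ?_)
    (and (good (E := fun p : ((α × ℕ) × List ℕ) × _ => E (p.1.1.1, p.2))
      (G := fun p : ((α × ℕ) × List ℕ) × _ => G (p.1.1.1, p.2))
      ?_ ?_ ?_ ?_ ?_ ?_ ?_ ?_ ?_ ?_) (eq (Computable.decide_mem ?_ ?_) ?_)))))) <;>
    fun_prop

theorem step (hD : Computable D) (hE : Computable E) (hG : Computable G)
    (hc : Computable c) (hP : Computable P) (hd : Computable d) (hK : Computable K)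
    (hm : Computable m) (hb : Computable b) (hs : Computable s) (ht : Computable t)
    (hr : Computable r) :
    Sigma1 fun Y a => Step D (c a) (fun z => E (a, z)) (fun z => G (a, z)) Y (P a) (d a) (K a)
      (m a) (b a) (s a) (t a) (r a) := by
  have h0 : Computable fun _ : α => 0 := .const 0
  have h0' : Computable fun _ : α × ℕ => 0 := .const 0
  have hm1 : Computable fun a => (m a).unpair.1 := by fun_prop
  have hm1' : Computable fun p : α × ℕ => (m p.1).unpair.1 := by fun_prop
  refine or (and (eq ?_ ?_) (baseAns hD ?_ ?_ ?_ ?_ ?_)) (and (ne ?_ ?_)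
    (or (and (column (inSeg hd hK hm1) h0) (column (ans hc hP hd (K := fun a => (m a).unpair.1 + 1)
      (m := fun a => (m a).unpair.2) ?_ ?_ hb hs ht hr) hm1))
    (or (and (eq ?_ ?_) (column (emptyColumn hd hK hm1) h0))
    (ex (and (column (maxSeg (d := fun p : α × ℕ => d p.1) (K := fun p : α × ℕ => K p.1)
      (j := fun p : α × ℕ => p.2) ?_ ?_ ?_) h0')
    (and (column (jumpColumn (d := fun p : α × ℕ => d p.1) (K := fun p : α × ℕ => K p.1)
      (j := fun p : α × ℕ => p.2) (k := fun p : α × ℕ => (m p.1).unpair.1) ?_ ?_ ?_ ?_) h0')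
    (column (jumpAns (E := fun p : (α × ℕ) × ℕ × ℕ × ℕ × ℕ × ℕ × ℕ × ℕ => E (p.1.1, p.2))
      (G := fun p : (α × ℕ) × ℕ × ℕ × ℕ × ℕ × ℕ × ℕ × ℕ × List ℕ => G (p.1.1, p.2))
      (P := fun p : α × ℕ => P p.1) (d := fun p : α × ℕ => d p.1) (K := fun p : α × ℕ => K p.1)
      (j := fun p : α × ℕ => p.2) (n := fun p : α × ℕ => (m p.1).unpair.2)
      (b := fun p : α × ℕ => b p.1) (s := fun p : α × ℕ => s p.1) (t := fun p : α × ℕ => t p.1)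
      (r := fun p : α × ℕ => r p.1) ?_ ?_ ?_ ?_ ?_ ?_ ?_ ?_ ?_ ?_ ?_) hm1'))))))) <;> fun_prop

end Sigma1

end Sigma1

/-- The programs and indices of the recursive procedure. -/
structure Procedure (D : ℕ → ℕ × ℕ × ℕ) where
  T : ℕ → ℕ → Option (List (ℕ × Bool))
  c : Code
  e : ℕ × ℕ × ℕ × ℕ × ℕ × ℕ × ℕ → ℕ
  g : ℕ × ℕ × ℕ × ℕ × ℕ × ℕ × ℕ × List ℕ → ℕ
  computable_e : Computable e
  computable_g : Computable g
  T_spec : ∀ Y n, (Phi n Y n).Dom ↔ ∃ w σ, T n w = some σ ∧ Holds σ Y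
  ans_iff : ∀ Y P d K m b s t r, Ans c Y P d K m b s t r ↔ Step D c e g Y P d K m b s t r
  e_spec : ∀ Y P d j n s t r x,
    (Phi (e (P, d, j, n, s, t, r)) Y x).Dom ↔ Halts T c Y P d j n s t r
  g_spec : ∀ Y P d w j n s t F x,
    (Phi (g (P, d, w, j, n, s, t, F)) Y x).Dom ↔ Exceeds T c Y P d w j n s t F

theorem exists_procedure {D : ℕ → ℕ × ℕ × ℕ} (hD : Computable D) : Nonempty (Procedure D) := by
  have hphi : Sigma1 fun Y (n : ℕ) => (Phi n Y n).Dom :=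
    (Sigma1.ex (P := fun Y n v => v ∈ Phi n Y n) (Sigma1.phi.comp
      (f := fun p : ℕ × ℕ => (p.1, p.1, p.2)) (by fun_prop))).of_iff fun Y n => Part.dom_iff_mem
  obtain ⟨T, hT, hTs⟩ := hphi
  -- The program `c` of the recursion is still a variable here: the indices of the questions are
  -- computable functions of `c`, and the fixed point is taken after that.
  obtain ⟨E, hE, hEs⟩ := (Sigma1.halts hT
    (c := fun p : Code × ℕ × ℕ × ℕ × ℕ × ℕ × ℕ × ℕ => p.1)
    (P := fun p => p.2.1) (d := fun p => p.2.2.1) (j := fun p => p.2.2.2.1)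
    (n := fun p => p.2.2.2.2.1) (s := fun p => p.2.2.2.2.2.1) (t := fun p => p.2.2.2.2.2.2.1)
    (r := fun p => p.2.2.2.2.2.2.2) (by fun_prop) (by fun_prop) (by fun_prop) (by fun_prop)
    (by fun_prop) (by fun_prop) (by fun_prop) (by fun_prop)).exists_index
  obtain ⟨G, hG, hGs⟩ := (Sigma1.exceeds hT
    (c := fun p : Code × ℕ × ℕ × ℕ × ℕ × ℕ × ℕ × ℕ × List ℕ => p.1)
    (P := fun p => p.2.1) (d := fun p => p.2.2.1) (w := fun p => p.2.2.2.1)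
    (j := fun p => p.2.2.2.2.1)
    (n := fun p => p.2.2.2.2.2.1) (s := fun p => p.2.2.2.2.2.2.1)
    (t := fun p => p.2.2.2.2.2.2.2.1)
    (F := fun p => p.2.2.2.2.2.2.2.2) (by fun_prop) (by fun_prop) (by fun_prop) (by fun_prop)
    (by fun_prop) (by fun_prop) (by fun_prop) (by fun_prop) (by fun_prop)).exists_index
  obtain ⟨c, hc⟩ := (Sigma1.step hD
    (E := fun p : (Code × ℕ × ℕ × ℕ × ℕ × Bool × ℕ × ℕ × ℕ) × _ => E (p.1.1, p.2))
    (G := fun p => G (p.1.1, p.2))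
    (c := fun p => p.1)
    (P := fun p => p.2.1) (d := fun p => p.2.2.1) (K := fun p => p.2.2.2.1)
    (m := fun p => p.2.2.2.2.1)
    (b := fun p => p.2.2.2.2.2.1) (s := fun p => p.2.2.2.2.2.2.1)
    (t := fun p => p.2.2.2.2.2.2.2.1)
    (r := fun p => p.2.2.2.2.2.2.2.2) (by fun_prop) (by fun_prop) (by fun_prop) (by fun_prop)
    (by fun_prop) (by fun_prop) (by fun_prop) (by fun_prop) (by fun_prop) (by fun_prop)
    (by fun_prop)).fixed_point
  exact ⟨{
    T := T
    c := c
    e := fun z => E (c, z)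
    g := fun z => G (c, z)
    computable_e := by fun_prop
    computable_g := by fun_prop
    T_spec := hTs
    ans_iff := fun Y P d K m b s t r => (hc Y (P, d, K, m, b, s, t, r)).symm
    e_spec := fun Y P d j n s t r x => hEs Y (c, P, d, j, n, s, t, r) x
    g_spec := fun Y P d w j n s t F x => hGs Y (c, P, d, w, j, n, s, t, F) x }⟩

end

/-! ### Dyadic cells, their measure, and rational end points. -/

section

open MeasureTheory Set Filter
open scoped ENNReal

/-- The end points of the cells. -/
noncomputable def point (s t r : ℕ) : ℝ := r / 2 ^ t - s

/-- The number of the cell of level `t` that contains `x`. -/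
noncomputable def cellIndex (s t : ℕ) (x : ℝ) : ℕ := ⌊(x + s) * 2 ^ t⌋₊

section Cells

variable {s t u r : ℕ} {x : ℝ}

theorem point_le_iff : point s t r ≤ x ↔ (r : ℝ) ≤ (x + s) * 2 ^ t := by
  rw [point, sub_le_iff_le_add, div_le_iff₀ (by positivity)]

theorem lt_point_iff : x < point s t r ↔ (x + s) * 2 ^ t < r := by
  rw [point, lt_sub_iff_add_lt, lt_div_iff₀ (by positivity)]

theorem cellIndex_eq_iff (hx : -(s : ℝ) ≤ x) :
    cellIndex s t x = r ↔ point s t r ≤ x ∧ x < point s t (r + 1) := by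
  rw [cellIndex, Nat.floor_eq_iff (mul_nonneg (by linarith) (by positivity)), point_le_iff,
    lt_point_iff]
  push_cast
  rfl

theorem point_cellIndex_le (hx : -(s : ℝ) ≤ x) : point s t (cellIndex s t x) ≤ x :=
  ((cellIndex_eq_iff hx).1 rfl).1

theorem lt_point_cellIndex_succ (hx : -(s : ℝ) ≤ x) : x < point s t (cellIndex s t x + 1) :=
  ((cellIndex_eq_iff hx).1 rfl).2

theorem point_succ : point s t (r + 1) = point s t r + 1 / 2 ^ t := by
  unfold point
  push_cast
  ring

theorem cellIndex_lt (hx : -(s : ℝ) ≤ x) (hx' : x < s) : cellIndex s t x < 2 * s * 2 ^ t := by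
  rw [cellIndex, Nat.floor_lt (mul_nonneg (by linarith) (by positivity))]
  push_cast
  have : (0 : ℝ) < 2 ^ t := by positivity
  nlinarith

/-- Dropping the last `u - t` binary digits leads to the ancestor of level `t`. -/
theorem cellIndex_div (h : t ≤ u) (x : ℝ) :
    cellIndex s u x / 2 ^ (u - t) = cellIndex s t x := by
  have h2 : ((2 : ℝ) ^ u) = 2 ^ t * ((2 ^ (u - t) : ℕ) : ℝ) := by
    push_cast
    rw [← pow_add]
    congr 1
    omega
  rw [cellIndex, cellIndex, ← Nat.floor_div_natCast, h2]
  congr 1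
  have : (((2 ^ (u - t) : ℕ)) : ℝ) ≠ 0 := by positivity
  field_simp

theorem neg_le_point : -(s : ℝ) ≤ point s t r := by
  unfold point
  have : (0 : ℝ) ≤ r / 2 ^ t := by positivity
  linarith

theorem point_le_of_le (h : r ≤ 2 * s * 2 ^ t) : point s t r ≤ s := by
  rw [point_le_iff]
  have : (r : ℝ) ≤ 2 * s * 2 ^ t := by exact_mod_cast h
  linarith

/-- The part of `[-s, s)` in the cells with number in `C`. -/
def cellSet (s t : ℕ) (C : Set ℕ) : Set ℝ := {x | -(s : ℝ) ≤ x ∧ x < s ∧ cellIndex s t x ∈ C}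

theorem cellSet_eq (C : Finset ℕ) (hC : ∀ r ∈ C, r < 2 * s * 2 ^ t) :
    cellSet s t C = ⋃ r ∈ C, Ico (point s t r) (point s t (r + 1)) := by
  ext x
  simp only [cellSet, mem_ofPred_eq, Finset.mem_coe, mem_iUnion, mem_Ico, exists_prop]
  constructor
  · rintro ⟨h1, h2, h3⟩
    exact ⟨_, h3, point_cellIndex_le h1, lt_point_cellIndex_succ h1⟩
  · rintro ⟨r, hr, h1, h2⟩
    have h3 : -(s : ℝ) ≤ x := neg_le_point.trans h1
    refine ⟨h3, h2.trans_le (point_le_of_le (hC r hr)), ?_⟩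
    rwa [(cellIndex_eq_iff h3).2 ⟨h1, h2⟩]

theorem measurableSet_cellSet (C : Finset ℕ) (hC : ∀ r ∈ C, r < 2 * s * 2 ^ t) :
    MeasurableSet (cellSet s t C) := by
  rw [cellSet_eq C hC]
  exact Finset.measurableSet_biUnion _ fun _ _ => measurableSet_Ico

theorem volume_cellSet (C : Finset ℕ) (hC : ∀ r ∈ C, r < 2 * s * 2 ^ t) :
    volume (cellSet s t C) = ENNReal.ofReal (C.card / 2 ^ t) := by
  rw [cellSet_eq C hC, measure_biUnion_finset]
  · simp only [Real.volume_Ico, point_succ, add_sub_cancel_left]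
    rw [Finset.sum_const, ← ENNReal.ofReal_nsmul]
    congr 1
    simp [div_eq_mul_inv]
  · intro i _ j _ hij
    refine Set.disjoint_left.2 fun x hi hj => hij ?_
    have h3 : -(s : ℝ) ≤ x := neg_le_point.trans hi.1
    rw [← (cellIndex_eq_iff h3).2 hi, (cellIndex_eq_iff h3).2 hj]
  · exact fun _ _ => measurableSet_Ico

end Cells

/-! ### Monotone families of cells -/

open scoped Classical in
/-- The cells of level `u` in `E` that do not lie below a cell of level `t` in `E`. -/
noncomputable def newCells (E : ℕ → ℕ → Prop) (s t u : ℕ) : Finset ℕ :=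
  (Finset.range (2 * s * 2 ^ u)).filter fun r => E u r ∧ ¬ E t (r / 2 ^ (u - t))

/-- At some level, the new cells have measure larger than `2 ^ (-w)`. -/
def Large (E : ℕ → ℕ → Prop) (s w t : ℕ) : Prop :=
  ∃ u, t ≤ u ∧ 2 ^ u < (newCells E s t u).card * 2 ^ w

theorem newCells_lt {E : ℕ → ℕ → Prop} {s t u : ℕ} : ∀ r ∈ newCells E s t u, r < 2 * s * 2 ^ u := by
  classical
  exact fun _ hr => Finset.mem_range.1 (Finset.mem_filter.1 hr).1

theorem mem_cellSet_newCells {E : ℕ → ℕ → Prop} {s t u : ℕ} (h : t ≤ u) {x : ℝ} :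
    x ∈ cellSet s u (newCells E s t u) ↔ -(s : ℝ) ≤ x ∧ x < s ∧ E u (cellIndex s u x) ∧
      ¬ E t (cellIndex s t x) := by
  simp only [cellSet, mem_ofPred_eq, newCells, Finset.mem_coe, Finset.mem_filter,
    Finset.mem_range, cellIndex_div h]
  exact and_congr_right fun h1 => and_congr_right fun h2 => by simp [cellIndex_lt h1 h2]

section Monotone

variable {E : ℕ → ℕ → Prop}

theorem cellIndex_mono (hE : ∀ t u r, t ≤ u → E t (r / 2 ^ (u - t)) → E u r) {s t u : ℕ}
    (h : t ≤ u) {x : ℝ} (hx : E t (cellIndex s t x)) : E u (cellIndex s u x) :=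
  hE t u _ h (by rwa [cellIndex_div h])

/-- The unions `V t` of the cells of level `t` increase inside a bounded interval, so the measure of
what `V t` misses of their union tends to zero. -/
theorem exists_not_large (hE : ∀ t u r, t ≤ u → E t (r / 2 ^ (u - t)) → E u r) (s w : ℕ) :
    ∃ t, ¬ Large E s w t := by
  classical
  by_contra hn
  push Not at hn
  let C : ℕ → Finset ℕ := fun t => (Finset.range (2 * s * 2 ^ t)).filter fun r => E t r
  have hC : ∀ t, ∀ r ∈ C t, r < 2 * s * 2 ^ t :=
    fun _ _ hr => Finset.mem_range.1 (Finset.mem_filter.1 hr).1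
  let V : ℕ → Set ℝ := fun t => cellSet s t (C t)
  have hV : ∀ t x, x ∈ V t ↔ -(s : ℝ) ≤ x ∧ x < s ∧ E t (cellIndex s t x) := by
    intro t x
    simp only [V, cellSet, mem_ofPred_eq, C, Finset.mem_coe, Finset.mem_filter, Finset.mem_range]
    exact and_congr_right fun h1 => and_congr_right fun h2 => by simp [cellIndex_lt h1 h2]
  have hVm : ∀ t, MeasurableSet (V t) := fun t => measurableSet_cellSet _ (hC t)
  have hmono : Monotone V := fun t u h x hx => by
    rw [hV] at hx ⊢
    exact ⟨hx.1, hx.2.1, cellIndex_mono hE h hx.2.2⟩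
  have hlim := tendsto_measure_iInter_atTop (μ := volume) (s := fun t => (⋃ u, V u) \ V t)
    (fun t => ((MeasurableSet.iUnion hVm).diff (hVm t)).nullMeasurableSet)
    (fun t u h => sdiff_subset_sdiff_right (hmono h)) ⟨0, by
      refine ne_top_of_le_ne_top (b := volume (Ico (-(s : ℝ)) s)) (by simp) (measure_mono ?_)
      intro x hx
      obtain ⟨u, hu⟩ := mem_iUnion.1 hx.1
      rw [hV] at hu
      exact ⟨hu.1, hu.2.1⟩⟩
  have hempty : ⋂ t, ((⋃ u, V u) \ V t) = ∅ := by
    ext x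
    simp only [mem_iInter, Set.mem_sdiff, mem_iUnion, mem_empty_iff_false, iff_false, not_forall]
    by_contra hx
    push Not at hx
    obtain ⟨u, hu⟩ := (hx 0).1
    exact (hx u).2 hu
  rw [hempty, measure_empty] at hlim
  have hpos : (0 : ℝ≥0∞) < ENNReal.ofReal (1 / 2 ^ w) := ENNReal.ofReal_pos.2 (by positivity)
  obtain ⟨t, ht⟩ := ((tendsto_order.1 hlim).2 _ hpos).exists
  obtain ⟨u, htu, hu⟩ := hn t
  refine absurd ht (not_lt.2 ?_)
  calc ENNReal.ofReal (1 / 2 ^ w)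
      ≤ ENNReal.ofReal ((newCells E s t u).card / 2 ^ u) := by
        refine ENNReal.ofReal_le_ofReal ?_
        rw [div_le_div_iff₀ (by positivity) (by positivity), one_mul]
        exact_mod_cast hu.le
    _ = volume (cellSet s u (newCells E s t u)) := (volume_cellSet _ newCells_lt).symm
    _ ≤ _ := by
        refine measure_mono fun x hx => ?_
        rw [mem_cellSet_newCells htu] at hx
        refine ⟨mem_iUnion.2 ⟨u, (hV u x).2 ⟨hx.1, hx.2.1, hx.2.2.1⟩⟩, fun h => ?_⟩
        exact hx.2.2.2 ((hV t x).1 h).2.2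

/-- The bound holds for all admissible levels `t` at once: each is at least the first one `t₀`, so a
point missed at level `t` was already missed at `t₀`. All errors thus lie in the increasing union of
the new cells over `t₀`. -/
theorem volume_le_of_not_large (hE : ∀ t u r, t ≤ u → E t (r / 2 ^ (u - t)) → E u r) (s w : ℕ) :
    volume {x : ℝ | -(s : ℝ) ≤ x ∧ x < s ∧ ∃ t u, t ≤ u ∧ ¬ Large E s w t ∧
      E u (cellIndex s u x) ∧ ¬ E t (cellIndex s t x)} ≤ ENNReal.ofReal (1 / 2 ^ w) := by
  classical
  have hex := exists_not_large hE s w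
  let t₀ := Nat.find hex
  have ht₀ : ¬ Large E s w t₀ := Nat.find_spec hex
  let W : ℕ → Set ℝ := fun n => cellSet s (t₀ + n) (newCells E s t₀ (t₀ + n))
  have hmem : ∀ n x, x ∈ W n ↔ -(s : ℝ) ≤ x ∧ x < s ∧ E (t₀ + n) (cellIndex s (t₀ + n) x) ∧
      ¬ E t₀ (cellIndex s t₀ x) := fun n x => mem_cellSet_newCells (Nat.le_add_right _ _)
  have hmono : Monotone W := fun m n h x hx => by
    rw [hmem] at hx ⊢
    exact ⟨hx.1, hx.2.1, cellIndex_mono hE (by omega) hx.2.2.1, hx.2.2.2⟩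
  calc _ ≤ volume (⋃ n, W n) := by
        refine measure_mono ?_
        rintro x ⟨h1, h2, t, u, htu, hl, h3, h4⟩
        have htt : t₀ ≤ t := Nat.find_min' hex hl
        obtain ⟨n, rfl⟩ := Nat.exists_eq_add_of_le (htt.trans htu)
        exact mem_iUnion.2 ⟨n, (hmem n x).2 ⟨h1, h2, h3, fun h => h4 (cellIndex_mono hE htt h)⟩⟩
    _ = ⨆ n, volume (W n) := hmono.measure_iUnion
    _ ≤ _ := by
        refine iSup_le fun n => ?_
        rw [volume_cellSet _ newCells_lt]
        refine ENNReal.ofReal_le_ofReal ?_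
        rw [div_le_div_iff₀ (by positivity) (by positivity), one_mul]
        by_contra hlt
        exact ht₀ ⟨_, Nat.le_add_right _ n, by exact_mod_cast not_le.1 hlt⟩

end Monotone

/-! ### Rational numbers -/

theorem ratData_spec (q : ℕ ≃ ℚ) (a : ℕ) :
    (q a : ℝ) = (((ratData q a).1 : ℝ) - (ratData q a).2.1) / (ratData q a).2.2 := by
  have h : ((q a).num : ℝ) = ((q a).num.toNat : ℝ) - ((-(q a).num).toNat : ℝ) := by
    have : ((q a).num : ℤ) = ((q a).num.toNat : ℤ) - ((-(q a).num).toNat : ℤ) := by omega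
    exact_mod_cast congrArg (Int.cast (R := ℝ)) this
  simp only [ratData]
  rw [← h, Rat.cast_def]

theorem ltPoint_iff (q : ℕ ≃ ℚ) (a s t r : ℕ) :
    LtPoint (ratData q) a s t r ↔ (q a : ℝ) < point s t r := by
  have hD : (0 : ℝ) < (ratData q a).2.2 := by exact_mod_cast (q a).den_pos
  rw [lt_point_iff, ratData_spec, LtPoint, ← Nat.cast_lt (α := ℝ), div_add' _ _ _ hD.ne',
    div_mul_eq_mul_div, div_lt_iff₀ hD]
  push_cast
  constructor <;> intro h <;> linarith

theorem pointLe_iff (q : ℕ ≃ ℚ) (a s t r : ℕ) :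
    PointLe (ratData q) a s t r ↔ point s t r ≤ (q a : ℝ) := by
  rw [← not_lt, ← ltPoint_iff, LtPoint, not_lt, PointLe]

theorem pointEq_iff (q : ℕ ≃ ℚ) (a s t r : ℕ) :
    PointEq (ratData q) a s t r ↔ point s t r = (q a : ℝ) := by
  have hD : ((ratData q a).2.2 : ℝ) ≠ 0 := by exact_mod_cast (q a).den_nz
  rw [ratData_spec, point, PointEq, ← Nat.cast_inj (R := ℝ), sub_eq_iff_eq_add,
    div_add' _ _ _ hD, div_eq_div_iff (by positivity) hD]
  push_cast
  constructor <;> intro h <;> linarith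

theorem exists_rat_eq_point (s t r : ℕ) : ∃ z : ℚ, (z : ℝ) = point s t r :=
  ⟨(r : ℚ) / 2 ^ t - s, by simp [point]⟩

end

/-! ### Correctness of the procedure outside the bad cells. -/

section

open MeasureTheory Set Filter
open Presentation

/-- Facts may be forced by an ancestor of the cell, so halting is inherited by subcells. -/
theorem Halts.mono {T : ℕ → ℕ → Option (List (ℕ × Bool))} {c : Nat.Partrec.Code} {Y : Set ℕ}
    {P d j n s : ℕ} (t u r : ℕ) (htu : t ≤ u)
    (h : Halts T c Y P d j n s t (r / 2 ^ (u - t))) : Halts T c Y P d j n s u r := by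
  obtain ⟨w, σ, hT, h⟩ := h
  refine ⟨w, σ, hT, fun p hp => ?_⟩
  obtain ⟨t', ht', h'⟩ := h p hp
  refine ⟨t', ht'.trans htu, ?_⟩
  rw [Nat.div_div_eq_div_mul, ← pow_add] at h'
  rwa [show u - t' = u - t + (t - t') by omega]

theorem length_filter_range (N : ℕ) (G : List ℕ) (C : Finset ℕ) (hC : ∀ r ∈ C, r < N)
    (h : ∀ r < N, r ∈ G ↔ r ∈ C) : ((List.range N).filter fun r => r ∈ G).length = C.card := by
  rw [← List.toFinset_card_of_nodup (List.nodup_range.filter _)]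
  congr 1
  ext r
  simp only [List.toFinset_filter, List.toFinset_range, decide_eq_true_eq, Finset.mem_filter,
    Finset.mem_range]
  exact ⟨fun hr => (h r hr.1).1 hr.2, fun hr => ⟨hC r hr, (h r (hC r hr)).2 hr⟩⟩

theorem div_two_pow_lt {s t u r : ℕ} (htu : t ≤ u) (hr : r < 2 * s * 2 ^ u) :
    r / 2 ^ (u - t) < 2 * s * 2 ^ t := by
  rw [Nat.div_lt_iff_lt_mul (by positivity), mul_assoc, ← pow_add]
  rwa [show t + (u - t) = u by omega]

/-- `Exceeds` is `Σ₁` because it exhibits a finite list `G` of cells; filtering `range` discards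
repetitions and numbers outside the window. If `F` is exact at level `t`, the best `G` is the set of
all new cells. -/
theorem exceeds_iff {T : ℕ → ℕ → Option (List (ℕ × Bool))} {c : Nat.Partrec.Code} {Y : Set ℕ}
    {P d w j n s t : ℕ} {F : List ℕ}
    (hF : ∀ r < 2 * s * 2 ^ t, Halts T c Y P d j n s t r ↔ r ∈ F) :
    Exceeds T c Y P d w j n s t F ↔ Large (Halts T c Y P d j n s) s w t := by
  classical
  constructor
  · rintro ⟨u, G, htu, hG, h⟩
    refine ⟨u, htu, h.trans_le (Nat.mul_le_mul_right _ ?_)⟩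
    rw [length_filter_range _ G ((Finset.range (2 * s * 2 ^ u)).filter fun r => r ∈ G)
      (fun r hr => Finset.mem_range.1 (Finset.mem_filter.1 hr).1) (fun r hr => by simp [hr])]
    refine Finset.card_le_card fun r hr => ?_
    obtain ⟨hr, hrG⟩ := Finset.mem_filter.1 hr
    rw [newCells, Finset.mem_filter]
    refine ⟨hr, (hG r hrG).1, ?_⟩
    rw [hF _ (div_two_pow_lt htu (Finset.mem_range.1 hr))]
    exact (hG r hrG).2
  · rintro ⟨u, htu, h⟩
    refine ⟨u, (newCells (Halts T c Y P d j n s) s t u).toList, htu, fun r hr => ?_, ?_⟩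
    · rw [Finset.mem_toList] at hr
      have hlt := newCells_lt r hr
      rw [newCells, Finset.mem_filter] at hr
      rw [← hF _ (div_two_pow_lt htu hlt)]
      exact hr.2
    · rwa [length_filter_range _ _ (newCells (Halts T c Y P d j n s) s t u) newCells_lt
        (fun r _ => Finset.mem_toList)]

/-- The halting set relative to `Y`. -/
def haltingSet (Y : Set ℕ) : Set ℕ := {n | (Phi n Y n).Dom}

theorem column_jump_seg_of_isLeast {A : Presentation} {K j k : ℕ} (hj : (A.seg K).IsGreatest j)
    (hk : IsLeast {k | j < k ∧ k ∉ (A.seg K).dom} k) (C : Set ℕ) :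
    column k ((A.seg K).jump C) = haltingSet ((A.seg (j + 1)).jump C) := by
  rw [column_jump_of_isLeast hj hk, seg_below hj.1]
  rfl

namespace Procedure

variable {D : ℕ → ℕ × ℕ × ℕ} (p : Procedure D)

theorem good_iff {Y : Set ℕ} {P d K j n s t : ℕ} {F : List ℕ} :
    Good p.e p.g (haltingSet Y) P d K j n s t F ↔
      (∀ r < 2 * s * 2 ^ t, Halts p.T p.c Y P d j n s t r ↔ r ∈ F) ∧
        ¬ Large (Halts p.T p.c Y P d j n s) s (weight P K n s) t := by
  simp only [Good, haltingSet, mem_ofPred_eq, p.e_spec, p.g_spec, decide_eq_true_eq]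
  refine and_congr_right fun hF => ?_
  rw [exceeds_iff hF]

theorem exists_good {Y : Set ℕ} {P d K j n s t : ℕ}
    (h : ¬ Large (Halts p.T p.c Y P d j n s) s (weight P K n s) t) :
    ∃ F, Good p.e p.g (haltingSet Y) P d K j n s t F := by
  classical
  refine ⟨((Finset.range (2 * s * 2 ^ t)).filter fun r =>
    Halts p.T p.c Y P d j n s t r).toList, p.good_iff.2 ⟨fun r hr => ?_, h⟩⟩
  simp [hr]

theorem bad_iff {Y : Set ℕ} {P d K j n s u r : ℕ} :
    Bad p.e p.g (haltingSet Y) P d K j n s u r ↔ r < 2 * s * 2 ^ u ∧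
      Halts p.T p.c Y P d j n s u r ∧ ∃ t, t ≤ u ∧
        ¬ Large (Halts p.T p.c Y P d j n s) s (weight P K n s) t ∧
        ¬ Halts p.T p.c Y P d j n s t (r / 2 ^ (u - t)) := by
  rw [Bad]
  refine and_congr_right fun hr => and_congr (p.e_spec _ _ _ _ _ _ _ _ _) ?_
  refine exists_congr fun t => ?_
  constructor
  · rintro ⟨F, htu, hF, h⟩
    rw [good_iff] at hF
    refine ⟨htu, hF.2, ?_⟩
    rw [hF.1 _ (div_two_pow_lt htu hr)]
    simpa using h
  · rintro ⟨htu, hl, h⟩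
    obtain ⟨F, hF⟩ := p.exists_good hl
    refine ⟨F, htu, hF, ?_⟩
    rw [(p.good_iff.1 hF).1 _ (div_two_pow_lt htu hr)] at h
    simpa using h

theorem volume_bad_le (Y : Set ℕ) (P d K j n s : ℕ) :
    volume {x : ℝ | -(s : ℝ) ≤ x ∧ x < s ∧
      ∃ u, Bad p.e p.g (haltingSet Y) P d K j n s u (cellIndex s u x)} ≤
        ENNReal.ofReal (1 / 2 ^ weight P K n s) := by
  refine (measure_mono ?_).trans (volume_le_of_not_large
    (E := Halts p.T p.c Y P d j n s) Halts.mono s (weight P K n s))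
  rintro x ⟨h1, h2, u, h⟩
  obtain ⟨-, hu, t, htu, hl, ht⟩ := p.bad_iff.1 h
  rw [cellIndex_div htu] at ht
  exact ⟨h1, h2, t, u, htu, hl, hu, ht⟩

/-- At a point in no bad cell, every good list, of whatever level, gives the true answer; a good
list exists by `exists_not_large`. -/
theorem jumpAns_iff {Y : Set ℕ} {P d K j n s : ℕ} {x : ℝ} (h1 : -(s : ℝ) ≤ x) (h2 : x < s)
    (hb : ∀ u, ¬ Bad p.e p.g (haltingSet Y) P d K j n s u (cellIndex s u x)) (b : Bool) :
    (∃ t, JumpAns p.e p.g (haltingSet Y) P d K j n b s t (cellIndex s t x)) ↔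
      ((∃ t, Halts p.T p.c Y P d j n s t (cellIndex s t x)) ↔ b = true) := by
  have key : ∀ t F, Good p.e p.g (haltingSet Y) P d K j n s t F →
      (cellIndex s t x ∈ F ↔ ∃ t, Halts p.T p.c Y P d j n s t (cellIndex s t x)) := by
    intro t F hF
    rw [good_iff] at hF
    rw [← hF.1 _ (cellIndex_lt h1 h2)]
    refine ⟨fun h => ⟨t, h⟩, fun ⟨u, hu⟩ => ?_⟩
    by_contra hn
    -- Otherwise halting is forced at a later level but not at `t`, which makes the cell of `x` of
    -- level `max t u` bad.
    refine hb (max t u) (p.bad_iff.2 ⟨cellIndex_lt h1 h2, ?_, t, le_max_left _ _, hF.2, ?_⟩)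
    · exact cellIndex_mono Halts.mono (le_max_right _ _) hu
    · rwa [cellIndex_div (le_max_left _ _)]
  constructor
  · rintro ⟨t, F, hF, -, rfl⟩
    rw [decide_eq_true_eq, key t F hF]
  · intro h
    obtain ⟨t, ht⟩ := exists_not_large (E := Halts p.T p.c Y P d j n s) Halts.mono s
      (weight P K n s)
    obtain ⟨F, hF⟩ := p.exists_good ht
    refine ⟨t, F, hF, cellIndex_lt h1 h2, ?_⟩
    rw [Bool.eq_iff_iff, decide_eq_true_eq, key t F hF]
    exact h

/-- The answers given at `x` about `Z` are the right ones. -/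
def Correct (Y : Set ℕ) (P d K s : ℕ) (x : ℝ) (Z : Set ℕ) : Prop :=
  ∀ m b, (∃ t, Ans p.c Y P d K m b s t (cellIndex s t x)) ↔ (m ∈ Z ↔ b = true)

theorem halts_iff {Y Z : Set ℕ} {P d j n s : ℕ} {x : ℝ} (h : p.Correct Y P d (j + 1) s x Z) :
    (∃ t, Halts p.T p.c Y P d j n s t (cellIndex s t x)) ↔ n ∈ haltingSet Z := by
  rw [haltingSet, mem_ofPred_eq, p.T_spec]
  constructor
  · rintro ⟨t, w, σ, hT, hσ⟩
    refine ⟨w, σ, hT, fun f hf => ?_⟩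
    obtain ⟨t', ht', h'⟩ := hσ f hf
    rw [cellIndex_div ht'] at h'
    exact (h f.1 f.2).1 ⟨t', h'⟩
  · rintro ⟨w, σ, hT, hσ⟩
    have := fun f hf => (h f.1 f.2).2 (hσ f hf)
    choose! τ hτ using this
    -- Only finitely many facts are needed, so the finest of their levels serves for all of them.
    refine ⟨σ.toFinset.sup τ, w, σ, hT, fun f hf => ?_⟩
    have hle : τ f ≤ σ.toFinset.sup τ := Finset.le_sup (List.mem_toFinset.2 hf)
    refine ⟨τ f, hle, ?_⟩
    rw [cellIndex_div hle]
    exact hτ f hf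

end Procedure

section Cuts

variable (q : ℕ ≃ ℚ)

theorem two_mul_mem_setJoin {B C : Set ℕ} {n : ℕ} : 2 * n ∈ setJoin B C ↔ n ∈ B := by
  simp only [setJoin, mem_ofPred_eq]
  constructor
  · rintro (⟨m, hm, h⟩ | ⟨m, hm, h⟩)
    · rwa [show n = m by omega]
    · omega
  · exact fun h => .inl ⟨n, h, rfl⟩

theorem two_mul_add_one_mem_setJoin {B C : Set ℕ} {n : ℕ} :
    2 * n + 1 ∈ setJoin B C ↔ n ∈ C := by
  simp only [setJoin, mem_ofPred_eq]
  constructor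
  · rintro (⟨m, hm, h⟩ | ⟨m, hm, h⟩)
    · omega
    · rwa [show n = m by omega]
  · exact fun h => .inr ⟨n, h, rfl⟩

theorem mem_withCuts_left (S : Set ℕ) (x : ℝ) (n : ℕ) : 2 * n ∈ withCuts q S x ↔ n ∈ S :=
  two_mul_mem_setJoin

theorem mem_withCuts_leftCut (S : Set ℕ) (x : ℝ) (a : ℕ) :
    2 * (2 * a) + 1 ∈ withCuts q S x ↔ (q a : ℝ) < x :=
  two_mul_add_one_mem_setJoin.trans two_mul_mem_setJoin

theorem mem_withCuts_rightCut (S : Set ℕ) (x : ℝ) (a : ℕ) :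
    2 * (2 * a + 1) + 1 ∈ withCuts q S x ↔ x < (q a : ℝ) :=
  two_mul_add_one_mem_setJoin.trans two_mul_add_one_mem_setJoin

variable {q} {s : ℕ} {x : ℝ}

theorem exists_width_lt {δ : ℝ} (hδ : 0 < δ) : ∃ t : ℕ, (1 : ℝ) / 2 ^ t < δ := by
  obtain ⟨t, ht⟩ := exists_pow_lt_of_lt_one hδ (by norm_num : (1 / 2 : ℝ) < 1)
  exact ⟨t, by simpa [div_pow] using ht⟩

theorem exists_ltPoint_iff (hx : -(s : ℝ) ≤ x) (a : ℕ) :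
    (∃ t, LtPoint (ratData q) a s t (cellIndex s t x)) ↔ (q a : ℝ) < x := by
  simp only [ltPoint_iff]
  constructor
  · rintro ⟨t, h⟩
    exact h.trans_le (point_cellIndex_le hx)
  · intro h
    obtain ⟨t, ht⟩ := exists_width_lt (sub_pos.2 h)
    have := lt_point_cellIndex_succ (t := t) hx
    rw [point_succ] at this
    exact ⟨t, by linarith⟩

theorem exists_pointLe_iff (hx : -(s : ℝ) ≤ x) (a : ℕ) :
    (∃ t, PointLe (ratData q) a s t (cellIndex s t x + 1)) ↔ x < (q a : ℝ) := by
  simp only [pointLe_iff]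
  constructor
  · rintro ⟨t, h⟩
    exact (lt_point_cellIndex_succ hx).trans_le h
  · intro h
    obtain ⟨t, ht⟩ := exists_width_lt (sub_pos.2 h)
    have := point_cellIndex_le (t := t) hx
    refine ⟨t, ?_⟩
    rw [point_succ]
    linarith

/-- Both truth values have to be established by an open condition. As `x` is not rational, `x` fails
to be in one cut only by being strictly on the other side. -/
theorem exists_baseAns_iff (hx : -(s : ℝ) ≤ x) (hq : ∀ a, x ≠ q a) (S : Set ℕ) (m : ℕ) (b : Bool) :
    (∃ t, BaseAns (ratData q) S m b s t (cellIndex s t x)) ↔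
      (m ∈ withCuts q S x ↔ b = true) := by
  have hnot : ∀ a, ¬ (q a : ℝ) < x ↔ x < q a := fun a =>
    ⟨fun h => lt_of_le_of_ne (not_lt.1 h) (hq a), fun h => not_lt.2 h.le⟩
  have hnot' : ∀ a, ¬ x < q a ↔ (q a : ℝ) < x := fun a => by rw [← hnot, not_not]
  rcases Nat.even_or_odd' m with ⟨n, rfl | rfl⟩
  · rw [mem_withCuts_left]
    constructor
    · rintro ⟨t, ⟨n', h, h'⟩ | ⟨a, h, -⟩ | ⟨a, h, -⟩⟩
      · rwa [show n = n' by omega]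
      · omega
      · omega
    · exact fun h => ⟨0, .inl ⟨n, rfl, h⟩⟩
  · rcases Nat.even_or_odd' n with ⟨a, rfl | rfl⟩
    · rw [mem_withCuts_leftCut]
      trans ∃ t, (b = true ∧ LtPoint (ratData q) a s t (cellIndex s t x) ∨
        b = false ∧ PointLe (ratData q) a s t (cellIndex s t x + 1))
      · refine exists_congr fun t => ⟨?_, fun h => .inr (.inl ⟨a, rfl, h⟩)⟩
        rintro (⟨n', h, h'⟩ | ⟨a', h, h'⟩ | ⟨a', h, -⟩)
        · omega
        · rwa [show a = a' by omega]
        · omega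
      · cases b
        · simp [exists_pointLe_iff hx, ← hnot]
        · simp [exists_ltPoint_iff hx a]
    · rw [mem_withCuts_rightCut]
      trans ∃ t, (b = true ∧ PointLe (ratData q) a s t (cellIndex s t x + 1) ∨
        b = false ∧ LtPoint (ratData q) a s t (cellIndex s t x))
      · refine exists_congr fun t => ⟨?_, fun h => .inr (.inr ⟨a, rfl, h⟩)⟩
        rintro (⟨n', h, h'⟩ | ⟨a', h, -⟩ | ⟨a', h, h'⟩)
        · omega
        · omega
        · rwa [show a = a' by omega]
      · cases b
        · simp [exists_ltPoint_iff hx a, ← hnot']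
        · simp [exists_pointLe_iff hx]

end Cuts

namespace Procedure

variable {q : ℕ ≃ ℚ} (p : Procedure (ratData q))

theorem correct_base {s : ℕ} {x : ℝ} (hx : -(s : ℝ) ≤ x) (hq : ∀ a, x ≠ q a) (S : Set ℕ)
    (P d : ℕ) : p.Correct S P d 1 s x (withCuts q S x) := by
  intro m b
  refine (exists_congr fun t => p.ans_iff ..).trans ?_
  simpa [Step] using exists_baseAns_iff hx hq S m b

/-- Induction on the order type of the segment. A column in the domain is correct by the induction
hypothesis; a jump column is correct since correct answers about the segment below `j` make `Halts`
describe true halting, and `x` avoids the bad cells; the remaining columns are empty. -/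
theorem correct_seg {A : Presentation} (hA : A.dom.Nonempty) {S : Set ℕ} {d : ℕ}
    (hd : Decides d S A.completeDiagram) {P s : ℕ} {x : ℝ} (h1 : -(s : ℝ) ≤ x) (h2 : x < s)
    (hq : ∀ a, x ≠ q a)
    (hb : ∀ K j k n u, A.ValidSeg K → (A.seg K).IsGreatest j →
      IsLeast {k | j < k ∧ k ∉ (A.seg K).dom} k →
      ¬ Bad p.e p.g (column k ((A.seg K).jump S)) P d K j n s u (cellIndex s u x)) :
    ∀ o, ∀ K, (A.seg K).ordinal = o → A.ValidSeg K →
      p.Correct ((A.seg K).jump S) P d K s x ((A.seg K).jump (withCuts q S x)) := by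
  intro o
  induction o using WellFoundedLT.induction with
  | ind o ih =>
  rintro K rfl hK
  by_cases hK1 : K = 1
  · subst hK1
    rw [jump_of_dom_eq_empty A.seg_one_dom, jump_of_dom_eq_empty A.seg_one_dom]
    exact p.correct_base h1 hq S P d
  have ih' : ∀ k ∈ (A.seg K).dom, p.Correct ((A.seg (k + 1)).jump S) P d (k + 1) s x
      ((A.seg (k + 1)).jump (withCuts q S x)) := by
    intro k hk
    refine ih _ ?_ (k + 1) rfl (validSeg_succ (mem_dom_of_mem_seg hk))
    rw [← seg_below hk]
    exact (A.seg K).ordinal_below_lt hk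
  have hne : (A.seg K).dom.Nonempty := ⟨0, zero_mem_seg hA hK hK1⟩
  intro m b
  refine (exists_congr fun t => p.ans_iff ..).trans ?_
  simp only [Step, hK1, false_and, false_or, ne_eq, not_false_eq_true, true_and,
    column_zero_jump_seg hA hK hK1, inSeg_iff hd hK, emptyColumn_iff hd hK, maxSeg_iff hd hK,
    jumpColumn_iff hd hK]
  have hm : ∀ C : Set ℕ, m ∈ (A.seg K).jump C ↔
      m.unpair.2 ∈ column m.unpair.1 ((A.seg K).jump C) := fun C => by
    simp [column]
  rw [hm]
  generalize m.unpair.1 = k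
  generalize m.unpair.2 = n
  by_cases hk : k ∈ (A.seg K).dom
  · rw [column_jump_of_mem hk, column_jump_of_mem hk, seg_below hk, ← ih' k hk n b]
    refine exists_congr fun t => ⟨?_, fun h => .inl ⟨hk, h⟩⟩
    rintro (⟨-, h⟩ | ⟨-, h, -⟩ | ⟨j, -, h, -⟩)
    · exact h
    · exact absurd hk h
    · exact absurd hk h.1.2
  · by_cases hj : ∃ j, (A.seg K).IsGreatest j ∧ IsLeast {k | j < k ∧ k ∉ (A.seg K).dom} k
    · obtain ⟨j, hj, hkj⟩ := hj
      have hbad := fun u => hb K j k n u hK hj hkj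
      have hJ := column_jump_seg_of_isLeast hj hkj
      -- The column of the jump along `S` is the halting set that the procedure interrogates; the
      -- one along the cuts, rewritten next, is what it has to predict.
      rw [hJ] at hbad ⊢
      rw [hJ, ← p.halts_iff (ih' j hj.1), ← p.jumpAns_iff h1 h2 hbad b]
      refine exists_congr fun t => ⟨?_, fun h => .inr (.inr ⟨j, hj, hkj, h⟩)⟩
      rintro (⟨h, -⟩ | ⟨-, -, h⟩ | ⟨j', hj', -, h⟩)
      · exact absurd h hk
      · exact absurd ⟨j, hj, hkj⟩ h
      · rwa [hj'.unique hj] at h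
    · have hn : n ∉ column k ((A.seg K).jump (withCuts q S x)) := notMem_jump hk hj hne _ n
      simp only [hn, false_iff, Bool.not_eq_true]
      constructor
      · rintro ⟨t, ⟨h, -⟩ | ⟨h, -⟩ | ⟨j, hj', hkj, -⟩⟩
        · exact absurd h hk
        · exact h
        · exact absurd ⟨j, hj', hkj⟩ hj
      · exact fun h => ⟨0, .inr (.inl ⟨h, hk, hj⟩)⟩

end Procedure

end

/-! ### Unsafe intervals and answers as `Σ₁` predicates. -/

section

open Encodable MeasureTheory Set Presentation
open scoped ENNReal

/-- `K` is the number of an initial segment, and the cell `(s, u, r)` is part of the error made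
for its greatest element, when `Y` is the iterated jump. -/
def SegBad {D : ℕ → ℕ × ℕ × ℕ} (p : Procedure D) (Y : Set ℕ) (P d K n s u r : ℕ) : Prop :=
  ∃ j k, MaxSeg (column 0 Y) d K j ∧ JumpColumn (column 0 Y) d K j k ∧
    ((K = 0 ∧ Bad p.e p.g (column k Y) P d K j n s u r) ∨
      ∃ l, K = l + 1 ∧ InSeg (column 0 Y) d 0 l ∧
        Bad p.e p.g (column k (column l Y)) P d K j n s u r)

/-- The interval between the points `lo` and `hi` of level `t` belongs to the error set: it is a
small neighbourhood of a rational number, or a cell in which the procedure errs. -/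
def ErrorCells {D : ℕ → ℕ × ℕ × ℕ} (p : Procedure D) (Y : Set ℕ) (P i s t lo hi : ℕ) : Prop :=
  (∃ a, t = P + a + 5 ∧ hi = lo + 2 ∧ PointLe D a s t (lo + 1) ∧ LtPoint D a s t (lo + 2)) ∨
  (i ≠ 0 ∧ hi = lo + 1 ∧ ∃ K n, SegBad p Y P (i - 1) K n s t lo)

/-- The interval between the rational numbers `a` and `b` belongs to the error set. -/
def ErrorInterval {D : ℕ → ℕ × ℕ × ℕ} (p : Procedure D) (Y : Set ℕ) (e i a b : ℕ) : Prop :=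
  ∃ s t lo hi, ErrorCells p Y (D e).2.2 i s t lo hi ∧ PointEq D a s t lo ∧ PointEq D b s t hi

/-- The real number whose cuts are coded in `Z` belongs to the error set. -/
def ErrorPoint {D : ℕ → ℕ × ℕ × ℕ} (p : Procedure D) (Z : Set ℕ) (e i : ℕ) : Prop :=
  ∃ a b, ErrorInterval p {n | 2 * n ∈ Z} e i a b ∧ 2 * (2 * a) + 1 ∈ Z ∧ 2 * (2 * b + 1) + 1 ∈ Z

/-- The procedure gives the answer `v` about `n`, for the real number whose cuts are coded
in `Z`. -/
def Answer {D : ℕ → ℕ × ℕ × ℕ} (p : Procedure D) (Z : Set ℕ) (e i n v : ℕ) : Prop :=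
  ∃ s t r lo hi, ∃ b : Bool, PointEq D lo s t r ∧ PointEq D hi s t (r + 1) ∧
    2 * (2 * lo + 1) + 1 ∉ Z ∧ 2 * (2 * hi + 1) + 1 ∈ Z ∧ r < 2 * s * 2 ^ t ∧ v = encode b ∧
    Ans p.c {n | 2 * n ∈ Z} (D e).2.2 (i - 1) (1 - i) n b s t r

section Sigma1

variable {α : Type*} [Primcodable α] {D : ℕ → ℕ × ℕ × ℕ}
  {P d i K n s t r u a b e lo hi v : α → ℕ}

namespace Sigma1

theorem evens {P : Set ℕ → α → Prop} (hP : Sigma1 P) :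
    Sigma1 fun Y a => P {n | 2 * n ∈ Y} a :=
  preimage (f := fun _ n => 2 * n) hP (Primrec.nat_mul.comp (.const 2) .snd)

theorem segBad (p : Procedure D) (hP : Computable P) (hd : Computable d) (hK : Computable K)
    (hn : Computable n) (hs : Computable s) (hu : Computable u) (hr : Computable r) :
    Sigma1 fun Y a => SegBad p Y (P a) (d a) (K a) (n a) (s a) (u a) (r a) := by
  have he := p.computable_e
  have hg := p.computable_g
  have h0 : Computable fun _ : (α × ℕ) × ℕ => 0 := .const 0
  have h0' : Computable fun _ : ((α × ℕ) × ℕ) × ℕ => 0 := .const 0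
  have hk : Computable fun q : (α × ℕ) × ℕ => q.2 := by fun_prop
  have hk' : Computable fun q : ((α × ℕ) × ℕ) × ℕ => q.1.2 := by fun_prop
  have hl' : Computable fun q : ((α × ℕ) × ℕ) × ℕ => q.2 := by fun_prop
  refine ex (ex (and (column (maxSeg (d := fun q : (α × ℕ) × ℕ => d q.1.1)
    (K := fun q : (α × ℕ) × ℕ => K q.1.1) (j := fun q : (α × ℕ) × ℕ => q.1.2) ?_ ?_ ?_) h0)
    (and (column (jumpColumn (d := fun q : (α × ℕ) × ℕ => d q.1.1)
    (K := fun q : (α × ℕ) × ℕ => K q.1.1) (j := fun q : (α × ℕ) × ℕ => q.1.2)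
    (k := fun q : (α × ℕ) × ℕ => q.2) ?_ ?_ ?_ ?_) h0)
    (or (and (eq ?_ ?_) (column (bad (E := fun q : ((α × ℕ) × ℕ) × _ => p.e q.2)
      (G := fun q : ((α × ℕ) × ℕ) × _ => p.g q.2)
      (P := fun q : (α × ℕ) × ℕ => P q.1.1) (d := fun q : (α × ℕ) × ℕ => d q.1.1)
      (K := fun q : (α × ℕ) × ℕ => K q.1.1) (j := fun q : (α × ℕ) × ℕ => q.1.2)
      (n := fun q : (α × ℕ) × ℕ => n q.1.1) (s := fun q : (α × ℕ) × ℕ => s q.1.1)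
      (u := fun q : (α × ℕ) × ℕ => u q.1.1) (r := fun q : (α × ℕ) × ℕ => r q.1.1)
      ?_ ?_ ?_ ?_ ?_ ?_ ?_ ?_ ?_ ?_) hk))
      (ex (and (eq ?_ ?_) (and
        (column (inSeg (d := fun q : ((α × ℕ) × ℕ) × ℕ => d q.1.1.1)
          (K := fun _ : ((α × ℕ) × ℕ) × ℕ => 0) (k := fun q : ((α × ℕ) × ℕ) × ℕ => q.2)
          ?_ ?_ ?_) h0')
        (column (column (bad (E := fun q : (((α × ℕ) × ℕ) × ℕ) × _ => p.e q.2)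
          (G := fun q : (((α × ℕ) × ℕ) × ℕ) × _ => p.g q.2)
          (P := fun q : ((α × ℕ) × ℕ) × ℕ => P q.1.1.1)
          (d := fun q : ((α × ℕ) × ℕ) × ℕ => d q.1.1.1)
          (K := fun q : ((α × ℕ) × ℕ) × ℕ => K q.1.1.1)
          (j := fun q : ((α × ℕ) × ℕ) × ℕ => q.1.1.2)
          (n := fun q : ((α × ℕ) × ℕ) × ℕ => n q.1.1.1)
          (s := fun q : ((α × ℕ) × ℕ) × ℕ => s q.1.1.1)
          (u := fun q : ((α × ℕ) × ℕ) × ℕ => u q.1.1.1)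
          (r := fun q : ((α × ℕ) × ℕ) × ℕ => r q.1.1.1)
          ?_ ?_ ?_ ?_ ?_ ?_ ?_ ?_ ?_ ?_) hk') hl')))))))) <;> fun_prop

theorem errorCells (hD : Computable D) (p : Procedure D) (hP : Computable P) (hi' : Computable i)
    (hs : Computable s) (ht : Computable t) (hlo : Computable lo) (hhi : Computable hi) :
    Sigma1 fun Y a => ErrorCells p Y (P a) (i a) (s a) (t a) (lo a) (hi a) := by
  refine or (ex (and (eq ?_ ?_) (and (eq ?_ ?_) (and (pointLe hD ?_ ?_ ?_ ?_)
    (ltPoint hD ?_ ?_ ?_ ?_))))) (and (ne ?_ ?_) (and (eq ?_ ?_)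
    (ex (ex (segBad p ?_ ?_ ?_ ?_ ?_ ?_ ?_))))) <;> fun_prop

theorem errorInterval (hD : Computable D) (p : Procedure D) (he : Computable e)
    (hi' : Computable i) (ha : Computable a) (hb : Computable b) :
    Sigma1 fun Y z => ErrorInterval p Y (e z) (i z) (a z) (b z) := by
  refine ex (ex (ex (ex (and (errorCells hD p ?_ ?_ ?_ ?_ ?_ ?_)
    (and (pointEq hD ?_ ?_ ?_ ?_) (pointEq hD ?_ ?_ ?_ ?_)))))) <;> fun_prop

theorem errorPoint (hD : Computable D) (p : Procedure D) (he : Computable e)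
    (hi' : Computable i) : Sigma1 fun Z z => ErrorPoint p Z (e z) (i z) := by
  refine ex (ex (and (evens (errorInterval hD p (e := fun q : (α × ℕ) × ℕ => e q.1.1)
    (i := fun q : (α × ℕ) × ℕ => i q.1.1) (a := fun q : (α × ℕ) × ℕ => q.1.2)
    (b := fun q : (α × ℕ) × ℕ => q.2) ?_ ?_ ?_ ?_))
    (and (mem ?_) (mem ?_)))) <;> fun_prop

theorem answer (hD : Computable D) (p : Procedure D) (he : Computable e)
    (hi' : Computable i) (hn : Computable n) (hv : Computable v) :
    Sigma1 fun Z z => Answer p Z (e z) (i z) (n z) (v z) := by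
  have hc : Computable fun q : (((((α × ℕ) × ℕ) × ℕ) × ℕ) × ℕ) × Bool => encode q.2 :=
    Computable.encode.comp .snd
  refine ex (ex (ex (ex (ex (ex (and (pointEq hD ?_ ?_ ?_ ?_) (and (pointEq hD ?_ ?_ ?_ ?_)
    (and (notMem ?_) (and (mem ?_) (and (lt ?_ ?_) (and (eq ?_ hc)
    (evens (ans (c := fun _ => p.c)
      (P := fun q : (((((α × ℕ) × ℕ) × ℕ) × ℕ) × ℕ) × Bool => (D (e q.1.1.1.1.1.1)).2.2)
      (d := fun q => i q.1.1.1.1.1.1 - 1) (K := fun q => 1 - i q.1.1.1.1.1.1)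
      (m := fun q => n q.1.1.1.1.1.1) (b := fun q => q.2) (s := fun q => q.1.1.1.1.1.2)
      (t := fun q => q.1.1.1.1.2) (r := fun q => q.1.1.1.2)
      ?_ ?_ ?_ ?_ ?_ ?_ ?_ ?_ ?_))))))))))))) <;> fun_prop

end Sigma1

end Sigma1

end

/-! ### The measure of the unsafe set and correctness outside it. -/

section

open Encodable MeasureTheory Set Presentation
open scoped ENNReal

theorem tsum_ofReal_one_div_two_pow (w : ℕ) :
    ∑' a : ℕ, ENNReal.ofReal (1 / 2 ^ (w + 1 + a)) = ENNReal.ofReal (1 / 2 ^ w) := by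
  have h : ∀ a : ℕ, (1 : ℝ) / 2 ^ (w + 1 + a) = 1 / 2 ^ w / 2 / 2 ^ a := fun a => by
    rw [pow_add, pow_succ, div_div, div_div, mul_assoc]
  simp only [h]
  rw [← ENNReal.ofReal_tsum_of_nonneg (fun _ => by positivity) (summable_geometric_two' _),
    tsum_geometric_two']

section

variable {q : ℕ ≃ ℚ} (p : Procedure (ratData q)) {A : Presentation} {S : Set ℕ}

/-- The jump along a proper segment is a column of `A.jump S`, so all bad cells, for all segments,
are enumerated from the single oracle `A.jump S`. -/
theorem segBad_iff (hA : A.dom.Nonempty) {d : ℕ} (hd : Decides d S A.completeDiagram)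
    {P K n s u r : ℕ} : SegBad p (A.jump S) P d K n s u r ↔ A.ValidSeg K ∧
      ∃ j k, (A.seg K).IsGreatest j ∧ IsLeast {k | j < k ∧ k ∉ (A.seg K).dom} k ∧
        Bad p.e p.g (column k ((A.seg K).jump S)) P d K j n s u r := by
  have h0 : A.ValidSeg 0 := .inl rfl
  have hS : column 0 (A.jump S) = S := column_zero_jump_seg hA h0 (by simp) S
  rw [SegBad, hS]
  constructor
  · rintro ⟨j, k, hj, hk, ⟨rfl, h⟩ | ⟨l, rfl, hl, h⟩⟩
    · exact ⟨h0, j, k, (maxSeg_iff hd h0).1 hj, (jumpColumn_iff hd h0).1 hk, h⟩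
    · have hl' : l ∈ A.dom := (inSeg_iff hd h0).1 hl
      have hv := validSeg_succ hl'
      rw [column_jump_of_mem hl'] at h
      exact ⟨hv, j, k, (maxSeg_iff hd hv).1 hj, (jumpColumn_iff hd hv).1 hk, h⟩
  · rintro ⟨hv, j, k, hj, hk, h⟩
    refine ⟨j, k, (maxSeg_iff hd hv).2 hj, (jumpColumn_iff hd hv).2 hk, ?_⟩
    rcases hv with rfl | ⟨l, hl, rfl⟩
    · exact .inl ⟨rfl, h⟩
    · refine .inr ⟨l, rfl, (inSeg_iff hd h0).2 hl, ?_⟩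
      rwa [column_jump_of_mem hl]

/-- The union of the intervals in which the procedure may err. -/
def unsafeSet (Y : Set ℕ) (e i : ℕ) : Set ℝ :=
  {x | ∃ a b, ErrorInterval p Y e i a b ∧ (q a : ℝ) < x ∧ x < q b}

theorem errorPoint_iff {Y : Set ℕ} {e i : ℕ} {x : ℝ} :
    ErrorPoint p (withCuts q Y x) e i ↔ x ∈ unsafeSet p Y e i := by
  simp only [ErrorPoint, mem_withCuts_left, mem_withCuts_leftCut, mem_withCuts_rightCut,
    unsafeSet, mem_ofPred_eq]
  rfl

theorem mem_unsafeSet_iff {Y : Set ℕ} {e i : ℕ} {x : ℝ} : x ∈ unsafeSet p Y e i ↔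
    ∃ s t lo hi, ErrorCells p Y (ratData q e).2.2 i s t lo hi ∧ point s t lo < x ∧
      x < point s t hi := by
  constructor
  · rintro ⟨a, b, ⟨s, t, lo, hi, h, ha, hb⟩, hax, hbx⟩
    rw [pointEq_iff] at ha hb
    exact ⟨s, t, lo, hi, h, by rwa [ha], by rwa [hb]⟩
  · rintro ⟨s, t, lo, hi, h, hlo, hhi⟩
    obtain ⟨a, ha⟩ := exists_rat_eq_point s t lo
    obtain ⟨b, hb⟩ := exists_rat_eq_point s t hi
    refine ⟨q.symm a, q.symm b, ⟨s, t, lo, hi, h, ?_, ?_⟩, ?_, ?_⟩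
    · rw [pointEq_iff, q.apply_symm_apply, ha]
    · rw [pointEq_iff, q.apply_symm_apply, hb]
    · rwa [q.apply_symm_apply, ha]
    · rwa [q.apply_symm_apply, hb]

/-- The interval consists of the cell of `q c` and its left neighbour, so `q c` is an interior point
even if it is an end point of a cell. -/
theorem rat_mem_unsafeSet (Y : Set ℕ) (e i c : ℕ) : (q c : ℝ) ∈ unsafeSet p Y e i := by
  rw [mem_unsafeSet_iff]
  -- The window has to extend at least `1` to the left of `q c`, so that there is a left neighbour.
  obtain ⟨s, hs⟩ := exists_nat_ge (1 - (q c : ℝ))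
  have hx : -(s : ℝ) ≤ q c := by linarith
  generalize ht : (ratData q e).2.2 + c + 5 = t
  have h1 : 1 ≤ cellIndex s t (q c) := by
    refine Nat.le_floor ?_
    have h2 : (1 : ℝ) ≤ 2 ^ t := one_le_pow₀ (by norm_num)
    push_cast
    nlinarith
  obtain ⟨lo, hlo⟩ := Nat.exists_eq_add_of_le' h1
  have h2 := (cellIndex_eq_iff hx).1 hlo
  refine ⟨s, t, lo, lo + 2, .inl ⟨c, ht.symm, rfl, ?_, ?_⟩, ?_, h2.2⟩
  · exact (pointLe_iff _ _ _ _ _).2 h2.1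
  · exact (ltPoint_iff _ _ _ _ _).2 h2.2
  · refine lt_of_lt_of_le ?_ h2.1
    rw [point_succ]
    have : (0 : ℝ) < 1 / 2 ^ t := by positivity
    linarith

/-- The segment `K` determines its greatest element `j` and the jump column `k`, so these contribute
no further summation. -/
theorem volume_segBad_le (hA : A.dom.Nonempty) {d : ℕ} (hd : Decides d S A.completeDiagram)
    (P K n s : ℕ) :
    volume {x : ℝ | ∃ t r, SegBad p (A.jump S) P d K n s t r ∧ point s t r < x ∧
      x < point s t (r + 1)} ≤ ENNReal.ofReal (1 / 2 ^ weight P K n s) := by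
  simp only [segBad_iff p hA hd]
  by_cases h : ∃ j k, (A.seg K).IsGreatest j ∧ IsLeast {k | j < k ∧ k ∉ (A.seg K).dom} k
  · obtain ⟨j, k, hj, hk⟩ := h
    refine (measure_mono ?_).trans
      (p.volume_bad_le ((A.seg (j + 1)).jump S) P d K j n s)
    rintro x ⟨t, r, ⟨-, j', k', hj', hk', h⟩, h1, h2⟩
    obtain rfl := hj.unique hj'
    obtain rfl := hk.unique hk'
    have hx : -(s : ℝ) ≤ x := neg_le_point.trans h1.le
    have hr : cellIndex s t x = r := (cellIndex_eq_iff hx).2 ⟨h1.le, h2⟩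
    refine ⟨hx, h2.trans_le (point_le_of_le h.1), t, ?_⟩
    rwa [hr, ← column_jump_seg_of_isLeast hj hk]
  · refine (measure_mono_null ?_ measure_empty).trans_le zero_le
    rintro x ⟨t, r, ⟨-, j, k, hj, hk, -⟩, -⟩
    exact h ⟨j, k, hj, hk⟩

/-- The first term bounds the neighbourhoods of the rationals. The second bounds the bad cells: the
pairing in `weight` makes their bounds a geometric series indexed by the codes of `(K, n, s)`. -/
theorem volume_unsafeSet_le {i : ℕ} (hi : A.IsIndex S i) (e : ℕ) :
    volume (unsafeSet p (A.jump S) e i) ≤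
      ENNReal.ofReal (1 / 2 ^ ((q e).den + 2)) + ENNReal.ofReal (1 / 2 ^ ((q e).den + 1)) := by
  set P := (q e).den
  let U : Set ℝ := ⋃ a : ℕ, Ioo (q a - 2 / 2 ^ (P + a + 5) : ℝ) (q a + 2 / 2 ^ (P + a + 5))
  let V : Set ℝ := ⋃ N : ℕ, {x : ℝ | i ≠ 0 ∧ ∃ t r, SegBad p (A.jump S) P (i - 1) N.unpair.1
    N.unpair.2.unpair.1 N.unpair.2.unpair.2 t r ∧ point N.unpair.2.unpair.2 t r < x ∧
      x < point N.unpair.2.unpair.2 t (r + 1)}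
  have hsub : unsafeSet p (A.jump S) e i ⊆ U ∪ V := by
    intro x hx
    obtain ⟨s, t, lo, hi, ⟨a, ht, rfl, ha, ha'⟩ | ⟨h0, rfl, K, n, h⟩, h1, h2⟩ :=
      (mem_unsafeSet_iff p).1 hx
    · refine .inl (mem_iUnion.2 ⟨a, ?_⟩)
      rw [pointLe_iff, point_succ] at ha
      rw [ltPoint_iff] at ha'
      have ht' : P + a + 5 = t := ht.symm
      have h3 : point s t (lo + 2) = point s t lo + 2 / 2 ^ t := by
        rw [point_succ, point_succ]
        ring
      have : (0 : ℝ) < 1 / 2 ^ t := by positivity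
      rw [ht', mem_Ioo]
      constructor <;> linarith
    · refine .inr (mem_iUnion.2 ⟨Nat.pair K (Nat.pair n s), h0, t, lo, ?_⟩)
      simp only [Nat.unpair_pair]
      exact ⟨h, h1, h2⟩
  refine (measure_mono hsub).trans ((measure_union_le _ _).trans (add_le_add ?_ ?_))
  · refine (measure_iUnion_le _).trans ?_
    rw [← tsum_ofReal_one_div_two_pow]
    refine ENNReal.tsum_le_tsum fun a => ?_
    rw [Real.volume_Ioo]
    refine ENNReal.ofReal_le_ofReal (le_of_eq ?_)
    -- The length is `4 / 2 ^ (P + a + 5)`, the term number `a` of the series with sum `2 ^ (-(P +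
    -- 2))`.
    rw [show P + a + 5 = P + 2 + 1 + a + 2 by omega, pow_add _ _ 2]
    field_simp
    norm_num
  · refine (measure_iUnion_le _).trans ?_
    rw [← tsum_ofReal_one_div_two_pow]
    refine ENNReal.tsum_le_tsum fun N => ?_
    rcases hi with ⟨-, rfl⟩ | ⟨hA, d, rfl, hd⟩
    · simp
    · simp only [ne_eq, Nat.add_eq_zero_iff, one_ne_zero, and_false, not_false_eq_true, true_and,
        Nat.add_sub_cancel]
      refine (volume_segBad_le p hA hd _ _ _ _).trans (le_of_eq ?_)
      rw [weight, Nat.pair_unpair, Nat.pair_unpair]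

theorem correct_of_notMem_unsafeSet {i : ℕ} (hi : A.IsIndex S i) {e s : ℕ} {x : ℝ}
    (hx : x ∉ unsafeSet p (A.jump S) e i) (h1 : -(s : ℝ) ≤ x) (h2 : x < s) :
    p.Correct (A.jump S) (ratData q e).2.2 (i - 1) (1 - i) s x (A.jump (withCuts q S x)) := by
  have hq : ∀ a, x ≠ q a := fun a h => hx (h ▸ rat_mem_unsafeSet p _ e i a)
  -- Truncated subtraction selects the starting segment: `1 - i` is `1`, the empty segment, for the
  -- index `0`, and `0`, the whole presentation, otherwise.
  rcases hi with ⟨hA, rfl⟩ | ⟨hA, d, rfl, hd⟩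
  · rw [jump_of_dom_eq_empty hA, jump_of_dom_eq_empty hA]
    exact p.correct_base h1 hq S _ _
  · rw [Nat.add_sub_cancel, show 1 - (d + 1) = 0 by omega]
    refine p.correct_seg hA hd h1 h2 hq ?_ _ 0 rfl (.inl rfl)
    intro K j k n u hK hj hk hb
    refine hx ((mem_unsafeSet_iff p).2 ⟨s, u, cellIndex s u x, cellIndex s u x + 1,
      .inr ⟨by simp, rfl, K, n, (segBad_iff p hA hd).2 ⟨hK, j, k, hj, hk, hb⟩⟩, ?_,
      lt_point_cellIndex_succ h1⟩)
    -- Cells are half-open and the intervals open; the difference is a rational end point, which is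
    -- unsafe anyway.
    refine lt_of_le_of_ne (point_cellIndex_le h1) fun h => ?_
    obtain ⟨z, hz⟩ := exists_rat_eq_point s u (cellIndex s u x)
    refine hq (q.symm z) ?_
    rw [q.apply_symm_apply, hz, h]

/-- An accepted answer must come from the cell that contains `x`, which the right cut alone
identifies: `x` is not below its left end point and is below its right one. -/
theorem answer_iff {i : ℕ} (hi : A.IsIndex S i) {e : ℕ} {x : ℝ}
    (hx : x ∉ unsafeSet p (A.jump S) e i) (n v : ℕ) :
    Answer p (withCuts q (A.jump S) x) e i n v ↔
      v = _root_.charFun (A.jump (withCuts q S x)) n := by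
  have hY : {n | 2 * n ∈ withCuts q (A.jump S) x} = A.jump S :=
    Set.ext fun n => mem_withCuts_left q (A.jump S) x n
  simp only [Answer, hY, mem_withCuts_rightCut, pointEq_iff, not_lt]
  constructor
  · rintro ⟨s, t, r, lo, hi', b, hlo, hhi, h1, h2, hr, rfl, h⟩
    rw [← hlo] at h1
    rw [← hhi] at h2
    have hs : -(s : ℝ) ≤ x := neg_le_point.trans h1
    obtain rfl := (cellIndex_eq_iff hs).2 ⟨h1, h2⟩
    have := (correct_of_notMem_unsafeSet p hi hx hs (h2.trans_le (point_le_of_le hr)) n b).1 ⟨t, h⟩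
    rw [_root_.charFun]
    cases b <;> simp_all
  · rintro rfl
    classical
    obtain ⟨s, hs⟩ := exists_nat_gt |x|
    rw [abs_lt] at hs
    obtain ⟨t, ht⟩ := (correct_of_notMem_unsafeSet p hi hx hs.1.le hs.2 n
      (decide (n ∈ A.jump (withCuts q S x)))).2 (by simp)
    obtain ⟨a, ha⟩ := exists_rat_eq_point s t (cellIndex s t x)
    obtain ⟨b, hb⟩ := exists_rat_eq_point s t (cellIndex s t x + 1)
    refine ⟨s, t, cellIndex s t x, q.symm a, q.symm b, _, ?_, ?_, ?_, ?_,
      cellIndex_lt hs.1.le hs.2, ?_, ht⟩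
    · rw [q.apply_symm_apply, ha]
    · rw [q.apply_symm_apply, hb]
    · rw [q.apply_symm_apply, ha]
      exact point_cellIndex_le hs.1.le
    · rw [q.apply_symm_apply, hb]
      exact lt_point_cellIndex_succ hs.1.le
    · rw [_root_.charFun]
      split_ifs with h <;> simp [h]

end

theorem one_div_two_pow_add_lt {ε : ℚ} (hε : 0 < ε) :
    ENNReal.ofReal (1 / 2 ^ (ε.den + 2)) + ENNReal.ofReal (1 / 2 ^ (ε.den + 1)) <
      ENNReal.ofReal (ε : ℝ) := by
  rw [← ENNReal.ofReal_add (by positivity) (by positivity)]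
  refine (ENNReal.ofReal_lt_ofReal_iff (by exact_mod_cast hε)).2 ?_
  have hd : (0 : ℝ) < ε.den := by exact_mod_cast ε.den_pos
  have h1 : (ε.den : ℝ) < 2 ^ ε.den := by exact_mod_cast Nat.lt_two_pow_self
  have h2 : (1 : ℝ) / ε.den ≤ ε := by
    rw [Rat.cast_def]
    gcongr
    exact_mod_cast Rat.num_pos.2 hε
  have h3 : (1 : ℝ) / 2 ^ ε.den < 1 / ε.den := one_div_lt_one_div_of_lt hd h1
  -- The two bounds add up to three quarters of `2 ^ (-den)`, while `2 ^ (-den) < 1 / den ≤ ε`.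
  have h4 : (1 : ℝ) / 2 ^ (ε.den + 2) + 1 / 2 ^ (ε.den + 1) = 3 / 4 * (1 / 2 ^ ε.den) := by
    rw [pow_add, pow_add]
    field_simp
    norm_num
  have h5 : (0 : ℝ) < 1 / 2 ^ ε.den := by positivity
  linarith

end

/-! ### The two functionals. -/

theorem corollary3p5 (q : ℕ ≃ ℚ) (hq : Computable fun n => ((q n).num, (q n).den)) :
    ∃ ψ θ : ℕ, ∀ ε : ℚ, 0 < ε → ∀ (S : Set ℕ) (A : Presentation) (i : ℕ), A.IsIndex S i →
      MeasureTheory.volume (errorSet q ψ ε i S A) < ENNReal.ofReal (ε : ℝ) ∧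
      errorSet q ψ ε i S A =
        ⋃ (a : ℕ) (b : ℕ) (_ : (functionalAt q θ ε i (A.jump S) (Nat.pair a b)).Dom),
          Set.Ioo (q a : ℝ) (q b : ℝ) ∧
      ∀ (x : ℝ) (n : ℕ), (functionalAt q ψ ε i (withCuts q (A.jump S) x) n).Dom := by
  have hD := Computable.ratData hq
  obtain ⟨p⟩ := exists_procedure hD
  obtain ⟨ψ, hψ⟩ := Sigma1.exists_select
    (Sigma1.errorPoint hD p (e := fun z : ℕ × ℕ => z.1) (i := fun z => z.2)
      (by fun_prop) (by fun_prop))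
    (Sigma1.answer hD p (e := fun z : (ℕ × ℕ) × ℕ × ℕ => z.1.1) (i := fun z => z.1.2)
      (n := fun z => z.2.1) (v := fun z => z.2.2) (by fun_prop) (by fun_prop) (by fun_prop)
      (by fun_prop))
  obtain ⟨θ, hθ⟩ := (Sigma1.errorInterval hD p (e := fun z : (ℕ × ℕ) × ℕ × ℕ => z.1.1)
    (i := fun z => z.1.2) (a := fun z => z.2.1) (b := fun z => z.2.2) (by fun_prop) (by fun_prop)
    (by fun_prop) (by fun_prop)).exists_domain
  refine ⟨ψ, θ, fun ε hε S A i hi => ?_⟩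
  have hψ' := fun x => hψ (withCuts q (A.jump S) x) (q.symm ε, i)
  simp only [errorPoint_iff] at hψ'
  -- The equality is exact: off the unsafe set the only possible output is the right one, and at an
  -- unsafe point some output is `2`, which no characteristic function takes.
  have hU : errorSet q ψ ε i S A = unsafeSet p (A.jump S) (q.symm ε) i := by
    ext x
    rw [errorSet, Set.mem_ofPred_eq, not_iff_comm]
    obtain ⟨hdom, hval, herr⟩ := hψ' x
    constructor
    · intro hx n
      obtain ⟨v, hv⟩ := Part.dom_iff_mem.1 ((hdom n).2 (.inr ⟨_, (answer_iff p hi hx n _).2 rfl⟩))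
      rcases hval n v hv with h | h
      · exact absurd h.2 hx
      · rw [answer_iff p hi hx] at h
        exact Part.eq_some_iff.2 (h ▸ hv)
    · intro h hx
      obtain ⟨n, hn⟩ := herr hx
      have h2 : 2 = _root_.charFun (A.jump (withCuts q S x)) n := Part.mem_some_iff.1 (h n ▸ hn)
      rw [_root_.charFun] at h2
      split_ifs at h2
      all_goals omega
  refine ⟨?_, ?_, fun x n => ?_⟩
  · rw [hU]
    refine (volume_unsafeSet_le p hi _).trans_lt ?_
    rw [q.apply_symm_apply]
    exact one_div_two_pow_add_lt hε
  · rw [hU]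
    ext x
    simp only [Set.mem_iUnion, Set.mem_Ioo, exists_prop]
    exact exists_congr fun a => exists_congr fun b => and_congr_left fun _ =>
      (hθ (A.jump S) ((q.symm ε, i), (a, b))).symm
  · refine ((hψ' x).1 n).2 ?_
    -- The search halts at an unsafe point because unsafety is found, and elsewhere because an
    -- answer exists.
    by_cases hx : x ∈ unsafeSet p (A.jump S) (q.symm ε) i
    · exact .inl hx
    · exact .inr ⟨_, (answer_iff p hi hx n _).2 rfl⟩
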